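/- **Setting.** Let $B\in\mathbb R^{m\times n}$ have columns of Euclidean norm at most $1$, let $p\in(0,1)^n$ and $\varepsilon\in(0,1)$. Write $\|\cdot\|$ for the Euclidean operator norm, $z_0=2p-\mathbf 1$, $D_p=\mathrm{diag}(4p_i(1-p_i))$ and $\eta=(1+\varepsilon)\min\{\|BD_pB^\top\|,\,1+1/\varepsilon\}$. A random $z\in\{\pm1\}^n$ is *feasible* if $\Pr(z_i=1)=p_i$ and $\Pr(z_i=-1)=1-p_i$ for all $i$. **Oracle$(W)$**, for positive definite $W\in\mathbb R^{m\times m}$. Write $W=U\,\mathrm{diag}(\lambda)U^\top$ with $U$ orthogonal, and put $B'=U^\top B$, $w=\lambda/\sum_j\lambda_j$. Start at $z=z_0$. While the set $A=\{i:|z_i|<1\}$ is non-empty: call a row $j$ of $B'$ big if $\sum_{i\in A}(B'_{ji})^2>1+1/\varepsilon$, and light otherwise; let $V$ be the submatrix of $B'$ of the light rows and the columns in $A$, let $w_l$ be the restriction of $w$ to the light rows, and let $G=V^\top\mathrm{diag}(w_l)V$ and $M=(1+\varepsilon)\,\mathrm{diag}(G)-G$; let $y$ maximize $y_A^\top M y_A$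 among the unit vectors that vanish off $A$ and satisfy $(B'y)_j=0$ for all big rows $j$; let $\gamma_\pm=\max\{\gamma: z\pm\gamma y\in[-1,1]^n\}$, and replace $z$ by $z+\gamma_+y$ with probability $\gamma_- /(\gamma_++\gamma_-)$ and by $z-\gamma_-y$ otherwise. Return $z$. **MWU.** Start with $W_0=I$. In pass $t=1,2,\dots$ draw $z_t\leftarrow$ Oracle$(W_{t-1})$ and obtain a matrix $M_t$, which is either (a) the covariance matrix of $Bz$ for $z\leftarrow$ Oracle$(W_{t-1})$, or (b) the empirical mean $\frac1N\sum_{k=1}^N B(z_{t,k}-z_0)(z_{t,k}-z_0)^\top B^\top$ of $N$ further independent samples $z_{t,k}\leftarrow$ Oracle$(W_{t-1})$. If $M_t=0$, return $z_t$. Otherwise put $\alpha_t=\varepsilon/(6\|M_t\|)$ and $W_t=\exp(\sum_{\tau\le t}\alpha_\tau M_\tau)$; stop as soon as $\alpha=\sum_{\tau\le t}\alpha_\tau\ge 2\ln m/(\varepsilon\eta)$, and return $z_\tau$ with probability $\alpha_\tau/\alpha$. **Running time** counts real arithmetic operations, comparisons and coin flips, where the spectral decomposition, the exponential and the norm of an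 $m\times m$ matrix cost $m^3$ and the maximization defining $y$ costs $(m+n)^3$; in version (a) the covariance matrix is supplied in explicit form with the oracle call, at cost $m^2$. **Theorem.** There are constants $C,k\in\mathbb N$ such that for all $m,n,B,p,\varepsilon$ as above: (a) MWU with explicit covariance matrices always halts within $C(m+n+1/\varepsilon)^k$ steps and returns a feasible random $z\in\{\pm1\}^n$ with $$\|\mathrm{Cov}(Bz)\|\le(1+\varepsilon)^2\min\Big\{\|BD_pB^\top\|,\;1+\frac1\varepsilon\Big\}.$$ (b) With $Q=C(m+n+1/\varepsilon+1/\eta)^k$ (where $1/\eta$ is read as $0$ if $\eta=0$), for every $N\ge Q$, MWU with empirical covariance matrices of $N$ samples always halts within $N\cdot Q$ steps and returns a feasible random $z\in\{\pm1\}^n$ that satisfies the same bound. -/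

import Mathlib

open scoped Matrix

/-! ### Randomized real-number computations with a step count -/

/-- A randomized computation on a real RAM, given by the joint law of its outcome and of the number
of elementary steps it spends.  The outcome `none` means that the run was cut off because some
while loop exceeded the number of passes it was allowed. -/
def RComp (α : Type) : Type := PMF (Option α × ℕ)

namespace RComp

/-- Return `a` after spending `c` elementary steps. -/
noncomputable def step {α : Type} (c : ℕ) (a : α) : RComp α := PMF.pure (some a, c)

/-- A run that is cut off. -/
noncomputable def cutOff {α : Type} : RComp α := PMF.pure (none, 0)

/-- Sequential composition; the random choices of the two parts are independent and their step
counts add up. -/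
noncomputable def seq {α β : Type} (c : RComp α) (f : α → RComp β) : RComp β :=
  PMF.bind c fun r =>
    match r.1 with
    | none => PMF.pure (none, r.2)
    | some a => PMF.map (fun s : Option β × ℕ => (s.1, r.2 + s.2)) (f a)

noncomputable instance : Monad RComp where
  pure a := step 0 a
  bind c f := seq c f

/-- One biased coin flip, `true` with probability `q` (where `q` is clamped to `[0, 1]`). -/
noncomputable def coin (q : ℝ) : RComp Bool :=
  PMF.map (fun b => (some b, 1))
    (PMF.ofFintype
      (fun b : Bool => ENNReal.ofReal (if b then max 0 (min q 1) else 1 - max 0 (min q 1)))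
      (by
        rw [Fintype.sum_bool, ← ENNReal.ofReal_add (by simp) (by simp)]
        simp))

/-- A while loop: `body s` either yields the next state (`inl`) or leaves the loop (`inr`).
The run is cut off if the loop is not left within `K` passes. -/
noncomputable def loop {σ α : Type} (body : σ → RComp (σ ⊕ α)) : ℕ → σ → RComp α
  | 0, _ => cutOff
  | K + 1, s => do
    match (← body s) with
    | Sum.inl s' => loop body K s'
    | Sum.inr a => step 1 a

/-- Sample from a list of weighted items, each item with probability weight / total weight. -/
noncomputable def sample {α : Type} : List (ℝ × α) → RComp α
  | [] => cutOff
  | (w, a) :: l => do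
    let q ← step (l.length + 2) (w / (w + (l.map Prod.fst).sum))
    if (← coin q) then step 1 a else sample l

/-- The law of the outcome. -/
noncomputable def law {α : Type} (c : RComp α) : PMF (Option α) := PMF.map Prod.fst c

/-- Every run of `c` spends at most `T` elementary steps. -/
def StepsAtMost {α : Type} (c : RComp α) (T : ℝ) : Prop :=
  ∀ r ∈ PMF.support c, (r.2 : ℝ) ≤ T

end RComp

/-! ### Feasible assignments and covariance -/

/-- The operator norm of a square matrix induced by the Euclidean norm. -/
noncomputable def opNorm {m : ℕ} (A : Matrix (Fin m) (Fin m) ℝ) : ℝ :=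
  ‖Matrix.toEuclideanCLM (𝕜 := ℝ) A‖

/-- `‖B‖_{1,2} ≤ 1`: every column of `B` has Euclidean norm at most one. -/
def ColumnsAtMostOne {m n : ℕ} (B : Matrix (Fin m) (Fin n) ℝ) : Prop :=
  ∀ i, ‖WithLp.toLp 2 (fun j => B j i)‖ ≤ 1

/-- A feasible distribution: it is supported on `{±1}^n`, and the `i`-th coordinate is `1` with
probability `p i` and `-1` with probability `1 - p i`. -/
def Feasible {n : ℕ} (p : Fin n → ℝ) (D : PMF (Fin n → ℝ)) : Prop :=
  (∀ z ∈ D.support, ∀ i, z i = 1 ∨ z i = -1) ∧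
  ∀ i, D.toMeasure {z | z i = 1} = ENNReal.ofReal (p i) ∧
    D.toMeasure {z | z i = -1} = ENNReal.ofReal (1 - p i)

/-- The covariance matrix of `B z` for `z` drawn from `D`. -/
noncomputable def covMat {m n : ℕ} (B : Matrix (Fin m) (Fin n) ℝ) (D : PMF (Fin n → ℝ)) :
    Matrix (Fin m) (Fin m) ℝ :=
  Matrix.of fun j k =>
    ProbabilityTheory.covariance (fun z => (B *ᵥ z) j) (fun z => (B *ᵥ z) k) D.toMeasure

/-- `‖B D_p Bᵀ‖`, where `D_p` is diagonal with entries `4 p_i (1 - p_i)`. -/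
noncomputable def bernoulliValue {m n : ℕ} (B : Matrix (Fin m) (Fin n) ℝ) (p : Fin n → ℝ) : ℝ :=
  opNorm (B * Matrix.diagonal (fun i => 4 * p i * (1 - p i)) * Bᵀ)

/-- `z₀ = 2p - 1`, the mean of a feasible assignment. -/
def meanVec {n : ℕ} (p : Fin n → ℝ) : Fin n → ℝ := fun i => 2 * p i - 1

/-! ### The random-walk oracle

Costs: one step per real arithmetic operation, comparison or coin flip (up to a constant factor);
spectral decomposition, exponential and operator norm of an `m × m` matrix cost `m ^ 3` steps, and
maximizing a quadratic form in `n` variables over the unit sphere under at most `m` linear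
constraints costs `(m + n) ^ 3` steps. -/

namespace RandomWalk

open Classical in
/-- An orthogonal matrix `U` of eigenvectors and the vector `lam` of eigenvalues, with
`W = U * diagonal lam * Uᵀ` (for symmetric `W`; the oracle is called for no other). -/
noncomputable def eigen {m : ℕ} (W : Matrix (Fin m) (Fin m) ℝ) :
    Matrix (Fin m) (Fin m) ℝ × (Fin m → ℝ) :=
  if h : W.IsHermitian then (h.eigenvectorUnitary, h.eigenvalues) else (1, 0)

open Classical in
/-- The alive coordinates. -/
noncomputable def alive {n : ℕ} (z : Fin n → ℝ) : Finset (Fin n) :=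
  Finset.univ.filter fun i => |z i| < 1

open Classical in
/-- The big rows, that is, those with squared norm above `1 + 1/ε` on the alive columns. -/
noncomputable def bigRows {m n : ℕ} (ε : ℝ) (B : Matrix (Fin m) (Fin n) ℝ) (A : Finset (Fin n)) :
    Finset (Fin m) :=
  Finset.univ.filter fun j => 1 + 1 / ε < ∑ i ∈ A, B j i ^ 2

open Classical in
/-- `V_l`, the submatrix of `B` with the rows that are not big and the alive columns, padded by
zeros. -/
noncomputable def lightPart {m n : ℕ} (ε : ℝ) (B : Matrix (Fin m) (Fin n) ℝ)
    (A : Finset (Fin n)) : Matrix (Fin m) (Fin n) ℝ :=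
  Matrix.of fun j i => if j ∉ bigRows ε B A ∧ i ∈ A then B j i else 0

/-- `M = (1 + ε) diag(V_lᵀ W V_l) - V_lᵀ W V_l` for `W = diagonal w`, padded by zeros. -/
noncomputable def walkMatrix {m n : ℕ} (ε : ℝ) (B : Matrix (Fin m) (Fin n) ℝ) (w : Fin m → ℝ)
    (A : Finset (Fin n)) : Matrix (Fin n) (Fin n) ℝ :=
  let G := (lightPart ε B A)ᵀ * Matrix.diagonal w * lightPart ε B A
  (1 + ε) • Matrix.diagonal G.diag - G

/-- The vectors among which the update direction is chosen: unit vectors that vanish off the alive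
coordinates and are orthogonal to the big rows. -/
def candidates {m n : ℕ} (ε : ℝ) (B : Matrix (Fin m) (Fin n) ℝ) (A : Finset (Fin n)) :
    Set (Fin n → ℝ) :=
  {y | (∀ i, i ∉ A → y i = 0) ∧ (∀ j ∈ bigRows ε B A, (B *ᵥ y) j = 0) ∧
    ‖WithLp.toLp 2 y‖ = 1}

/-- `y` is a candidate that maximizes `yᵀ M y`. -/
def IsDirection {m n : ℕ} (ε : ℝ) (B : Matrix (Fin m) (Fin n) ℝ) (w : Fin m → ℝ)
    (A : Finset (Fin n)) (y : Fin n → ℝ) : Prop :=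
  y ∈ candidates ε B A ∧ IsMaxOn (fun x => x ⬝ᵥ (walkMatrix ε B w A *ᵥ x)) (candidates ε B A) y

open Classical in
/-- The update direction, an arbitrary maximizer. -/
noncomputable def direction {m n : ℕ} (ε : ℝ) (B : Matrix (Fin m) (Fin n) ℝ) (w : Fin m → ℝ)
    (A : Finset (Fin n)) : Fin n → ℝ :=
  if h : ∃ y, IsDirection ε B w A y then h.choose else 0

/-- `max {γ : z + γ y ∈ [-1, 1]^n}`. -/
noncomputable def maxStep {n : ℕ} (z y : Fin n → ℝ) : ℝ :=
  sSup {γ : ℝ | ∀ i, z i + γ * y i ∈ Set.Icc (-1 : ℝ) 1}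

open Classical in
/-- One pass of the walk for the diagonal weight `diagonal w`. -/
noncomputable def walkStep {m n : ℕ} (ε : ℝ) (B : Matrix (Fin m) (Fin n) ℝ) (w : Fin m → ℝ)
    (z : Fin n → ℝ) : RComp ((Fin n → ℝ) ⊕ (Fin n → ℝ)) := do
  let A ← RComp.step (n + 1) (alive z)
  if A = ∅ then
    RComp.step 1 (Sum.inr z)
  else
    -- light and big rows and the matrix `M`, then the maximization
    let y ← RComp.step (m * n + m * n ^ 2 + (m + n) ^ 3) (direction ε B w A)
    let γp ← RComp.step (n + 1) (maxStep z y)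
    let γm ← RComp.step (n + 1) (maxStep z (-y))
    let up ← RComp.coin (γm / (γp + γm))
    RComp.step (n + 1) (Sum.inl (z + (if up then γp else -γm) • y))

/-- The random-walk oracle: it passes to an eigenbasis of `W`, normalizes the trace to one, and
walks from `2p - 1` to a vertex of the cube. -/
noncomputable def oracle {m n : ℕ} (K : ℕ) (ε : ℝ) (B : Matrix (Fin m) (Fin n) ℝ) (p : Fin n → ℝ)
    (W : Matrix (Fin m) (Fin m) ℝ) : RComp (Fin n → ℝ) := do
  let UL ← RComp.step (m ^ 3) (eigen W)
  let B' ← RComp.step (m * m * n) (UL.1ᵀ * B)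
  let w ← RComp.step (2 * m) (fun j => UL.2 j / ∑ k, UL.2 k)
  let z₀ ← RComp.step n (meanVec p)
  RComp.loop (walkStep ε B' w) K z₀

end RandomWalk

/-! ### The multiplicative weights update algorithm -/

namespace MWU

/-- The state of the main loop. -/
structure State (m n : ℕ) where
  /-- the current weight matrix -/
  W : Matrix (Fin m) (Fin m) ℝ
  /-- the sum of `α_τ Cov(B z_τ)` so far -/
  S : Matrix (Fin m) (Fin m) ℝ
  /-- the sum of the `α_τ` so far -/
  total : ℝ
  /-- the pairs `(α_τ, z_τ)` so far -/
  items : List (ℝ × (Fin n → ℝ))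

/-- The parameter `η = (1 + ε) min {‖B D_p Bᵀ‖, 1 + 1/ε}`. -/
noncomputable def eta {m n : ℕ} (ε : ℝ) (B : Matrix (Fin m) (Fin n) ℝ) (p : Fin n → ℝ) : ℝ :=
  (1 + ε) * min (bernoulliValue B p) (1 + 1 / ε)

open Classical in
/-- One pass of the main loop, with oracle `O` and with `cov W` the procedure that supplies the
covariance matrix of `B z` for `z ← O W`.  If that matrix is zero, then `ε / (6 ‖Cov‖)` is infinite,
and all the weight goes to the current vector, which is returned.  The loop test comes at the end
of the pass, so that there is at least one pass also if `log m = 0`. -/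
noncomputable def pass {m n : ℕ} (O : Matrix (Fin m) (Fin m) ℝ → RComp (Fin n → ℝ))
    (cov : Matrix (Fin m) (Fin m) ℝ → RComp (Matrix (Fin m) (Fin m) ℝ)) (η ε : ℝ)
    (s : State m n) : RComp (State m n ⊕ (Fin n → ℝ)) := do
  let z ← O s.W
  let M ← cov s.W
  let nrm ← RComp.step (m ^ 3 + 1) (opNorm M)
  if nrm = 0 then
    RComp.step 1 (Sum.inr z)
  else
    let a ← RComp.step 2 (ε / (6 * nrm))
    let S ← RComp.step (2 * m ^ 2) (s.S + a • M)
    let W ← RComp.step (m ^ 3) (NormedSpace.exp S)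
    let total ← RComp.step 1 (s.total + a)
    let items ← RComp.step (n + 1) (s.items ++ [(a, z)])
    let goOn ← RComp.step 4 (decide (total < 2 * Real.log m / (ε * η)))
    if goOn then
      RComp.step 1 (Sum.inl ⟨W, S, total, items⟩)
    else do
      let r ← RComp.sample items
      RComp.step 1 (Sum.inr r)

/-- The algorithm with the random-walk oracle and a procedure `cov` for the covariance matrices.
No while loop may make more than `K` passes. -/
noncomputable def run {m n : ℕ} (K : ℕ)
    (cov : Matrix (Fin m) (Fin m) ℝ → RComp (Matrix (Fin m) (Fin m) ℝ))
    (ε : ℝ) (B : Matrix (Fin m) (Fin n) ℝ) (p : Fin n → ℝ) : RComp (Fin n → ℝ) := do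
  let η ← RComp.step (4 * n + m * n + m * m * n + m ^ 3 + 4) (eta ε B p)
  let W₀ ← RComp.step (m ^ 2) (1 : Matrix (Fin m) (Fin m) ℝ)
  RComp.loop (pass (RandomWalk.oracle K ε B p) cov η ε) K ⟨W₀, 0, 0, []⟩

/-- The covariance matrix of `B z`, `z ← oracle W`, supplied in explicit form along with the oracle
call; only reading its `m ^ 2` entries is charged. -/
noncomputable def exactCov {m n : ℕ} (K : ℕ) (ε : ℝ) (B : Matrix (Fin m) (Fin n) ℝ)
    (p : Fin n → ℝ) (W : Matrix (Fin m) (Fin m) ℝ) : RComp (Matrix (Fin m) (Fin m) ℝ) :=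
  RComp.step (m ^ 2)
    (covMat B ((RandomWalk.oracle K ε B p W).law.map fun r => r.getD 0))

/-- The sum of `B (z - z₀) (z - z₀)ᵀ Bᵀ` over `N` independent samples `z ← oracle W`. -/
noncomputable def sampleSum {m n : ℕ} (K : ℕ) (ε : ℝ) (B : Matrix (Fin m) (Fin n) ℝ)
    (p : Fin n → ℝ) (W : Matrix (Fin m) (Fin m) ℝ) : ℕ → RComp (Matrix (Fin m) (Fin m) ℝ)
  | 0 => RComp.step (m ^ 2) 0
  | N + 1 => do
    let z ← RandomWalk.oracle K ε B p W
    let v ← RComp.step (2 * m * n + 3 * n) (B *ᵥ (z - meanVec p))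
    let rest ← sampleSum K ε B p W N
    RComp.step (2 * m ^ 2) (Matrix.vecMulVec v v + rest)

/-- The empirical estimate of the covariance matrix from `N` independent samples. -/
noncomputable def empiricalCov {m n : ℕ} (N K : ℕ) (ε : ℝ) (B : Matrix (Fin m) (Fin n) ℝ)
    (p : Fin n → ℝ) (W : Matrix (Fin m) (Fin m) ℝ) : RComp (Matrix (Fin m) (Fin m) ℝ) := do
  let S ← sampleSum K ε B p W N
  RComp.step (m ^ 2 + 1) ((1 / (N : ℝ)) • S)

/-- The algorithm with explicit covariance matrices. -/
noncomputable def withExactCov {m n : ℕ} (K : ℕ) (ε : ℝ) (B : Matrix (Fin m) (Fin n) ℝ)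
    (p : Fin n → ℝ) : RComp (Fin n → ℝ) :=
  run K (exactCov K ε B p) ε B p

/-- The algorithm with every covariance matrix replaced by an empirical mean of `N` samples. -/
noncomputable def withSampledCov {m n : ℕ} (N K : ℕ) (ε : ℝ) (B : Matrix (Fin m) (Fin n) ℝ)
    (p : Fin n → ℝ) : RComp (Fin n → ℝ) :=
  run K (empiricalCov N K ε B p) ε B p

end MWU

/-- No run of `c` is cut off, and the law `D` of the returned vector is feasible and satisfies
`‖Cov(B z)‖ ≤ (1 + ε)² min {‖B D_p Bᵀ‖, 1 + 1/ε}`. -/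
def ReturnsGoodAssignment {m n : ℕ} (ε : ℝ) (B : Matrix (Fin m) (Fin n) ℝ) (p : Fin n → ℝ)
    (c : RComp (Fin n → ℝ)) : Prop :=
  ∃ D : PMF (Fin n → ℝ), c.law = D.map some ∧ Feasible p D ∧
    opNorm (covMat B D) ≤ (1 + ε) ^ 2 * min (bernoulliValue B p) (1 + 1 / ε)

/-! The output is z_τ with probability α_τ/α, and all oracle laws have the same mean z_0. Hence
second moments about z_0 are covariances, they mix linearly, and the covariance of the output is the
expectation of the α-weighted mean of the covariances C_τ of Bz under the oracle for W_{τ-1}. Two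
facts bound it.

The oracle satisfies tr(C W) ≤ η tr W. In an eigenbasis of W put ρ_j(z) = Σ_i B'_{ji}² (1 - z_i²).
The potential Σ_j w_j (B'(z - z_0))_j² + (1+ε) Σ_j w_j min(ρ_j(z), 1+1/ε) is a supermartingale
(`IsMove.potential_le`): in light rows the loss of ρ_j pays for the growth of the square, and in big
rows the square does not grow because B'y vanishes there. Its initial value is at most η. A
direction of this quality exists by counting dimensions (`exists_mem_form_le`, `direction_spec`):
fewer than ε|A|/(1+ε) rows are big, so the admissible subspace has dimension above |A|/(1+ε),
whereas the weighted light matrix with normalized columns has squared Frobenius norm at most |A|;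
some vector of the subspace is therefore stretched by a factor of at most 1+ε in square.

Multiplicative weights: if M_t differs from the true covariance by e_t in entrywise ℓ1 norm, a pass
multiplies tr exp(S) by at most exp((1+2ε/5) α_t (η + e_t)). This rests on `trace_exp_add_le`, which
is derived from scalar inequalities summed over pairs of eigenvectors, with no appeal to
Golden–Thompson. Since exp(vᵀSv) ≤ tr exp(S) for unit v, the form vᵀSv/α is at most (1+2ε/5)η + (ln
m)/α plus errors, and the stopping rule makes (ln m)/α at most εη/2. The remaining εη/10 absorbs the
errors, which vanish for explicit covariances and are small in expectation for empirical ones by a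
second-moment bound.

The norms of the M_t are polynomially bounded, so the α_t are bounded below and there are few
passes. With explicit covariances the norm bound is n²η, so that η cancels; the empirical bound
(2n)² leaves a factor 1/η.

To handle the randomness, `shadow` replaces the value of each z_t by its conditional mean given
W_{t-1}. This is legitimate because M_t and z_t are independent given W_{t-1}, and the expected
output value is affine in the values of the samples. -/

open scoped ENNReal

/-! ### Expectations of nonnegative functions -/

namespace PMF

/-- The expectation of a nonnegative function. -/
noncomputable def expect {α : Type*} (p : PMF α) (f : α → ℝ≥0∞) : ℝ≥0∞ := ∑' a, p a * f a

variable {α β : Type*}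

theorem expect_pure (a : α) (f : α → ℝ≥0∞) : (PMF.pure a).expect f = f a := by
  classical
  unfold expect
  rw [tsum_eq_single a]
  · simp
  · intro b hb
    simp [PMF.pure_apply, hb]

theorem expect_bind (p : PMF α) (k : α → PMF β) (f : β → ℝ≥0∞) :
    (p.bind k).expect f = p.expect fun a => (k a).expect f := by
  unfold expect
  simp only [PMF.bind_apply, ← ENNReal.tsum_mul_right, ← ENNReal.tsum_mul_left]
  rw [ENNReal.tsum_comm]
  simp only [mul_assoc]

theorem expect_map (p : PMF α) (g : α → β) (f : β → ℝ≥0∞) :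
    (p.map g).expect f = p.expect (f ∘ g) := by
  rw [PMF.map, expect_bind]
  simp only [Function.comp_def, expect_pure]

theorem expect_mono {p : PMF α} {f g : α → ℝ≥0∞} (h : ∀ a ∈ p.support, f a ≤ g a) :
    p.expect f ≤ p.expect g := by
  refine ENNReal.tsum_le_tsum fun a => ?_
  by_cases ha : p a = 0
  · simp [ha]
  · gcongr
    exact h a ((p.mem_support_iff a).2 ha)

theorem expect_congr {p : PMF α} {f g : α → ℝ≥0∞} (h : ∀ a ∈ p.support, f a = g a) :
    p.expect f = p.expect g :=
  le_antisymm (expect_mono fun a ha => (h a ha).le) (expect_mono fun a ha => (h a ha).ge)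

theorem expect_const (p : PMF α) (c : ℝ≥0∞) : (p.expect fun _ => c) = c := by
  rw [expect, ENNReal.tsum_mul_right, p.tsum_coe, one_mul]

theorem expect_add (p : PMF α) (f g : α → ℝ≥0∞) :
    (p.expect fun a => f a + g a) = p.expect f + p.expect g := by
  simp only [expect, mul_add, ENNReal.tsum_add]

theorem expect_const_mul (p : PMF α) (c : ℝ≥0∞) (f : α → ℝ≥0∞) :
    (p.expect fun a => c * f a) = c * p.expect f := by
  simp only [expect, ← ENNReal.tsum_mul_left]
  exact tsum_congr fun a => by ring

theorem expect_comm (p : PMF α) (q : PMF β) (f : α → β → ℝ≥0∞) :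
    (p.expect fun a => q.expect (f a)) = q.expect fun b => p.expect fun a => f a b := by
  simp only [expect, ← ENNReal.tsum_mul_left]
  rw [ENNReal.tsum_comm]
  exact tsum_congr fun b => tsum_congr fun a => by ring

end PMF

/-! ### Expectations and step bounds of randomized computations -/

namespace RComp

variable {α β σ : Type}

/-- The joint law of the outcome and of the number of steps. -/
def toPMF (c : RComp α) : PMF (Option α × ℕ) := c

theorem toPMF_bind (c : RComp α) (k : α → RComp β) :
    (c >>= k).toPMF = c.toPMF.bind fun r =>
      match r.1 with
      | none => PMF.pure (none, r.2)
      | some a => PMF.map (fun s : Option β × ℕ => (s.1, r.2 + s.2)) (k a).toPMF := rfl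

theorem law_eq_map (c : RComp α) : c.law = c.toPMF.map Prod.fst := rfl

/-- The expectation of a nonnegative function of the outcome, where a run that is cut off
contributes zero. -/
noncomputable def ex (c : RComp α) (f : α → ℝ≥0∞) : ℝ≥0∞ :=
  c.toPMF.expect fun r => r.1.elim 0 f

/-- Every run returns, after at most `T` steps, a value that satisfies `P`. -/
def Halts (c : RComp α) (T : ℕ) (P : α → Prop) : Prop :=
  ∀ r ∈ c.toPMF.support, ∃ a, r.1 = some a ∧ P a ∧ r.2 ≤ T

theorem ex_step (k : ℕ) (a : α) (f : α → ℝ≥0∞) : (step k a).ex f = f a := by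
  simp [ex, step, toPMF, PMF.expect_pure]

theorem ex_cutOff (f : α → ℝ≥0∞) : (cutOff : RComp α).ex f = 0 := by
  simp [ex, cutOff, toPMF, PMF.expect_pure]

theorem ex_bind (c : RComp α) (k : α → RComp β) (f : β → ℝ≥0∞) :
    (c >>= k).ex f = c.ex fun a => (k a).ex f := by
  rw [ex, toPMF_bind, PMF.expect_bind, ex]
  congr 1
  funext r
  rcases r with ⟨_ | a, t⟩
  · simp [PMF.expect_pure]
  · simp only [PMF.expect_map, Option.elim]
    rfl

theorem ex_coin (q : ℝ) (h0 : 0 ≤ q) (h1 : q ≤ 1) (f : Bool → ℝ≥0∞) :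
    (coin q).ex f = ENNReal.ofReal q * f true + ENNReal.ofReal (1 - q) * f false := by
  change PMF.expect (PMF.map _ (PMF.ofFintype _ _)) _ = _
  rw [PMF.expect_map, PMF.expect, tsum_fintype, Fintype.sum_bool]
  simp [h0, h1]

/-- Tonelli for two independent computations. This is how the independence of the sample z_t and the
matrix M_t, given the weights, enters. -/
theorem ex_comm (c : RComp α) (d : RComp β) (f : α → β → ℝ≥0∞) :
    (c.ex fun a => d.ex (f a)) = d.ex fun b => c.ex fun a => f a b := by
  have h := PMF.expect_comm c.toPMF d.toPMF
    fun r s => r.1.elim 0 fun a => s.1.elim 0 fun b => f a b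
  simp only [ex]
  convert h using 3 with r r
  · rcases r with ⟨_ | a, t⟩
    · simp [PMF.expect_const]
    · rfl
  · rcases r with ⟨_ | a, t⟩
    · have : ∀ r : Option α × ℕ, (r.1.elim 0 fun _ => (0 : ℝ≥0∞)) = 0 := by
        rintro ⟨_ | _, _⟩ <;> rfl
      simp [this, PMF.expect_const]
    · rfl

theorem ex_add (c : RComp α) (f g : α → ℝ≥0∞) :
    (c.ex fun a => f a + g a) = c.ex f + c.ex g := by
  simp only [ex, ← PMF.expect_add]
  congr 1
  funext r
  rcases r with ⟨_ | a, t⟩ <;> simp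

theorem ex_const_mul (c : RComp α) (k : ℝ≥0∞) (f : α → ℝ≥0∞) :
    (c.ex fun a => k * f a) = k * c.ex f := by
  simp only [ex, ← PMF.expect_const_mul]
  congr 1
  funext r
  rcases r with ⟨_ | a, t⟩ <;> simp

section Halts

variable {c : RComp α} {T : ℕ} {P : α → Prop}

theorem Halts.ex_mono (h : c.Halts T P) {f g : α → ℝ≥0∞} (hfg : ∀ a, P a → f a ≤ g a) :
    c.ex f ≤ c.ex g := by
  refine PMF.expect_mono fun r hr => ?_
  obtain ⟨a, ha, hP, -⟩ := h r hr
  simpa [ha] using hfg a hP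

theorem Halts.ex_congr (h : c.Halts T P) {f g : α → ℝ≥0∞} (hfg : ∀ a, P a → f a = g a) :
    c.ex f = c.ex g :=
  le_antisymm (h.ex_mono fun a ha => (hfg a ha).le) (h.ex_mono fun a ha => (hfg a ha).ge)

theorem Halts.ex_const (h : c.Halts T P) (k : ℝ≥0∞) : (c.ex fun _ => k) = k := by
  rw [ex, ← PMF.expect_const c.toPMF k]
  refine PMF.expect_congr fun r hr => ?_
  obtain ⟨a, ha, -, -⟩ := h r hr
  simp [ha, PMF.expect_const]

theorem Halts.mono (h : c.Halts T P) {T' : ℕ} {P' : α → Prop} (hT : T ≤ T')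
    (hP : ∀ a, P a → P' a) : c.Halts T' P' := fun r hr => by
  obtain ⟨a, ha, h1, h2⟩ := h r hr
  exact ⟨a, ha, hP a h1, h2.trans hT⟩

theorem halts_step (k : ℕ) (a : α) (h : P a) : (step k a).Halts k P := by
  intro r hr
  change r ∈ (PMF.pure (some a, k)).support at hr
  rw [PMF.support_pure, Set.mem_singleton_iff] at hr
  subst hr
  exact ⟨a, rfl, h, le_rfl⟩

theorem halts_step_of_le {k : ℕ} {a : α} (hk : k ≤ T) (h : P a) : (step k a).Halts T P :=
  (halts_step k a h).mono hk fun _ h => h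

theorem Halts.bind (h : c.Halts T P) {k : α → RComp β} {T' : ℕ} {P' : β → Prop}
    (hk : ∀ a, P a → (k a).Halts T' P') : (c >>= k).Halts (T + T') P' := by
  intro r hr
  rw [toPMF_bind, PMF.mem_support_bind_iff] at hr
  obtain ⟨s, hs, hr⟩ := hr
  obtain ⟨a, ha, hP, ht⟩ := h s hs
  simp only [ha] at hr
  rw [PMF.mem_support_map_iff] at hr
  obtain ⟨u, hu, rfl⟩ := hr
  obtain ⟨b, hb, hP', ht'⟩ := hk a hP u hu
  exact ⟨b, hb, hP', by simp only; omega⟩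

theorem halts_step_bind {k T₀ : ℕ} {a : α} {f : α → RComp β} {P' : β → Prop}
    (h : (f a).Halts T₀ P') (hT : k + T₀ ≤ T) : (step k a >>= f).Halts T P' :=
  ((halts_step (P := fun b => b = a) k a rfl).bind fun b hb => by
    subst hb
    exact h).mono hT fun _ h => h

theorem halts_coin {P : Bool → Prop} (q : ℝ) (ht : 0 < q → P true) (hf : q < 1 → P false) :
    (coin q).Halts 1 P := by
  intro r hr
  change r ∈ (PMF.map _ (PMF.ofFintype _ _)).support at hr
  rw [PMF.mem_support_map_iff] at hr
  obtain ⟨b, hb, rfl⟩ := hr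
  refine ⟨b, rfl, ?_, le_rfl⟩
  rw [PMF.mem_support_iff, PMF.ofFintype_apply] at hb
  cases b
  · apply hf
    simp only [Bool.false_eq_true, if_false, ne_eq, ENNReal.ofReal_eq_zero, not_le, sub_pos] at hb
    by_contra! h
    simp [h] at hb
  · apply ht
    simp only [if_true, ne_eq, ENNReal.ofReal_eq_zero, not_le] at hb
    by_contra! h
    simp only [lt_max_iff, lt_self_iff_false, lt_min_iff, false_or] at hb
    linarith

theorem Halts.stepsAtMost (h : c.Halts T P) {T' : ℝ} (hT : (T : ℝ) ≤ T') : c.StepsAtMost T' := by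
  intro r hr
  obtain ⟨a, -, -, ht⟩ := h r hr
  exact le_trans (by exact_mod_cast ht) hT

/-- A computation that halts never has outcome `none`, so the default `d` is never used. -/
theorem Halts.law_eq (h : c.Halts T P) (d : α) :
    c.law = (c.law.map fun r => r.getD d).map some := by
  rw [law_eq_map, PMF.map_comp, PMF.map_comp, PMF.map, PMF.map]
  refine PMF.ext fun x => ?_
  rw [PMF.bind_apply, PMF.bind_apply]
  refine tsum_congr fun r => ?_
  by_cases hr : c.toPMF r = 0
  · rw [hr, zero_mul, zero_mul]
  · obtain ⟨a, ha, -, -⟩ := h r hr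
    simp [ha]

theorem Halts.expect_law (h : c.Halts T P) (d : α) (f : α → ℝ≥0∞) :
    (c.law.map fun r => r.getD d).expect f = c.ex f := by
  rw [law_eq_map, PMF.expect_map, PMF.expect_map, ex]
  refine PMF.expect_congr fun r hr => ?_
  obtain ⟨a, ha, -, -⟩ := h r hr
  simp [ha]

theorem Halts.of_mem_support_law (h : c.Halts T P) (d : α) {a : α}
    (ha : a ∈ (c.law.map fun r => r.getD d).support) : P a := by
  rw [law_eq_map, PMF.map_comp, PMF.mem_support_map_iff] at ha
  obtain ⟨r, hr, rfl⟩ := ha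
  obtain ⟨b, hb, hP, -⟩ := h r hr
  simpa [hb] using hP

end Halts

/-! ### Loops -/

theorem ex_loop_succ (body : σ → RComp (σ ⊕ α)) (K : ℕ) (s : σ) (f : α → ℝ≥0∞) :
    (loop body (K + 1) s).ex f =
      (body s).ex (Sum.elim (fun s' => (loop body K s').ex f) f) := by
  rw [loop, ex_bind]
  congr 1
  funext r
  rcases r with s' | a
  · rfl
  · exact ex_step 1 a f

/-- A loop whose states carry a bound on the number of remaining passes. -/
theorem halts_loop {body : σ → RComp (σ ⊕ α)} {T : ℕ} {I : ℕ → σ → Prop} {P : α → Prop}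
    (hbody : ∀ r s, I r s → (body s).Halts T (Sum.elim (fun s' => ∃ r' < r, I r' s') P)) :
    ∀ (K r : ℕ) (s : σ), I r s → r < K → (loop body K s).Halts ((r + 1) * (T + 1)) P := by
  intro K
  induction K with
  | zero => intro r s _ h; omega
  | succ K ih =>
    intro r s hI hr
    rw [loop]
    -- One pass costs `T`; afterwards there are either at most `r` further rounds of cost `T + 1` or
    -- the single step of leaving the loop.
    refine ((hbody r s hI).bind (T' := r * (T + 1) + 1) ?_).mono (by ring_nf; omega) fun _ h => h
    rintro (s' | a) h
    · obtain ⟨r', hr', hI'⟩ := h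
      refine (ih r' s' hI' (by omega)).mono ?_ fun _ h => h
      have : (r' + 1) * (T + 1) ≤ r * (T + 1) := Nat.mul_le_mul_right _ hr'
      omega
    · exact halts_step_of_le (by omega) h

/-! ### Sampling from a weighted list -/

/-- The head is taken with probability w/(w+s), where s is the weight of the tail; otherwise the
recursive value carries a denominator s that cancels against the probability s/(w+s). For the last
item s = 0, so the empty list is reached with probability zero. -/
theorem ex_sample : ∀ (l : List (ℝ × α)), l ≠ [] → (∀ x ∈ l, 0 < x.1) → ∀ f : α → ℝ≥0∞,
    (sample l).ex f = (l.map fun x => ENNReal.ofReal x.1 * f x.2).sum /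
      ENNReal.ofReal (l.map Prod.fst).sum := by
  intro l
  induction l with
  | nil => intro h; exact absurd rfl h
  | cons x l ih =>
    obtain ⟨w, a⟩ := x
    intro _ hpos f
    have hw : 0 < w := hpos (w, a) (by simp)
    have hl : ∀ x ∈ l, 0 < x.1 := fun x hx => hpos x (by simp [hx])
    have hs : 0 ≤ (l.map Prod.fst).sum := by
      apply List.sum_nonneg
      intro y hy
      obtain ⟨x, hx, rfl⟩ := List.mem_map.1 hy
      exact (hl x hx).le
    set s := (l.map Prod.fst).sum with hsdef
    have hq0 : 0 ≤ w / (w + s) := by positivity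
    have hq1 : w / (w + s) ≤ 1 := by rw [div_le_one (by positivity)]; linarith
    have h1q : 1 - w / (w + s) = s / (w + s) := by field_simp; ring
    rw [sample, ex_bind, ex_step, ex_bind, ex_coin _ hq0 hq1, h1q]
    simp only [if_true, Bool.false_eq_true, if_false, ex_step, List.map_cons, List.sum_cons]
    rw [← hsdef, ENNReal.ofReal_div_of_pos (by positivity), ENNReal.ofReal_div_of_pos (by positivity)]
    rcases eq_or_ne l [] with rfl | hne
    · simp only [List.map_nil, List.sum_nil] at hsdef ⊢
      simp [hsdef, div_eq_mul_inv, mul_right_comm]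
    · rw [ih hne hl f]
      have hs' : 0 < s := List.sum_pos _ (fun y hy => by
        obtain ⟨x, hx, rfl⟩ := List.mem_map.1 hy
        exact hl x hx) (by simpa using hne)
      have h0 : ENNReal.ofReal s ≠ 0 := by simpa using hs'
      rw [ENNReal.add_div]
      simp only [div_eq_mul_inv]
      congr 1
      · ring
      · rw [show ∀ a b c d : ℝ≥0∞, a * b * (c * d) = (a * d) * (c * b) by intros; ring,
          ENNReal.mul_inv_cancel h0 ENNReal.ofReal_ne_top, one_mul]

theorem halts_sample {P : α → Prop} : ∀ (l : List (ℝ × α)), l ≠ [] →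
    (∀ x ∈ l, 0 < x.1 ∧ P x.2) → (sample l).Halts (l.length * (l.length + 4)) P := by
  intro l
  induction l with
  | nil => intro h; exact absurd rfl h
  | cons x l ih =>
    obtain ⟨w, a⟩ := x
    intro _ hpos
    have hw := hpos (w, a) (by simp)
    rw [sample]
    refine halts_step_bind (T₀ := 1 + (1 + l.length * (l.length + 4))) ?_ (by
      simp only [List.length_cons]; ring_nf; omega)
    -- At the last item the coin has bias exactly 1, so `false` is possible only if the tail is
    -- non-empty; this keeps the cut-off for the empty list out of the support.
    refine (halts_coin (P := fun b => b = true ∨ l ≠ []) _ (fun _ => Or.inl rfl) fun h => ?_).bind ?_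
    · right
      rintro rfl
      simp [hw.1.ne'] at h
    · rintro b hb
      cases b
      · simp only [Bool.false_eq_true, false_or, if_false] at hb ⊢
        exact (ih hb fun x hx => hpos x (by simp [hx])).mono (by omega) fun _ h => h
      · simpa using halts_step_of_le (by omega) hw.2

end RComp

/-! ### Spectral calculus for symmetric real matrices -/

namespace Matrix

variable {m : ℕ}

/-- `U * diagonal x * Uᵀ`. -/
def spectralForm (U : Matrix (Fin m) (Fin m) ℝ) (x : Fin m → ℝ) : Matrix (Fin m) (Fin m) ℝ :=
  U * diagonal x * Uᵀ

theorem IsHermitian.exists_spectralForm {A : Matrix (Fin m) (Fin m) ℝ} (hA : A.IsHermitian) :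
    ∃ (U : Matrix (Fin m) (Fin m) ℝ) (a : Fin m → ℝ), Uᵀ * U = 1 ∧ U * Uᵀ = 1 ∧
      A = spectralForm U a ∧ U = hA.eigenvectorUnitary ∧ a = hA.eigenvalues := by
  refine ⟨hA.eigenvectorUnitary, hA.eigenvalues, ?_, ?_, ?_, rfl, rfl⟩
  · simpa [star_eq_conjTranspose] using Unitary.coe_star_mul_self hA.eigenvectorUnitary
  · simpa [star_eq_conjTranspose] using Unitary.coe_mul_star_self hA.eigenvectorUnitary
  · have h := hA.spectral_theorem
    rw [Unitary.conjStarAlgAut_apply] at h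
    simpa [spectralForm, star_eq_conjTranspose, Function.comp_def] using h

theorem spectralForm_one {U : Matrix (Fin m) (Fin m) ℝ} (hU : U * Uᵀ = 1) :
    spectralForm U 1 = 1 := by
  simp [spectralForm, hU]

theorem spectralForm_mul {U : Matrix (Fin m) (Fin m) ℝ} (hU : Uᵀ * U = 1) (x y : Fin m → ℝ) :
    spectralForm U x * spectralForm U y = spectralForm U (x * y) := by
  have : spectralForm U x * spectralForm U y = U * diagonal x * (Uᵀ * U) * diagonal y * Uᵀ := by
    simp only [spectralForm, Matrix.mul_assoc]
  rw [this, hU, Matrix.mul_one, Matrix.mul_assoc U, diagonal_mul_diagonal]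
  rfl

theorem exp_spectralForm {U : Matrix (Fin m) (Fin m) ℝ} (hU : U * Uᵀ = 1) (x : Fin m → ℝ) :
    NormedSpace.exp (spectralForm U x) = spectralForm U (fun i => Real.exp (x i)) := by
  have hinv : U⁻¹ = Uᵀ := inv_eq_right_inv hU
  have hunit : IsUnit U := by
    rw [isUnit_iff_isUnit_det]
    exact IsUnit.of_mul_eq_one _ (by rw [← det_mul, hU, det_one])
  rw [spectralForm, ← hinv, exp_conj U _ hunit, exp_diagonal, hinv, spectralForm]
  congr 3
  funext i
  rw [Pi.coe_exp, Real.exp_eq_exp_ℝ]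

/-! ### Trace inequalities for exponentials of non-commuting matrices. -/

theorem trace_mul_spectralForm (P U : Matrix (Fin m) (Fin m) ℝ) (x : Fin m → ℝ) :
    (P * spectralForm U x).trace = ∑ i, x i * (Uᵀ * P * U) i i := by
  rw [spectralForm, ← Matrix.mul_assoc, trace_mul_comm, ← Matrix.mul_assoc, ← Matrix.mul_assoc,
    trace]
  exact Finset.sum_congr rfl fun i _ => by rw [diag_apply, mul_diagonal, mul_comm]

/-- The nonnegative weights (UᵀV)_{ij}² do not depend on the eigenvalues. An inequality between
traces of products f(A)g(B) thus follows from the scalar inequality at each pair of eigenvalues,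
without commutativity. -/
theorem trace_spectralForm_mul_spectralForm (U V : Matrix (Fin m) (Fin m) ℝ) (x y : Fin m → ℝ) :
    (spectralForm U x * spectralForm V y).trace =
      ∑ i, ∑ j, x i * y j * (Uᵀ * V) i j ^ 2 := by
  rw [trace_mul_spectralForm, Finset.sum_comm]
  refine Finset.sum_congr rfl fun j _ => ?_
  have : Vᵀ * spectralForm U x * V = (Uᵀ * V)ᵀ * diagonal x * (Uᵀ * V) := by
    simp only [spectralForm, transpose_mul, transpose_transpose, Matrix.mul_assoc]
  rw [this, mul_apply, Finset.mul_sum]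
  exact Finset.sum_congr rfl fun i _ => by rw [mul_diagonal, transpose_apply]; ring

/-- Klein's inequality for the exponential: the scalar tangent bound e^b ≤ e^a + (b - a)e^b, summed
over pairs of eigenvalues. -/
theorem trace_exp_le {A B : Matrix (Fin m) (Fin m) ℝ} (hA : A.IsHermitian) (hB : B.IsHermitian) :
    (NormedSpace.exp B).trace ≤
      (NormedSpace.exp A).trace + ((B - A) * NormedSpace.exp B).trace := by
  obtain ⟨U, a, hU, hU', rfl, -, -⟩ := hA.exists_spectralForm
  obtain ⟨V, b, hV, hV', rfl, -, -⟩ := hB.exists_spectralForm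
  rw [exp_spectralForm hU', exp_spectralForm hV', sub_mul, trace_sub, spectralForm_mul hV]
  have h1 : ∀ y, (spectralForm V y).trace = ∑ i, ∑ j, 1 * y j * (Uᵀ * V) i j ^ 2 := fun y => by
    rw [← Matrix.one_mul (spectralForm V y), ← spectralForm_one hU',
      trace_spectralForm_mul_spectralForm]
    rfl
  have h2 : ∀ x, (spectralForm U x).trace = ∑ i, ∑ j, x i * 1 * (Uᵀ * V) i j ^ 2 := fun x => by
    rw [← Matrix.mul_one (spectralForm U x), ← spectralForm_one hV',
      trace_spectralForm_mul_spectralForm]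
    rfl
  rw [h1, h1, h2, trace_spectralForm_mul_spectralForm]
  simp only [← Finset.sum_sub_distrib, ← Finset.sum_add_distrib]
  refine Finset.sum_le_sum fun i _ => Finset.sum_le_sum fun j _ => ?_
  have h := Real.add_one_le_exp (a i - b j)
  have h3 : Real.exp (a i) = Real.exp (b j) * Real.exp (a i - b j) := by
    rw [← Real.exp_add]; ring_nf
  have h4 : Real.exp (b j) * (a i - b j + 1) ≤ Real.exp (a i) := by rw [h3]; gcongr
  have h5 := mul_le_mul_of_nonneg_right h4 (sq_nonneg ((Uᵀ * V) i j))
  simp only [Pi.mul_apply]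
  nlinarith [h5]

/-- The scalar case (y-x)(e^y - e^x) ≤ (y-x)²(e^x + e^y) carries over since, by cyclicity of the
trace, every word in the expansion reduces to a function of A times a function of B. -/
theorem trace_sub_mul_exp_sub_exp_le {A B : Matrix (Fin m) (Fin m) ℝ} (hA : A.IsHermitian)
    (hB : B.IsHermitian) :
    ((B - A) * (NormedSpace.exp B - NormedSpace.exp A)).trace ≤
      ((B - A) * (B - A) * (NormedSpace.exp A + NormedSpace.exp B)).trace := by
  obtain ⟨U, a, hU, hU', rfl, -, -⟩ := hA.exists_spectralForm
  obtain ⟨V, b, hV, hV', rfl, -, -⟩ := hB.exists_spectralForm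
  rw [exp_spectralForm hU', exp_spectralForm hV']
  set ea := fun i => Real.exp (a i) with hea
  set eb := fun i => Real.exp (b i) with heb
  have h1 : ∀ y, (spectralForm V y).trace = ∑ i, ∑ j, 1 * y j * (Uᵀ * V) i j ^ 2 := fun y => by
    rw [← Matrix.one_mul (spectralForm V y), ← spectralForm_one hU',
      trace_spectralForm_mul_spectralForm]
    rfl
  have h2 : ∀ x, (spectralForm U x).trace = ∑ i, ∑ j, x i * 1 * (Uᵀ * V) i j ^ 2 := fun x => by
    rw [← Matrix.mul_one (spectralForm U x), ← spectralForm_one hV',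
      trace_spectralForm_mul_spectralForm]
    rfl
  have hL : (spectralForm V b - spectralForm U a) * (spectralForm V eb - spectralForm U ea) =
      spectralForm V (b * eb) - spectralForm V b * spectralForm U ea
        - spectralForm U a * spectralForm V eb + spectralForm U (a * ea) := by
    rw [← spectralForm_mul hU, ← spectralForm_mul hV]
    noncomm_ring
  have hR : ((spectralForm V b - spectralForm U a) * (spectralForm V b - spectralForm U a) *
      (spectralForm U ea + spectralForm V eb)).trace =
      (spectralForm V (b * b * eb)).trace + (spectralForm U (a * a * ea)).trace
        - 2 * (spectralForm U a * spectralForm V (b * eb)).trace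
        - 2 * (spectralForm U (a * ea) * spectralForm V b).trace
        + (spectralForm U (a * a) * spectralForm V eb).trace
        + (spectralForm U ea * spectralForm V (b * b)).trace := by
    have e1 : (spectralForm V b - spectralForm U a) * (spectralForm V b - spectralForm U a) *
      (spectralForm U ea + spectralForm V eb) =
      spectralForm V (b * b * eb) + spectralForm U (a * a * ea)
        - spectralForm U a * spectralForm V (b * eb)
        - spectralForm V b * spectralForm U (a * ea)
        + spectralForm U (a * a) * spectralForm V eb
        + spectralForm V (b * b) * spectralForm U ea
        - spectralForm V b * spectralForm U a * spectralForm V eb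
        - spectralForm U a * spectralForm V b * spectralForm U ea := by
      simp only [← spectralForm_mul hU, ← spectralForm_mul hV]
      noncomm_ring
    -- The two words in which A and B alternate twice; a cyclic rotation merges the outer factors,
    -- which share a basis.
    have e2 : (spectralForm V b * spectralForm U a * spectralForm V eb).trace =
        (spectralForm U a * spectralForm V (b * eb)).trace := by
      rw [trace_mul_comm, ← Matrix.mul_assoc, spectralForm_mul hV, trace_mul_comm, mul_comm eb]
    have e3 : (spectralForm U a * spectralForm V b * spectralForm U ea).trace =
        (spectralForm U (a * ea) * spectralForm V b).trace := by
      rw [trace_mul_comm, ← Matrix.mul_assoc, spectralForm_mul hU, mul_comm ea]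
    rw [e1]
    simp only [trace_add, trace_sub, e2, e3]
    rw [trace_mul_comm (spectralForm V b), trace_mul_comm (spectralForm V (b * b))]
    ring
  rw [hL, hR]
  simp only [trace_add, trace_sub]
  rw [trace_mul_comm (spectralForm V b), h1, h1, h2, h2]
  simp only [trace_spectralForm_mul_spectralForm]
  simp only [Finset.mul_sum, ← Finset.sum_sub_distrib, ← Finset.sum_add_distrib]
  refine Finset.sum_le_sum fun i _ => Finset.sum_le_sum fun j _ => ?_
  simp only [Pi.mul_apply, hea, heb]
  have hab : ∀ x y : ℝ, (y - x) * (Real.exp y - Real.exp x) ≤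
      (y - x) ^ 2 * (Real.exp x + Real.exp y) := by
    have key : ∀ x y : ℝ, x ≤ y → Real.exp y - Real.exp x ≤ (y - x) * Real.exp y := by
      intro x y _
      have h := Real.add_one_le_exp (x - y)
      have h3 : Real.exp x = Real.exp y * Real.exp (x - y) := by rw [← Real.exp_add]; ring_nf
      have h4 : Real.exp y * (x - y + 1) ≤ Real.exp x := by rw [h3]; gcongr
      linarith
    intro x y
    rcases le_total x y with h | h
    · have := mul_le_mul_of_nonneg_left (key x y h) (sub_nonneg.2 h)
      nlinarith [mul_nonneg (sq_nonneg (y - x)) (Real.exp_pos x).le]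
    · have := mul_le_mul_of_nonneg_left (key y x h) (sub_nonneg.2 h)
      nlinarith [mul_nonneg (sq_nonneg (y - x)) (Real.exp_pos y).le]
  have h5 := mul_le_mul_of_nonneg_right (hab (a i) (b j)) (sq_nonneg ((Uᵀ * V) i j))
  nlinarith [h5]

/-! ### Quadratic forms, positive semidefinite matrices and the weights update. -/

theorem col_dotProduct_mulVec (P U : Matrix (Fin m) (Fin m) ℝ) (i : Fin m) :
    (Uᵀ * P * U) i i = U.col i ⬝ᵥ (P *ᵥ U.col i) := by
  rw [Matrix.mul_assoc, mul_apply, dotProduct]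
  refine Finset.sum_congr rfl fun k _ => ?_
  rw [transpose_apply, mul_apply]
  rfl

theorem col_dotProduct_col {U : Matrix (Fin m) (Fin m) ℝ} (hU : Uᵀ * U = 1) (i : Fin m) :
    U.col i ⬝ᵥ U.col i = 1 := by
  have := congrFun (congrFun hU i) i
  rwa [mul_apply, one_apply_eq] at this

theorem eigenvalue_eq {U : Matrix (Fin m) (Fin m) ℝ} (hU : Uᵀ * U = 1) (x : Fin m → ℝ)
    (i : Fin m) : U.col i ⬝ᵥ (spectralForm U x *ᵥ U.col i) = x i := by
  rw [← col_dotProduct_mulVec]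
  have : Uᵀ * spectralForm U x * U = (Uᵀ * U) * diagonal x * (Uᵀ * U) := by
    simp only [spectralForm, Matrix.mul_assoc]
  rw [this, hU, Matrix.one_mul, Matrix.mul_one, diagonal_apply_eq]

theorem PosSemidef.dotProduct_mulVec_nonneg' {P : Matrix (Fin m) (Fin m) ℝ} (hP : P.PosSemidef)
    (v : Fin m → ℝ) : 0 ≤ v ⬝ᵥ (P *ᵥ v) := by
  simpa using hP.dotProduct_mulVec_nonneg v

theorem posSemidef_of_dotProduct {P : Matrix (Fin m) (Fin m) ℝ} (hP : P.IsHermitian)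
    (h : ∀ v : Fin m → ℝ, 0 ≤ v ⬝ᵥ (P *ᵥ v)) : P.PosSemidef :=
  PosSemidef.of_dotProduct_mulVec_nonneg hP fun v => by simpa using h v

/-- The trace of the product of a positive semidefinite matrix and a matrix `Δ` is controlled by
the quadratic form of `Δ`. -/
theorem PosSemidef.trace_mul_le {P : Matrix (Fin m) (Fin m) ℝ} (hP : P.PosSemidef)
    {Δ : Matrix (Fin m) (Fin m) ℝ} {c : ℝ} (h : ∀ v, v ⬝ᵥ v = 1 → v ⬝ᵥ (Δ *ᵥ v) ≤ c) :
    (Δ * P).trace ≤ c * P.trace := by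
  obtain ⟨U, a, hU, hU', rfl, -, -⟩ := hP.1.exists_spectralForm
  have ha : ∀ i, 0 ≤ a i := fun i => by
    rw [← eigenvalue_eq hU a i]
    exact hP.dotProduct_mulVec_nonneg' _
  rw [trace_mul_spectralForm, ← Matrix.one_mul (spectralForm U a), trace_mul_spectralForm,
    Finset.mul_sum]
  refine Finset.sum_le_sum fun i _ => ?_
  rw [Matrix.mul_one, hU, one_apply_eq, col_dotProduct_mulVec]
  nlinarith [h _ (col_dotProduct_col hU i), ha i]

theorem PosSemidef.trace_mul_nonneg {P : Matrix (Fin m) (Fin m) ℝ} (hP : P.PosSemidef)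
    {Δ : Matrix (Fin m) (Fin m) ℝ} (h : Δ.PosSemidef) : 0 ≤ (Δ * P).trace := by
  have := hP.trace_mul_le (Δ := -Δ) (c := 0) fun v _ => by
    rw [neg_mulVec, dotProduct_neg, neg_nonpos]
    exact h.dotProduct_mulVec_nonneg' v
  rw [neg_mul, trace_neg] at this
  linarith

/-- The eigenvalues of D lie in [0, δ], so D² ≤ δD; the trace against P is taken in the eigenbasis
of D. -/
theorem PosSemidef.trace_sq_mul_le {D P : Matrix (Fin m) (Fin m) ℝ} (hD : D.PosSemidef)
    (hP : P.PosSemidef) {δ : ℝ} (h : ∀ v, v ⬝ᵥ v = 1 → v ⬝ᵥ (D *ᵥ v) ≤ δ) :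
    (D * D * P).trace ≤ δ * (D * P).trace := by
  obtain ⟨U, a, hU, hU', rfl, -, -⟩ := hD.1.exists_spectralForm
  have ha : ∀ i, 0 ≤ a i ∧ a i ≤ δ := fun i => by
    rw [← eigenvalue_eq hU a i]
    exact ⟨hD.dotProduct_mulVec_nonneg' _, h _ (col_dotProduct_col hU i)⟩
  rw [spectralForm_mul hU, trace_mul_comm, trace_mul_comm (spectralForm U a),
    trace_mul_spectralForm, trace_mul_spectralForm, Finset.mul_sum]
  refine Finset.sum_le_sum fun i _ => ?_
  rw [col_dotProduct_mulVec, Pi.mul_apply]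
  have := mul_nonneg (mul_nonneg (ha i).1 (sub_nonneg.2 (ha i).2))
    (hP.dotProduct_mulVec_nonneg' (U.col i))
  nlinarith

theorem IsHermitian.posSemidef_exp {A : Matrix (Fin m) (Fin m) ℝ} (hA : A.IsHermitian) :
    (NormedSpace.exp A).PosSemidef := by
  have h := hA.exp
  obtain ⟨U, a, hU, hU', rfl, -, -⟩ := hA.exists_spectralForm
  refine posSemidef_of_dotProduct h fun v => ?_
  rw [exp_spectralForm hU', spectralForm, ← mulVec_mulVec, ← mulVec_mulVec, dotProduct_mulVec,
    ← mulVec_transpose, dotProduct]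
  refine Finset.sum_nonneg fun i _ => ?_
  rw [mulVec_diagonal]
  nlinarith [mul_nonneg (Real.exp_pos (a i)).le (mul_self_nonneg ((Uᵀ *ᵥ v) i))]

theorem dotProduct_spectralForm_mulVec (U : Matrix (Fin m) (Fin m) ℝ) (a v : Fin m → ℝ) :
    v ⬝ᵥ (spectralForm U a *ᵥ v) = ∑ i, a i * (Uᵀ *ᵥ v) i ^ 2 := by
  rw [spectralForm, ← mulVec_mulVec, ← mulVec_mulVec, dotProduct_mulVec,
    ← mulVec_transpose, dotProduct]
  refine Finset.sum_congr rfl fun i _ => ?_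
  rw [mulVec_diagonal]
  ring

theorem sum_transpose_mulVec_sq {U : Matrix (Fin m) (Fin m) ℝ} (hU : U * Uᵀ = 1)
    (v : Fin m → ℝ) : ∑ i, (Uᵀ *ᵥ v) i ^ 2 = v ⬝ᵥ v := by
  have := dotProduct_spectralForm_mulVec U 1 v
  rw [spectralForm_one hU, one_mulVec] at this
  simpa using this.symm

/-- One step of the matrix multiplicative weights update. -/
theorem trace_exp_add_le {A D : Matrix (Fin m) (Fin m) ℝ} (hA : A.IsHermitian)
    (hD : D.PosSemidef) {δ : ℝ} (hδ : δ < 1)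
    (h : ∀ v, v ⬝ᵥ v = 1 → v ⬝ᵥ (D *ᵥ v) ≤ δ) :
    (NormedSpace.exp (A + D)).trace ≤
      (NormedSpace.exp A).trace + (1 + δ) / (1 - δ) * (D * NormedSpace.exp A).trace := by
  have hB : (A + D).IsHermitian := hA.add hD.1
  have h1 := trace_exp_le hA hB
  have h2 := trace_sub_mul_exp_sub_exp_le hA hB
  rw [add_sub_cancel_left] at h1 h2
  rw [mul_sub, trace_sub, mul_add, trace_add] at h2
  have h3 := hD.trace_sq_mul_le hA.posSemidef_exp h
  have h4 := hD.trace_sq_mul_le hB.posSemidef_exp h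
  have h5 : (1 - δ) * (D * NormedSpace.exp (A + D)).trace ≤
      (1 + δ) * (D * NormedSpace.exp A).trace := by linarith
  have h6 : (D * NormedSpace.exp (A + D)).trace ≤
      (1 + δ) / (1 - δ) * (D * NormedSpace.exp A).trace := by
    rw [div_mul_eq_mul_div, le_div_iff₀ (by linarith)]
    linarith
  linarith

/-- In an eigenbasis vᵀSv is a convex combination of the eigenvalues with weights (Uᵀv)_i², so
Jensen applies; the weights are then bounded by 1. -/
theorem exp_dotProduct_mulVec_le {S : Matrix (Fin m) (Fin m) ℝ} (hS : S.IsHermitian)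
    {v : Fin m → ℝ} (hv : v ⬝ᵥ v = 1) :
    Real.exp (v ⬝ᵥ (S *ᵥ v)) ≤ (NormedSpace.exp S).trace := by
  obtain ⟨U, a, hU, hU', rfl, -, -⟩ := hS.exists_spectralForm
  have hsum := sum_transpose_mulVec_sq hU' v
  rw [hv] at hsum
  rw [dotProduct_spectralForm_mulVec, exp_spectralForm hU',
    ← Matrix.one_mul (spectralForm U _), trace_mul_spectralForm]
  simp only [hU, one_apply_eq, mul_one]
  have hj := convexOn_exp.map_sum_le (t := Finset.univ) (w := fun i => (Uᵀ *ᵥ v) i ^ 2) (p := a)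
    (fun i _ => sq_nonneg _) hsum (fun i _ => Set.mem_univ _)
  simp only [smul_eq_mul] at hj
  calc _ = Real.exp (∑ i, (Uᵀ *ᵥ v) i ^ 2 * a i) := by
        congr 1; exact Finset.sum_congr rfl fun i _ => mul_comm _ _
    _ ≤ _ := hj
    _ ≤ _ := Finset.sum_le_sum fun i _ => by
        have : (Uᵀ *ᵥ v) i ^ 2 ≤ 1 := by
          rw [← hsum]
          exact Finset.single_le_sum (f := fun i => (Uᵀ *ᵥ v) i ^ 2) (fun i _ => sq_nonneg _)
            (Finset.mem_univ i)
        nlinarith [Real.exp_pos (a i)]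

/-- The sum of the absolute values of the entries. -/
def entrySum (Δ : Matrix (Fin m) (Fin m) ℝ) : ℝ := ∑ j, ∑ k, |Δ j k|

theorem entrySum_nonneg (Δ : Matrix (Fin m) (Fin m) ℝ) : 0 ≤ entrySum Δ :=
  Finset.sum_nonneg fun _ _ => Finset.sum_nonneg fun _ _ => abs_nonneg _

theorem abs_le_one_of_dotProduct {v : Fin m → ℝ} (hv : v ⬝ᵥ v = 1) (j : Fin m) : |v j| ≤ 1 := by
  rw [← sq_le_one_iff_abs_le_one, ← hv, sq]
  exact Finset.single_le_sum (f := fun i => v i * v i) (fun i _ => mul_self_nonneg _)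
    (Finset.mem_univ j)

/-- A crude bound, uniform in v, that suffices for a polynomial number of samples and can be
averaged entry by entry. -/
theorem dotProduct_mulVec_le_entrySum (Δ : Matrix (Fin m) (Fin m) ℝ) {v : Fin m → ℝ}
    (hv : v ⬝ᵥ v = 1) : v ⬝ᵥ (Δ *ᵥ v) ≤ entrySum Δ := by
  unfold dotProduct mulVec entrySum
  simp only [dotProduct, Finset.mul_sum]
  refine Finset.sum_le_sum fun j _ => Finset.sum_le_sum fun k _ => ?_
  refine (le_abs_self _).trans ?_
  rw [abs_mul, abs_mul]
  have h1 := abs_le_one_of_dotProduct hv j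
  have h2 := abs_le_one_of_dotProduct hv k
  calc |v j| * (|Δ j k| * |v k|) ≤ 1 * (|Δ j k| * 1) := by gcongr
    _ = _ := by ring

end Matrix

/-! ### The operator norm and the quadratic form -/

section OpNorm

open Matrix

variable {m : ℕ}

theorem norm_toLp_sq (v : Fin m → ℝ) : ‖WithLp.toLp 2 v‖ ^ 2 = v ⬝ᵥ v := by
  rw [EuclideanSpace.norm_sq_eq]
  simp [dotProduct, sq]

theorem opNorm_nonneg (A : Matrix (Fin m) (Fin m) ℝ) : 0 ≤ opNorm A := norm_nonneg _

theorem opNorm_eq_zero {A : Matrix (Fin m) (Fin m) ℝ} : opNorm A = 0 ↔ A = 0 := by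
  rw [opNorm, norm_eq_zero, EmbeddingLike.map_eq_zero_iff]

theorem dotProduct_mulVec_le_opNorm (A : Matrix (Fin m) (Fin m) ℝ) (v : Fin m → ℝ) :
    v ⬝ᵥ (A *ᵥ v) ≤ opNorm A * (v ⬝ᵥ v) := by
  have h1 : v ⬝ᵥ (A *ᵥ v) =
      inner ℝ (WithLp.toLp 2 v) (Matrix.toEuclideanCLM (𝕜 := ℝ) A (WithLp.toLp 2 v)) := by
    rw [Matrix.toEuclideanCLM_toLp, EuclideanSpace.inner_toLp_toLp, dotProduct_comm]
    simp
  rw [h1, ← norm_toLp_sq]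
  calc _ ≤ _ := real_inner_le_norm _ _
    _ ≤ ‖WithLp.toLp 2 v‖ * (opNorm A * ‖WithLp.toLp 2 v‖) := by
      gcongr
      exact ContinuousLinearMap.le_opNorm _ _
    _ = _ := by ring

theorem Matrix.PosSemidef.opNorm_le {A : Matrix (Fin m) (Fin m) ℝ} (hA : A.PosSemidef) {c : ℝ}
    (hc : 0 ≤ c) (h : ∀ v, v ⬝ᵥ v = 1 → v ⬝ᵥ (A *ᵥ v) ≤ c) : opNorm A ≤ c := by
  obtain ⟨U, a, hU, hU', rfl, -, -⟩ := hA.1.exists_spectralForm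
  have ha : ∀ i, 0 ≤ a i ∧ a i ≤ c := fun i => by
    rw [← eigenvalue_eq hU a i]
    exact ⟨hA.dotProduct_mulVec_nonneg' _, h _ (col_dotProduct_col hU i)⟩
  refine ContinuousLinearMap.opNorm_le_bound _ hc fun x => ?_
  obtain ⟨v, rfl⟩ : ∃ v, x = WithLp.toLp 2 v := ⟨x.ofLp, rfl⟩
  rw [Matrix.toEuclideanCLM_toLp]
  refine le_of_sq_le_sq ?_ (by positivity)
  rw [mul_pow, norm_toLp_sq, norm_toLp_sq]
  have hsymm : (spectralForm U a)ᵀ = spectralForm U a := by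
    simp [spectralForm, Matrix.mul_assoc]
  have : (spectralForm U a *ᵥ v) ⬝ᵥ (spectralForm U a *ᵥ v) =
      v ⬝ᵥ (spectralForm U (a * a) *ᵥ v) := by
    rw [← spectralForm_mul hU, ← mulVec_mulVec, dotProduct_mulVec v, ← mulVec_transpose, hsymm]
  rw [this, dotProduct_spectralForm_mulVec, ← sum_transpose_mulVec_sq hU' v, Finset.mul_sum]
  refine Finset.sum_le_sum fun i _ => mul_le_mul_of_nonneg_right ?_ (sq_nonneg _)
  rw [Pi.mul_apply, sq]
  exact mul_le_mul (ha i).2 (ha i).2 (ha i).1 hc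

end OpNorm

/-! ### The update direction -/

namespace RandomWalk

open Matrix

variable {m n : ℕ}

/-- In a large subspace there is a vector on which the form `(1 + ε) diag(G) - G` is nonnegative,
where `G = Vᵀ diagonal w V`. -/
theorem exists_mem_form_le (V : Matrix (Fin m) (Fin n) ℝ) {w : Fin m → ℝ} (hw : ∀ j, 0 ≤ w j)
    (A : Finset (Fin n)) (hV : ∀ j, ∀ i ∉ A, V j i = 0) {ε : ℝ}
    (H : Submodule ℝ (Fin n → ℝ)) (hH : (A.card : ℝ) < (1 + ε) * Module.finrank ℝ H) :
    ∃ y ∈ H, y ≠ 0 ∧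
      ∑ j, w j * (V *ᵥ y) j ^ 2 ≤ (1 + ε) * ∑ i, (∑ j, w j * V j i ^ 2) * y i ^ 2 := by
  classical
  -- If every nonzero vector of `H` violated the bound, an orthonormal basis of the rescaled space
  -- would have total stretch at least (1+ε) dim H, more than the squared Frobenius norm |A|
  -- permits.
  by_contra! hneg
  set g : Fin n → ℝ := fun i => ∑ j, w j * V j i ^ 2 with hg
  have hg0 : ∀ i, 0 ≤ g i := fun i =>
    Finset.sum_nonneg fun j _ => mul_nonneg (hw j) (sq_nonneg _)
  have hgz : ∀ i, g i = 0 → ∀ j, w j * V j i ^ 2 = 0 := fun i h j =>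
    (Finset.sum_eq_zero_iff_of_nonneg fun j _ => mul_nonneg (hw j) (sq_nonneg _)).1 h j
      (Finset.mem_univ j)
  have hgz' : ∀ i, g i = 0 → ∀ j, √(w j) * V j i = 0 := fun i h j => by
    have := hgz i h j
    rw [mul_eq_zero, sq_eq_zero_iff] at this
    rcases this with h | h <;> simp [h]
  -- Rescaling coordinate i by the weighted norm √g_i of column i turns the diagonal form into the
  -- Euclidean norm.
  let Φ : (Fin n → ℝ) →ₗ[ℝ] EuclideanSpace ℝ (Fin n) :=
    { toFun := fun y => WithLp.toLp 2 fun i => √(g i) * y i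
      map_add' := fun x y => by ext i; simp [mul_add]
      map_smul' := fun c y => by ext i; simp; ring }
  have hΦ : ∀ y, ‖Φ y‖ ^ 2 = ∑ i, g i * y i ^ 2 := fun y => by
    change ‖WithLp.toLp 2 fun i => √(g i) * y i‖ ^ 2 = _
    rw [EuclideanSpace.norm_sq_eq]
    refine Finset.sum_congr rfl fun i _ => ?_
    simp [mul_pow, Real.sq_sqrt (hg0 i)]
  -- Rows of the weighted matrix after normalizing its columns. Where g_i = 0 the whole weighted
  -- column vanishes, so the junk value of division by zero is harmless.
  let r : Fin m → EuclideanSpace ℝ (Fin n) := fun j => WithLp.toLp 2 fun i => √(w j) * V j i / √(g i)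
  have hr : ∀ j y, inner ℝ (Φ y) (r j) = √(w j) * (V *ᵥ y) j := fun j y => by
    change inner ℝ (WithLp.toLp 2 fun i => √(g i) * y i)
      (WithLp.toLp 2 fun i => √(w j) * V j i / √(g i)) = _
    rw [EuclideanSpace.inner_toLp_toLp, dotProduct, mulVec, dotProduct, Finset.mul_sum]
    refine Finset.sum_congr rfl fun i _ => ?_
    simp only [star_trivial]
    rcases (hg0 i).eq_or_lt with h | h
    · rw [← mul_assoc (√(w j)), hgz' i h.symm j]; simp
    · have : √(g i) ≠ 0 := (Real.sqrt_pos.2 h).ne'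
      field_simp
  have hrsum : ∑ j, ‖r j‖ ^ 2 ≤ A.card := by
    have : ∀ j, ‖r j‖ ^ 2 = ∑ i, w j * V j i ^ 2 / g i := fun j => by
      change ‖WithLp.toLp 2 fun i => √(w j) * V j i / √(g i)‖ ^ 2 = _
      rw [EuclideanSpace.norm_sq_eq]
      refine Finset.sum_congr rfl fun i _ => ?_
      simp [div_pow, mul_pow, Real.sq_sqrt (hg0 i), Real.sq_sqrt (hw j)]
    simp only [this]
    rw [Finset.sum_comm]
    simp only [← Finset.sum_div]
    calc ∑ i, g i / g i ≤ ∑ i, (if i ∈ A then 1 else 0 : ℝ) := by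
          refine Finset.sum_le_sum fun i _ => ?_
          split_ifs with h
          · exact div_self_le_one _
          · have : g i = 0 := Finset.sum_eq_zero fun j _ => by simp [hV j i h]
            simp [this]
      _ = A.card := by simp
  -- If Φ y = 0 then both sides of the strict inequality `hneg` vanish, so y = 0. Hence the
  -- rescaling preserves the dimension of `H` even if some g_i are zero.
  have hinj : Function.Injective (Φ.domRestrict H) := by
    rw [injective_iff_map_eq_zero]
    rintro ⟨y, hy⟩ h
    rw [LinearMap.domRestrict_apply] at h
    by_contra hne
    have hne' : y ≠ 0 := fun h => hne (by simpa using h)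
    have h1 := hneg y hy hne'
    have h2 : ∑ i, g i * y i ^ 2 = 0 := by rw [← hΦ, h]; simp
    have h3 : ∀ j, w j * (V *ᵥ y) j ^ 2 = 0 := fun j => by
      have := hr j y
      rw [h, inner_zero_left] at this
      rw [← Real.sq_sqrt (hw j), ← mul_pow, ← this]; simp
    rw [h2, Finset.sum_eq_zero fun j _ => h3 j] at h1
    simp at h1
  set R := LinearMap.range (Φ.domRestrict H)
  have hd : Module.finrank ℝ R = Module.finrank ℝ H := LinearMap.finrank_range_of_inj hinj
  let b := stdOrthonormalBasis ℝ R
  have hb : Orthonormal ℝ fun k => (b k : EuclideanSpace ℝ (Fin n)) :=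
    b.orthonormal.comp_linearIsometry R.subtypeₗᵢ
  have hbk : ∀ k, 1 + ε ≤ ∑ j, inner ℝ (b k : EuclideanSpace ℝ (Fin n)) (r j) ^ 2 := fun k => by
    obtain ⟨⟨y, hy⟩, hyk⟩ := (b k).2
    rw [LinearMap.domRestrict_apply] at hyk
    have hn : ‖Φ y‖ = 1 := by rw [hyk]; exact hb.1 k
    have hne : y ≠ 0 := by rintro rfl; simp at hn
    have h1 := hneg y hy hne
    rw [← hΦ, hn] at h1
    rw [← hyk]
    simp only [hr, mul_pow, Real.sq_sqrt (hw _)]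
    linarith
  have hbess : ∀ j, ∑ k, inner ℝ (b k : EuclideanSpace ℝ (Fin n)) (r j) ^ 2 ≤ ‖r j‖ ^ 2 :=
    fun j => by
    have := hb.sum_inner_products_le (r j) (s := Finset.univ)
    simpa using this
  have htot : (Module.finrank ℝ R : ℝ) * (1 + ε) ≤ A.card := by
    calc (Module.finrank ℝ R : ℝ) * (1 + ε) = ∑ _k : Fin (Module.finrank ℝ R), (1 + ε) := by
          simp [mul_add]
      _ ≤ ∑ k, ∑ j, inner ℝ (b k : EuclideanSpace ℝ (Fin n)) (r j) ^ 2 :=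
        Finset.sum_le_sum fun k _ => hbk k
      _ = ∑ j, ∑ k, inner ℝ (b k : EuclideanSpace ℝ (Fin n)) (r j) ^ 2 := Finset.sum_comm
      _ ≤ ∑ j, ‖r j‖ ^ 2 := Finset.sum_le_sum fun j _ => hbess j
      _ ≤ _ := hrsum
  rw [hd] at htot
  linarith

/-- Double counting: the squared entries on the alive columns sum to at most |A|, and each big row
takes more than 1+1/ε of this. Without big rows the strictness comes from A being non-empty. -/
theorem card_bigRows_lt {B : Matrix (Fin m) (Fin n) ℝ} (hB : ∀ i, ∑ j, B j i ^ 2 ≤ 1) {ε : ℝ}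
    {A : Finset (Fin n)} (hA : A.Nonempty) :
    ((bigRows ε B A).card : ℝ) * (1 + 1 / ε) < A.card := by
  have hcard : (0 : ℝ) < A.card := by exact_mod_cast hA.card_pos
  rcases (bigRows ε B A).eq_empty_or_nonempty with h | h
  · simpa [h] using hcard
  · calc ((bigRows ε B A).card : ℝ) * (1 + 1 / ε) = ∑ _j ∈ bigRows ε B A, (1 + 1 / ε) := by
          simp [mul_add]
      _ < ∑ j ∈ bigRows ε B A, ∑ i ∈ A, B j i ^ 2 :=
        Finset.sum_lt_sum_of_nonempty h fun j hj => by
          simpa [bigRows] using hj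
      _ ≤ ∑ j, ∑ i ∈ A, B j i ^ 2 :=
        Finset.sum_le_sum_of_subset_of_nonneg (Finset.subset_univ _) fun j _ _ =>
          Finset.sum_nonneg fun i _ => sq_nonneg _
      _ = ∑ i ∈ A, ∑ j, B j i ^ 2 := Finset.sum_comm
      _ ≤ ∑ i ∈ A, (1 : ℝ) := Finset.sum_le_sum fun i _ => hB i
      _ = A.card := by simp

/-- The linear constraints on the candidates. -/
def candidateMap (ε : ℝ) (B : Matrix (Fin m) (Fin n) ℝ) (A : Finset (Fin n)) :
    (Fin n → ℝ) →ₗ[ℝ] ({i // i ∉ A} → ℝ) × ({j // j ∈ bigRows ε B A} → ℝ) :=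
  LinearMap.prod (LinearMap.pi fun i => LinearMap.proj i.1)
    (LinearMap.pi fun j => (LinearMap.proj j.1).comp B.mulVecLin)

theorem mem_ker_candidateMap {ε : ℝ} {B : Matrix (Fin m) (Fin n) ℝ} {A : Finset (Fin n)}
    {y : Fin n → ℝ} : y ∈ LinearMap.ker (candidateMap ε B A) ↔
      (∀ i, i ∉ A → y i = 0) ∧ ∀ j ∈ bigRows ε B A, (B *ᵥ y) j = 0 := by
  rw [LinearMap.mem_ker, Prod.ext_iff, funext_iff, funext_iff, Subtype.forall, Subtype.forall]
  rfl

theorem card_le_finrank_ker_candidateMap (ε : ℝ) (B : Matrix (Fin m) (Fin n) ℝ)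
    (A : Finset (Fin n)) :
    A.card ≤ Module.finrank ℝ (LinearMap.ker (candidateMap ε B A)) + (bigRows ε B A).card := by
  classical
  have h := LinearMap.finrank_range_add_finrank_ker (candidateMap ε B A)
  have h2 := Submodule.finrank_le (LinearMap.range (candidateMap ε B A))
  rw [Module.finrank_prod, Module.finrank_fintype_fun_eq_card,
    Module.finrank_fintype_fun_eq_card, Fintype.card_subtype_compl, Fintype.card_coe,
    Fintype.card_coe, Fintype.card_fin] at h2
  rw [Module.finrank_fintype_fun_eq_card, Fintype.card_fin] at h
  have h3 : A.card ≤ n := by simpa using A.card_le_univ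
  omega

theorem dotProduct_walkMatrix (ε : ℝ) (B : Matrix (Fin m) (Fin n) ℝ) (w : Fin m → ℝ)
    (A : Finset (Fin n)) (y : Fin n → ℝ) :
    y ⬝ᵥ (walkMatrix ε B w A *ᵥ y) =
      (1 + ε) * ∑ i, (∑ j, w j * lightPart ε B A j i ^ 2) * y i ^ 2 -
        ∑ j, w j * (lightPart ε B A *ᵥ y) j ^ 2 := by
  set V := lightPart ε B A with hV
  have h1 : y ⬝ᵥ ((Vᵀ * diagonal w * V) *ᵥ y) = ∑ j, w j * (V *ᵥ y) j ^ 2 := by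
    rw [← mulVec_mulVec, ← mulVec_mulVec, dotProduct_mulVec, vecMul_transpose, dotProduct]
    refine Finset.sum_congr rfl fun j _ => ?_
    rw [mulVec_diagonal]; ring
  have h2 : ∀ i, (Vᵀ * diagonal w * V) i i = ∑ j, w j * V j i ^ 2 := fun i => by
    rw [mul_apply]
    refine Finset.sum_congr rfl fun j _ => ?_
    rw [mul_diagonal, transpose_apply]; ring
  have h3 : y ⬝ᵥ (diagonal (Vᵀ * diagonal w * V).diag *ᵥ y) =
      ∑ i, (∑ j, w j * V j i ^ 2) * y i ^ 2 := by
    rw [dotProduct]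
    refine Finset.sum_congr rfl fun i _ => ?_
    rw [mulVec_diagonal, diag_apply, h2]; ring
  simp only [walkMatrix, ← hV]
  rw [sub_mulVec, dotProduct_sub, smul_mulVec, dotProduct_smul, h1, h3, smul_eq_mul]

theorem isCompact_candidates (ε : ℝ) (B : Matrix (Fin m) (Fin n) ℝ) (A : Finset (Fin n)) :
    IsCompact (candidates ε B A) := by
  have hsub : candidates ε B A ⊆ Set.pi Set.univ fun _ => Set.Icc (-1 : ℝ) 1 := by
    rintro y ⟨-, -, hy⟩ i -
    have h : y ⬝ᵥ y = 1 := by rw [← norm_toLp_sq, hy, one_pow]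
    exact abs_le.1 (abs_le_one_of_dotProduct h i)
  refine (isCompact_univ_pi fun _ => isCompact_Icc).of_isClosed_subset ?_ hsub
  have : candidates ε B A = (⋂ i, ⋂ (_ : i ∉ A), {y | y i = 0}) ∩
      ((⋂ j, ⋂ (_ : j ∈ bigRows ε B A), {y | (B *ᵥ y) j = 0}) ∩
        {y | ‖WithLp.toLp 2 y‖ = 1}) := by
    ext y
    simp [candidates]
  rw [this]
  refine IsClosed.inter ?_ (IsClosed.inter ?_ ?_)
  · exact isClosed_iInter fun i => isClosed_iInter fun _ =>
      isClosed_eq (continuous_apply i) continuous_const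
  · exact isClosed_iInter fun j => isClosed_iInter fun _ =>
      isClosed_eq ((continuous_apply j).comp (Continuous.matrix_mulVec continuous_const
        continuous_id)) continuous_const
  · exact isClosed_eq (PiLp.continuous_toLp 2 _).norm continuous_const

theorem direction_spec {B : Matrix (Fin m) (Fin n) ℝ} (hB : ∀ i, ∑ j, B j i ^ 2 ≤ 1) {ε : ℝ}
    (hε : 0 < ε) {w : Fin m → ℝ} (hw : ∀ j, 0 ≤ w j) {A : Finset (Fin n)} (hA : A.Nonempty) :
    direction ε B w A ∈ candidates ε B A ∧
      0 ≤ direction ε B w A ⬝ᵥ (walkMatrix ε B w A *ᵥ direction ε B w A) := by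
  -- With b big rows, rank–nullity gives |A| ≤ d + b, and b(1+ε) < ε|A|; eliminating b leaves |A| <
  -- (1+ε)d.
  have hdim : (A.card : ℝ) < (1 + ε) * Module.finrank ℝ (LinearMap.ker (candidateMap ε B A)) := by
    have h1 := card_bigRows_lt (ε := ε) hB hA
    have h2 : (A.card : ℝ) ≤ Module.finrank ℝ (LinearMap.ker (candidateMap ε B A)) + (bigRows ε B A).card := by
      exact_mod_cast card_le_finrank_ker_candidateMap ε B A
    have h3 : ((bigRows ε B A).card : ℝ) * (1 + ε) < ε * A.card := by
      have := mul_lt_mul_of_pos_left h1 hε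
      calc _ = ε * (((bigRows ε B A).card : ℝ) * (1 + 1 / ε)) := by field_simp; ring
        _ < _ := this
    nlinarith
  obtain ⟨y, hyH, hy0, hy⟩ := exists_mem_form_le (lightPart ε B A) hw A
    (fun j i hi => by simp [lightPart, hi]) _ hdim
  have hpos : 0 < ‖WithLp.toLp 2 y‖ := by
    rw [norm_pos_iff]
    exact fun h => hy0 (by simpa using h)
  set c := ‖WithLp.toLp 2 y‖⁻¹ with hc
  have hmem : c • y ∈ candidates ε B A := by
    have h := mem_ker_candidateMap.1 (Submodule.smul_mem _ c hyH)
    refine ⟨h.1, h.2, ?_⟩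
    rw [WithLp.toLp_smul, norm_smul, hc, norm_inv, norm_norm, inv_mul_cancel₀ hpos.ne']
  have hval : 0 ≤ (c • y) ⬝ᵥ (walkMatrix ε B w A *ᵥ (c • y)) := by
    rw [mulVec_smul, dotProduct_smul, smul_dotProduct, smul_smul, smul_eq_mul,
      dotProduct_walkMatrix]
    exact mul_nonneg (mul_self_nonneg c) (sub_nonneg.2 hy)
  -- The candidate just found makes the compact candidate set non-empty, so a maximizer exists, and
  -- its value is at least that of the candidate, hence nonnegative.
  have hex : ∃ y, IsDirection ε B w A y := by
    obtain ⟨x, hx, hmax⟩ := (isCompact_candidates ε B A).exists_isMaxOn ⟨_, hmem⟩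
      (f := fun x => x ⬝ᵥ (walkMatrix ε B w A *ᵥ x))
      (Continuous.dotProduct continuous_id
        (Continuous.matrix_mulVec continuous_const continuous_id)).continuousOn
    exact ⟨x, hx, hmax⟩
  have hdir : IsDirection ε B w A (direction ε B w A) := by
    rw [direction, dif_pos hex]
    exact hex.choose_spec
  exact ⟨hdir.1, hval.trans (hdir.2 hmem)⟩

/-- The weighted squared length of the image of the update direction is at most `1 + ε` times the
contribution of the light rows to its diagonal part. -/
theorem sum_mulVec_direction_sq_le {B : Matrix (Fin m) (Fin n) ℝ} (hB : ∀ i, ∑ j, B j i ^ 2 ≤ 1)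
    {ε : ℝ} (hε : 0 < ε) {w : Fin m → ℝ} (hw : ∀ j, 0 ≤ w j) {A : Finset (Fin n)}
    (hA : A.Nonempty) :
    ∑ j, w j * (B *ᵥ direction ε B w A) j ^ 2 ≤
      (1 + ε) * ∑ j ∈ (bigRows ε B A)ᶜ, w j * ∑ i, B j i ^ 2 * direction ε B w A i ^ 2 := by
  obtain ⟨⟨h0, hbig, -⟩, h⟩ := direction_spec hB hε hw hA
  set y := direction ε B w A
  rw [dotProduct_walkMatrix, sub_nonneg] at h
  -- On big rows both sides are zero, the left one by the constraint; on light rows they agree since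
  -- y vanishes off A.
  have h1 : ∀ j, (B *ᵥ y) j = (lightPart ε B A *ᵥ y) j := fun j => by
    by_cases hj : j ∈ bigRows ε B A
    · rw [hbig j hj]
      exact (Finset.sum_eq_zero (s := Finset.univ)
        (f := fun i => lightPart ε B A j i * y i) fun i _ => by simp [lightPart, hj]).symm
    · simp only [mulVec, dotProduct]
      refine Finset.sum_congr rfl fun i _ => ?_
      by_cases hi : i ∈ A
      · simp [lightPart, hj, hi]
      · simp [h0 i hi]
  simp only [h1]
  refine h.trans_eq ?_
  congr 1
  simp only [Finset.sum_mul]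
  rw [Finset.sum_comm]
  rw [← Finset.sum_subset (Finset.subset_univ (bigRows ε B A)ᶜ)]
  · refine Finset.sum_congr rfl fun j hj => ?_
    rw [Finset.mul_sum]
    refine Finset.sum_congr rfl fun i _ => ?_
    by_cases hi : i ∈ A
    · simp only [lightPart, of_apply, if_pos (And.intro (Finset.mem_compl.1 hj) hi)]; ring
    · simp [h0 i hi]
  · intro j _ hj
    rw [Finset.mem_compl, not_not] at hj
    exact Finset.sum_eq_zero fun i _ => by simp [lightPart, hj]

/-! ### The step length -/

/-- The cube `[-1, 1]^n`. -/
def cube (n : ℕ) : Set (Fin n → ℝ) := {z | ∀ i, z i ∈ Set.Icc (-1 : ℝ) 1}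

theorem mem_alive {z : Fin n → ℝ} {i : Fin n} : i ∈ alive z ↔ |z i| < 1 := by
  simp [alive]

/-- The supremum is attained, and there some alive coordinate hits the boundary, while frozen
coordinates do not move; this freezing is what makes the walk terminate. -/
theorem maxStep_spec {z y : Fin n → ℝ} (hz : z ∈ cube n) (hy : ∀ i, i ∉ alive z → y i = 0)
    (hne : y ≠ 0) :
    0 < maxStep z y ∧ z + maxStep z y • y ∈ cube n ∧
      alive (z + maxStep z y • y) ⊂ alive z := by
  set S := {γ : ℝ | ∀ i, z i + γ * y i ∈ Set.Icc (-1 : ℝ) 1} with hS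
  obtain ⟨i₀, hi₀⟩ : ∃ i, y i ≠ 0 := by
    by_contra! h
    exact hne (funext h)
  have h0 : (0 : ℝ) ∈ S := fun i => by simpa using hz i
  have hbdd : BddAbove S := by
    refine ⟨2 / |y i₀|, fun γ hγ => ?_⟩
    rw [le_div_iff₀ (abs_pos.2 hi₀)]
    have h1 := abs_le.2 (hγ i₀)
    have h2 := abs_le.2 (hz i₀)
    calc γ * |y i₀| ≤ |γ| * |y i₀| := by gcongr; exact le_abs_self γ
      _ = |γ * y i₀| := (abs_mul _ _).symm
      _ = |(z i₀ + γ * y i₀) - z i₀| := by congr 1; ring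
      _ ≤ |z i₀ + γ * y i₀| + |z i₀| := abs_sub _ _
      _ ≤ 2 := by linarith
  have hclosed : IsClosed S := by
    have : S = ⋂ i, {γ : ℝ | z i + γ * y i ∈ Set.Icc (-1 : ℝ) 1} := by ext; simp [hS]
    rw [this]
    exact isClosed_iInter fun i => isClosed_Icc.preimage (by fun_prop)
  set γ := maxStep z y with hγ
  have hmem : γ ∈ S := hclosed.csSup_mem ⟨0, h0⟩ hbdd
  -- Otherwise all alive coordinates are interior at γ and, by continuity, a slightly larger step is
  -- still feasible.
  have htight : ∃ i ∈ alive z, ¬ |z i + γ * y i| < 1 := by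
    by_contra! hall
    have hev : ∀ᶠ γ' in nhds γ, ∀ i, z i + γ' * y i ∈ Set.Icc (-1 : ℝ) 1 := by
      rw [Filter.eventually_all]
      intro i
      by_cases hi : i ∈ alive z
      · have hcont : ContinuousAt (fun γ' : ℝ => |z i + γ' * y i|) γ := by fun_prop
        filter_upwards [hcont.eventually_lt_const (hall i hi)] with γ' h
        exact abs_le.1 h.le
      · exact Filter.Eventually.of_forall fun γ' => by simpa [hy i hi] using hz i
    obtain ⟨δ, hδ, hball⟩ := Metric.eventually_nhds_iff.1 hev
    have hgt : γ + δ / 2 ∈ S := hball (by simp [abs_of_pos hδ]; linarith)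
    have := le_csSup hbdd hgt
    change γ + δ / 2 ≤ γ at this
    linarith
  obtain ⟨i₁, hi₁, hi₁'⟩ := htight
  have hpos : 0 < γ := by
    refine lt_of_le_of_ne (le_csSup hbdd h0) fun h => hi₁' ?_
    rw [← h]
    simpa using mem_alive.1 hi₁
  refine ⟨hpos, hmem, ?_⟩
  rw [Finset.ssubset_iff_of_subset]
  · exact ⟨i₁, hi₁, fun h => hi₁' (by simpa using mem_alive.1 h)⟩
  · intro i hi
    by_contra hi'
    have := mem_alive.1 hi
    simp only [Pi.add_apply, Pi.smul_apply, hy i hi', smul_eq_mul, mul_zero, add_zero] at this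
    exact hi' (mem_alive.2 this)

end RandomWalk

/-! ### The random walk -/

namespace RandomWalk

open Matrix

variable {m n : ℕ}

/-- A pass of the walk moves from `z` either to `z + γp • y` or to `z - γm • y`. -/
structure IsMove (ε : ℝ) (B : Matrix (Fin m) (Fin n) ℝ) (w : Fin m → ℝ) (z y : Fin n → ℝ)
    (γp γm : ℝ) : Prop where
  mem_cube : z ∈ cube n
  pos_up : 0 < γp
  pos_down : 0 < γm
  up_mem : z + γp • y ∈ cube n
  down_mem : z - γm • y ∈ cube n
  up_alive : alive (z + γp • y) ⊂ alive z
  down_alive : alive (z - γm • y) ⊂ alive z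
  form_le : ∑ j, w j * (B *ᵥ y) j ^ 2 ≤
    (1 + ε) * ∑ j ∈ (bigRows ε B (alive z))ᶜ, w j * ∑ i, B j i ^ 2 * y i ^ 2

/-- The number of steps of a pass. -/
def passCost (m n : ℕ) : ℕ := 4 * (n + 1) + (m * n + m * n ^ 2 + (m + n) ^ 3) + 2

theorem walkStep_of_alive_eq_empty (ε : ℝ) (B : Matrix (Fin m) (Fin n) ℝ) (w : Fin m → ℝ)
    {z : Fin n → ℝ} (hz : alive z = ∅) :
    (walkStep ε B w z).Halts (passCost m n) (fun r => r = Sum.inr z) ∧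
      ∀ F, (walkStep ε B w z).ex F = F (Sum.inr z) := by
  constructor
  · unfold walkStep
    refine RComp.halts_step_bind (T₀ := 1) ?_ (by unfold passCost; omega)
    rw [if_pos hz]
    exact RComp.halts_step _ _ rfl
  · intro F
    unfold walkStep
    rw [RComp.ex_bind, RComp.ex_step, if_pos hz, RComp.ex_step]

theorem exists_isMove {B : Matrix (Fin m) (Fin n) ℝ} (hB : ∀ i, ∑ j, B j i ^ 2 ≤ 1) {ε : ℝ}
    (hε : 0 < ε) {w : Fin m → ℝ} (hw : ∀ j, 0 ≤ w j) {z : Fin n → ℝ} (hz : z ∈ cube n)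
    (hA : alive z ≠ ∅) :
    ∃ y γp γm, IsMove ε B w z y γp γm ∧
      (walkStep ε B w z).Halts (passCost m n)
        (fun r => r = Sum.inl (z + γp • y) ∨ r = Sum.inl (z - γm • y)) ∧
      ∀ F, (walkStep ε B w z).ex F =
        ENNReal.ofReal (γm / (γp + γm)) * F (Sum.inl (z + γp • y)) +
        ENNReal.ofReal (γp / (γp + γm)) * F (Sum.inl (z - γm • y)) := by
  have hA' : (alive z).Nonempty := Finset.nonempty_iff_ne_empty.2 hA
  obtain ⟨⟨h0, -, hunit⟩, -⟩ := direction_spec hB hε hw hA'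
  have hform := sum_mulVec_direction_sq_le hB hε hw hA'
  set y := direction ε B w (alive z) with hy
  have hne : y ≠ 0 := by
    intro h
    rw [h] at hunit
    simp at hunit
  obtain ⟨hp, hpc, hpa⟩ := maxStep_spec hz h0 hne
  obtain ⟨hm, hmc, hma⟩ := maxStep_spec (y := -y) hz (fun i hi => by simp [h0 i hi])
    (neg_ne_zero.2 hne)
  set γp := maxStep z y with hγp
  set γm := maxStep z (-y) with hγm
  rw [smul_neg, ← sub_eq_add_neg] at hmc hma
  refine ⟨y, γp, γm, ⟨hz, hp, hm, hpc, hmc, hpa, hma, hform⟩, ?_, fun F => ?_⟩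
  · unfold walkStep
    refine RComp.halts_step_bind (T₀ := m * n + m * n ^ 2 + (m + n) ^ 3 + (3 * (n + 1) + 1))
      ?_ (by unfold passCost; omega)
    rw [if_neg hA]
    refine RComp.halts_step_bind (T₀ := 3 * (n + 1) + 1) ?_ le_rfl
    refine RComp.halts_step_bind (T₀ := 2 * (n + 1) + 1) ?_ (by omega)
    refine RComp.halts_step_bind (T₀ := 1 + (n + 1)) ?_ (by omega)
    refine (RComp.halts_coin (P := fun _ => True) _ (fun _ => trivial) fun _ => trivial).bind ?_
    rintro b -
    refine RComp.halts_step _ _ ?_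
    cases b
    · right
      simp [← hy, ← hγm, sub_eq_add_neg]
    · left
      simp [← hy, ← hγp]
  · have hq0 : 0 ≤ γm / (γp + γm) := by positivity
    have hq1 : γm / (γp + γm) ≤ 1 := by rw [div_le_one (by positivity)]; linarith
    have h1q : 1 - γm / (γp + γm) = γp / (γp + γm) := by field_simp; ring
    unfold walkStep
    rw [RComp.ex_bind, RComp.ex_step, if_neg hA]
    simp only [RComp.ex_bind, RComp.ex_step]
    rw [← hy, ← hγp, ← hγm, RComp.ex_coin _ hq0 hq1, h1q]
    simp [sub_eq_add_neg]

/-- The number of alive coordinates drops in every move, so there are at most n moves and one last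
pass that finds no alive coordinate. -/
theorem halts_loop_walkStep {B : Matrix (Fin m) (Fin n) ℝ} (hB : ∀ i, ∑ j, B j i ^ 2 ≤ 1) {ε : ℝ}
    (hε : 0 < ε) {w : Fin m → ℝ} (hw : ∀ j, 0 ≤ w j) {z : Fin n → ℝ} (hz : z ∈ cube n) {K : ℕ}
    (hK : n < K) :
    (RComp.loop (walkStep ε B w) K z).Halts ((n + 1) * (passCost m n + 1))
      (fun z => ∀ i, z i = 1 ∨ z i = -1) := by
  refine RComp.halts_loop (I := fun r z => z ∈ cube n ∧ (alive z).card ≤ r) ?_ K n z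
    ⟨hz, by simpa using (alive z).card_le_univ⟩ hK
  rintro r z ⟨hz, hr⟩
  by_cases hA : alive z = ∅
  · refine (walkStep_of_alive_eq_empty ε B w hA).1.mono le_rfl ?_
    rintro _ rfl i
    have hi : ¬ |z i| < 1 := fun h => by simpa [hA] using mem_alive.2 h
    have h1 : |z i| = 1 := le_antisymm (abs_le.2 (hz i)) (not_lt.1 hi)
    exact eq_or_eq_neg_of_abs_eq h1
  · obtain ⟨y, γp, γm, hmove, hh, -⟩ := exists_isMove hB hε hw hz hA
    refine hh.mono le_rfl ?_
    rintro _ (rfl | rfl)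
    · exact ⟨_, (Finset.card_lt_card hmove.up_alive).trans_le hr, hmove.up_mem, le_rfl⟩
    · exact ⟨_, (Finset.card_lt_card hmove.down_alive).trans_le hr, hmove.down_mem, le_rfl⟩

/-- A function that is a supermartingale along the walk bounds the expectation at the end. -/
theorem ex_loop_walkStep_le {B : Matrix (Fin m) (Fin n) ℝ} (hB : ∀ i, ∑ j, B j i ^ 2 ≤ 1) {ε : ℝ}
    (hε : 0 < ε) {w : Fin m → ℝ} (hw : ∀ j, 0 ≤ w j) {g Ψ : (Fin n → ℝ) → ℝ}
    (hΨ : ∀ z ∈ cube n, 0 ≤ Ψ z) (hend : ∀ z ∈ cube n, g z ≤ Ψ z)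
    (hmove : ∀ z y γp γm, IsMove ε B w z y γp γm →
      γm * Ψ (z + γp • y) + γp * Ψ (z - γm • y) ≤ (γp + γm) * Ψ z) :
    ∀ (K : ℕ) (z : Fin n → ℝ), z ∈ cube n →
      (RComp.loop (walkStep ε B w) K z).ex (fun z => ENNReal.ofReal (g z)) ≤
        ENNReal.ofReal (Ψ z) := by
  intro K
  induction K with
  -- A run that is cut off contributes zero, so the upper bound needs no assumption on the number of
  -- passes.
  | zero => intro z _; simp [RComp.loop, RComp.ex_cutOff]
  | succ K ih =>
    intro z hz
    rw [RComp.ex_loop_succ]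
    by_cases hA : alive z = ∅
    · rw [(walkStep_of_alive_eq_empty ε B w hA).2]
      exact ENNReal.ofReal_le_ofReal (hend z hz)
    · obtain ⟨y, γp, γm, hmv, -, hex⟩ := exists_isMove hB hε hw hz hA
      have hp := hmv.pos_up
      have hm := hmv.pos_down
      rw [hex, Sum.elim_inl, Sum.elim_inl]
      calc _ ≤ ENNReal.ofReal (γm / (γp + γm)) * ENNReal.ofReal (Ψ (z + γp • y)) +
            ENNReal.ofReal (γp / (γp + γm)) * ENNReal.ofReal (Ψ (z - γm • y)) := by
            gcongr
            · exact ih _ hmv.up_mem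
            · exact ih _ hmv.down_mem
        _ = ENNReal.ofReal (γm / (γp + γm) * Ψ (z + γp • y) +
            γp / (γp + γm) * Ψ (z - γm • y)) := by
            rw [ENNReal.ofReal_add, ENNReal.ofReal_mul (by positivity),
              ENNReal.ofReal_mul (by positivity)]
            · exact mul_nonneg (by positivity) (hΨ _ hmv.up_mem)
            · exact mul_nonneg (by positivity) (hΨ _ hmv.down_mem)
        _ ≤ _ := by
            apply ENNReal.ofReal_le_ofReal
            rw [div_mul_eq_mul_div, div_mul_eq_mul_div, ← add_div, div_le_iff₀ (by positivity)]
            linarith [hmove z y γp γm hmv]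

/-- The potential that bounds the weighted variance of the endpoint of the walk. -/
noncomputable def potential (ε : ℝ) (B : Matrix (Fin m) (Fin n) ℝ) (w a : Fin m → ℝ)
    (z : Fin n → ℝ) : ℝ :=
  ∑ j, w j * ((B *ᵥ z) j + a j) ^ 2 +
    (1 + ε) * ∑ j, w j * min (∑ i, B j i ^ 2 * (1 - z i ^ 2)) (1 + 1 / ε)

theorem one_sub_sq_nonneg {z : Fin n → ℝ} (hz : z ∈ cube n) (i : Fin n) : 0 ≤ 1 - z i ^ 2 := by
  have := (sq_le_one_iff_abs_le_one (z i)).2 (abs_le.2 (hz i))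
  linarith

theorem sum_sq_mul_one_sub_sq_le {z : Fin n → ℝ} (hz : z ∈ cube n) (b : Fin n → ℝ) :
    ∑ i, b i ^ 2 * (1 - z i ^ 2) ≤ ∑ i ∈ alive z, b i ^ 2 := by
  rw [← Finset.sum_subset (Finset.subset_univ (alive z))]
  · refine Finset.sum_le_sum fun i _ => ?_
    nlinarith [sq_nonneg (b i), sq_nonneg (z i)]
  · intro i _ hi
    have h1 : |z i| = 1 :=
      le_antisymm (abs_le.2 (hz i)) (not_lt.1 fun h => hi (mem_alive.2 h))
    rw [← sq_abs (z i), h1]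
    ring

/-- The function min(·, c) is concave and nondecreasing, so it preserves the supermartingale
property. -/
theorem min_add_min_le {s t a b x c : ℝ} (hs : 0 ≤ s) (ht : 0 ≤ t)
    (h : s * a + t * b ≤ (t + s) * x) :
    s * min a c + t * min b c ≤ (t + s) * min x c := by
  rcases le_total x c with hxc | hxc
  · rw [min_eq_left hxc]
    exact le_trans (add_le_add (mul_le_mul_of_nonneg_left (min_le_left _ _) hs)
      (mul_le_mul_of_nonneg_left (min_le_left _ _) ht)) h
  · rw [min_eq_right hxc]
    calc s * min a c + t * min b c ≤ s * c + t * c :=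
          add_le_add (mul_le_mul_of_nonneg_left (min_le_right _ _) hs)
            (mul_le_mul_of_nonneg_left (min_le_right _ _) ht)
      _ = _ := by ring

/-- On average the weighted square grows by γ₊γ₋ Σ_j w_j (By)_j², and each ρ_j falls by γ₊γ₋ s_j. A
light row passes its full loss on to the truncated term; for a big row it is enough that the
truncated term does not rise on average. The quality `form_le` of the direction balances the growth
against the loss in the light rows. -/
theorem IsMove.potential_le {ε : ℝ} (hε : 0 < ε) {B : Matrix (Fin m) (Fin n) ℝ} {w : Fin m → ℝ}
    (hw : ∀ j, 0 ≤ w j) (a : Fin m → ℝ) {z y : Fin n → ℝ} {γp γm : ℝ}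
    (h : IsMove ε B w z y γp γm) :
    γm * potential ε B w a (z + γp • y) + γp * potential ε B w a (z - γm • y) ≤
      (γp + γm) * potential ε B w a z := by
  classical
  have hp := h.pos_up
  have hm := h.pos_down
  set s : Fin m → ℝ := fun j => ∑ i, B j i ^ 2 * y i ^ 2 with hs
  set ρ : (Fin n → ℝ) → Fin m → ℝ := fun z j => ∑ i, B j i ^ 2 * (1 - z i ^ 2) with hρ
  have hρavg : ∀ j, γm * ρ (z + γp • y) j + γp * ρ (z - γm • y) j =
      (γp + γm) * (ρ z j - γp * γm * s j) := fun j => by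
    simp only [hρ, hs, Finset.mul_sum, ← Finset.sum_add_distrib, ← Finset.sum_sub_distrib,
      Pi.add_apply, Pi.sub_apply, Pi.smul_apply, smul_eq_mul]
    exact Finset.sum_congr rfl fun i _ => by ring
  have hmin : ∀ j, γm * min (ρ (z + γp • y) j) (1 + 1 / ε) +
      γp * min (ρ (z - γm • y) j) (1 + 1 / ε) ≤ (γp + γm) * (min (ρ z j) (1 + 1 / ε) -
        γp * γm * (if j ∈ bigRows ε B (alive z) then 0 else s j)) := fun j => by
    split_ifs with hj
    · rw [mul_zero, sub_zero]
      refine min_add_min_le hm.le hp.le ?_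
      rw [hρavg]
      have : 0 ≤ s j := Finset.sum_nonneg fun i _ => mul_nonneg (sq_nonneg _) (sq_nonneg _)
      have : 0 ≤ γp * γm * s j := by positivity
      nlinarith
    · have hlight : ρ z j ≤ 1 + 1 / ε := by
        refine (sum_sq_mul_one_sub_sq_le h.mem_cube (B j)).trans ?_
        simpa [bigRows] using hj
      rw [min_eq_left hlight, ← hρavg]
      gcongr <;> exact min_le_left _ _
  have hsq : ∀ j, γm * ((B *ᵥ (z + γp • y)) j + a j) ^ 2 + γp * ((B *ᵥ (z - γm • y)) j + a j) ^ 2 =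
      (γp + γm) * (((B *ᵥ z) j + a j) ^ 2 + γp * γm * (B *ᵥ y) j ^ 2) := fun j => by
    simp only [mulVec_add, mulVec_sub, mulVec_smul, Pi.add_apply, Pi.sub_apply, Pi.smul_apply,
      smul_eq_mul]
    ring
  have hlightsum : ∑ j, w j * (if j ∈ bigRows ε B (alive z) then 0 else s j) =
      ∑ j ∈ (bigRows ε B (alive z))ᶜ, w j * s j := by
    rw [← Finset.sum_subset (Finset.subset_univ (bigRows ε B (alive z))ᶜ)]
    · exact Finset.sum_congr rfl fun j hj => by rw [if_neg (Finset.mem_compl.1 hj)]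
    · intro j _ hj
      rw [Finset.mem_compl, not_not] at hj
      rw [if_pos hj, mul_zero]
  have h1 : γm * ∑ j, w j * ((B *ᵥ (z + γp • y)) j + a j) ^ 2 +
      γp * ∑ j, w j * ((B *ᵥ (z - γm • y)) j + a j) ^ 2 =
      (γp + γm) * (∑ j, w j * ((B *ᵥ z) j + a j) ^ 2 + γp * γm * ∑ j, w j * (B *ᵥ y) j ^ 2) := by
    simp only [Finset.mul_sum, ← Finset.sum_add_distrib]
    exact Finset.sum_congr rfl fun j _ => by linear_combination w j * hsq j
  have h2 : γm * ∑ j, w j * min (ρ (z + γp • y) j) (1 + 1 / ε) +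
      γp * ∑ j, w j * min (ρ (z - γm • y) j) (1 + 1 / ε) ≤
      (γp + γm) * (∑ j, w j * min (ρ z j) (1 + 1 / ε) -
        γp * γm * ∑ j, w j * (if j ∈ bigRows ε B (alive z) then 0 else s j)) := by
    simp only [Finset.mul_sum, ← Finset.sum_add_distrib, ← Finset.sum_sub_distrib]
    refine Finset.sum_le_sum fun j _ => ?_
    have := mul_le_mul_of_nonneg_left (hmin j) (hw j)
    linarith
  rw [hlightsum] at h2
  have h3 := mul_le_mul_of_nonneg_left h.form_le (mul_pos hp hm).le
  have h4 := mul_le_mul_of_nonneg_left h3 (add_pos hp hm).le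
  have h5 := mul_le_mul_of_nonneg_left h2 (show 0 ≤ 1 + ε by linarith)
  unfold potential
  linarith

/-- The number of steps of the oracle. -/
def oracleCost (m n : ℕ) : ℕ :=
  m ^ 3 + (m * m * n + (2 * m + (n + (n + 1) * (passCost m n + 1))))

theorem meanVec_mem_cube {p : Fin n → ℝ} (hp : ∀ i, 0 < p i ∧ p i < 1) : meanVec p ∈ cube n :=
  fun i => ⟨by unfold meanVec; linarith [(hp i).1], by unfold meanVec; linarith [(hp i).2]⟩

theorem eigen_spec {W : Matrix (Fin m) (Fin m) ℝ} (hW : W.PosSemidef) :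
    (eigen W).1ᵀ * (eigen W).1 = 1 ∧ (eigen W).1 * (eigen W).1ᵀ = 1 ∧
      W = spectralForm (eigen W).1 (eigen W).2 ∧ (∀ j, 0 ≤ (eigen W).2 j) ∧
      W.trace = ∑ j, (eigen W).2 j := by
  obtain ⟨U, a, hU, hU', h, h1, h2⟩ := hW.1.exists_spectralForm
  have he : eigen W = (U, a) := by rw [eigen, dif_pos hW.1, h1, h2]
  rw [he]
  refine ⟨hU, hU', h, fun j => ?_, ?_⟩
  · rw [h2]
    exact hW.eigenvalues_nonneg j
  · rw [h2]
    simpa using hW.1.trace_eq_sum_eigenvalues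

theorem sum_transpose_mul_sq_le {B : Matrix (Fin m) (Fin n) ℝ} (hB : ColumnsAtMostOne B)
    {U : Matrix (Fin m) (Fin m) ℝ} (hU : U * Uᵀ = 1) (i : Fin n) :
    ∑ j, (Uᵀ * B) j i ^ 2 ≤ 1 := by
  have h1 : ∀ j, (Uᵀ * B) j i = (Uᵀ *ᵥ fun j => B j i) j := fun j => rfl
  simp only [h1]
  rw [sum_transpose_mulVec_sq hU, ← norm_toLp_sq]
  exact pow_le_one₀ (norm_nonneg _) (hB i)

/-- The value `min {‖B D_p Bᵀ‖, 1 + 1/ε}`. -/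
noncomputable def valueBound (ε : ℝ) (B : Matrix (Fin m) (Fin n) ℝ) (p : Fin n → ℝ) : ℝ :=
  min (bernoulliValue B p) (1 + 1 / ε)

/-- Since 1 - (2p-1)² = 4p(1-p), the inner sums are the diagonal entries of B D_p Bᵀ in the
eigenbasis. The weights are only assumed to sum to at most 1, which also covers a zero trace, where
the normalization divides by zero. -/
theorem sum_min_le_valueBound {ε : ℝ} (hε : 0 < ε) (B : Matrix (Fin m) (Fin n) ℝ)
    (p : Fin n → ℝ) {U : Matrix (Fin m) (Fin m) ℝ} (hU : Uᵀ * U = 1) {w : Fin m → ℝ}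
    (hw : ∀ j, 0 ≤ w j) (hw1 : ∑ j, w j ≤ 1) :
    ∑ j, w j * min (∑ i, (Uᵀ * B) j i ^ 2 * (1 - meanVec p i ^ 2)) (1 + 1 / ε) ≤
      valueBound ε B p := by
  refine le_min ?_ ?_
  · calc _ ≤ ∑ j, w j * bernoulliValue B p := by
          refine Finset.sum_le_sum fun j _ => mul_le_mul_of_nonneg_left ?_ (hw j)
          refine (min_le_left _ _).trans ?_
          have h := dotProduct_mulVec_le_opNorm
            (B * diagonal (fun i => 4 * p i * (1 - p i)) * Bᵀ) (U.col j)
          rw [col_dotProduct_col hU, mul_one, ← col_dotProduct_mulVec] at h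
          refine le_trans (le_of_eq ?_) h
          have e : Uᵀ * (B * diagonal (fun i => 4 * p i * (1 - p i)) * Bᵀ) * U =
              (Uᵀ * B) * diagonal (fun i => 4 * p i * (1 - p i)) * (Uᵀ * B)ᵀ := by
            simp only [transpose_mul, transpose_transpose, Matrix.mul_assoc]
          rw [e, mul_apply (M := Uᵀ * B * diagonal _)]
          refine Finset.sum_congr rfl fun i _ => ?_
          rw [mul_diagonal, transpose_apply, meanVec]
          ring
      _ = (∑ j, w j) * bernoulliValue B p := by rw [Finset.sum_mul]
      _ ≤ 1 * bernoulliValue B p := mul_le_mul_of_nonneg_right hw1 (opNorm_nonneg _)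
      _ = _ := one_mul _
  · calc _ ≤ ∑ j, w j * (1 + 1 / ε) :=
          Finset.sum_le_sum fun j _ => mul_le_mul_of_nonneg_left (min_le_right _ _) (hw j)
      _ = (∑ j, w j) * (1 + 1 / ε) := by rw [Finset.sum_mul]
      _ ≤ 1 * (1 + 1 / ε) := mul_le_mul_of_nonneg_right hw1 (by positivity)
      _ = _ := one_mul _

/-! ### Halting, mean and weighted covariance of the oracle. -/

section Oracle

variable {B : Matrix (Fin m) (Fin n) ℝ} {p : Fin n → ℝ} {ε : ℝ} {W : Matrix (Fin m) (Fin m) ℝ}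

theorem halts_oracle (hB : ColumnsAtMostOne B) (hp : ∀ i, 0 < p i ∧ p i < 1) (hε : 0 < ε)
    (hW : W.PosSemidef) {K : ℕ} (hK : n < K) :
    (oracle K ε B p W).Halts (oracleCost m n) (fun z => ∀ i, z i = 1 ∨ z i = -1) := by
  obtain ⟨-, hU', -, ha, -⟩ := eigen_spec hW
  unfold oracle
  refine RComp.halts_step_bind ?_ le_rfl
  refine RComp.halts_step_bind ?_ le_rfl
  refine RComp.halts_step_bind ?_ le_rfl
  refine RComp.halts_step_bind ?_ le_rfl
  exact halts_loop_walkStep (sum_transpose_mul_sq_le hB hU') hε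
    (fun j => div_nonneg (ha j) (Finset.sum_nonneg fun k _ => ha k)) (meanVec_mem_cube hp) hK

/-- Only upper bounds for nonnegative functions are available. Applied to both 1 + z_i and 1 - z_i,
whose expectations sum to 2, as do the bounds, they force equality. -/
theorem ex_oracle_one_add (hB : ColumnsAtMostOne B) (hp : ∀ i, 0 < p i ∧ p i < 1) (hε : 0 < ε)
    (hW : W.PosSemidef) {K : ℕ} (hK : n < K) (i : Fin n) :
    (oracle K ε B p W).ex (fun z => ENNReal.ofReal (1 + z i)) = ENNReal.ofReal (2 * p i) := by
  obtain ⟨-, hU', -, ha, -⟩ := eigen_spec hW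
  have hhalt := halts_oracle hB hp hε hW hK
  have hle : ∀ c : ℝ, c = 1 ∨ c = -1 →
      (oracle K ε B p W).ex (fun z => ENNReal.ofReal (1 + c * z i)) ≤
        ENNReal.ofReal (1 + c * meanVec p i) := by
    intro c hc
    unfold oracle
    simp only [RComp.ex_bind, RComp.ex_step]
    refine ex_loop_walkStep_le (Ψ := fun z => 1 + c * z i) (sum_transpose_mul_sq_le hB hU') hε
      (fun j => div_nonneg (ha j) (Finset.sum_nonneg fun k _ => ha k)) ?_ (fun _ _ => le_rfl) ?_
      K _ (meanVec_mem_cube hp)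
    · intro z hz
      rcases hc with rfl | rfl <;> linarith [(hz i).1, (hz i).2]
    · intro z y γp γm _
      simp only [Pi.add_apply, Pi.sub_apply, Pi.smul_apply, smul_eq_mul]
      apply le_of_eq
      ring
  have hsum : (oracle K ε B p W).ex (fun z => ENNReal.ofReal (1 + 1 * z i)) +
      (oracle K ε B p W).ex (fun z => ENNReal.ofReal (1 + -1 * z i)) = 2 := by
    rw [← RComp.ex_add, ← hhalt.ex_const 2]
    refine hhalt.ex_congr fun z hz => ?_
    rcases hz i with h | h <;> rw [h] <;> norm_num
  have h1 := hle 1 (Or.inl rfl)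
  have h2 := hle (-1) (Or.inr rfl)
  have e1 : 1 + 1 * meanVec p i = 2 * p i := by unfold meanVec; ring
  have e2 : 1 + -1 * meanVec p i = 2 * (1 - p i) := by unfold meanVec; ring
  rw [e1] at h1
  rw [e2] at h2
  simp only [one_mul] at h1 hsum
  refine le_antisymm h1 ?_
  have h3 : ENNReal.ofReal (2 * p i) + ENNReal.ofReal (2 * (1 - p i)) = 2 := by
    rw [← ENNReal.ofReal_add (by linarith [(hp i).1]) (by linarith [(hp i).2])]
    ring_nf
    simp
  have h4 : ENNReal.ofReal (2 * p i) + ENNReal.ofReal (2 * (1 - p i)) ≤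
      (oracle K ε B p W).ex (fun z => ENNReal.ofReal (1 + z i)) +
        ENNReal.ofReal (2 * (1 - p i)) := by
    rw [h3, ← hsum]
    gcongr
  exact (ENNReal.add_le_add_iff_right ENNReal.ofReal_ne_top).1 h4

theorem ex_oracle_form_le (hB : ColumnsAtMostOne B) (hp : ∀ i, 0 < p i ∧ p i < 1) (hε : 0 < ε)
    (hW : W.PosSemidef) (K : ℕ) :
    (oracle K ε B p W).ex (fun z => ENNReal.ofReal
        ((B *ᵥ (z - meanVec p)) ⬝ᵥ (W *ᵥ (B *ᵥ (z - meanVec p))))) ≤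
      ENNReal.ofReal (MWU.eta ε B p * W.trace) := by
  obtain ⟨hU, hU', hWe, ha, htr⟩ := eigen_spec hW
  set U := (eigen W).1 with hUdef
  set lam := (eigen W).2 with hlam
  set Λ := ∑ k, lam k with hΛ
  have hΛ0 : 0 ≤ Λ := Finset.sum_nonneg fun k _ => ha k
  set w : Fin m → ℝ := fun j => lam j / Λ with hwdef
  have hw : ∀ j, 0 ≤ w j := fun j => div_nonneg (ha j) hΛ0
  have hw1 : ∑ j, w j ≤ 1 := by
    rw [← Finset.sum_div]
    exact div_self_le_one _
  have hlw : ∀ j, lam j = Λ * w j := fun j => by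
    rcases hΛ0.eq_or_lt with h | h
    · have : lam j = 0 :=
        (Finset.sum_eq_zero_iff_of_nonneg fun k _ => ha k).1 h.symm j (Finset.mem_univ j)
      simp [hwdef, this]
    · simp only [hwdef]
      field_simp
  set a : Fin m → ℝ := -((Uᵀ * B) *ᵥ meanVec p) with hadef
  have hform : ∀ z, (B *ᵥ (z - meanVec p)) ⬝ᵥ (W *ᵥ (B *ᵥ (z - meanVec p))) =
      Λ * ∑ j, w j * (((Uᵀ * B) *ᵥ z) j + a j) ^ 2 := fun z => by
    conv_lhs => rw [hWe]
    rw [dotProduct_spectralForm_mulVec, Finset.mul_sum]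
    refine Finset.sum_congr rfl fun j _ => ?_
    rw [mulVec_mulVec, mulVec_sub, hlw, hadef]
    simp only [Pi.sub_apply, Pi.neg_apply]
    ring
  simp only [hform, ENNReal.ofReal_mul hΛ0]
  rw [RComp.ex_const_mul, mul_comm (MWU.eta ε B p), htr, ENNReal.ofReal_mul hΛ0]
  gcongr
  unfold oracle
  simp only [RComp.ex_bind, RComp.ex_step]
  rw [← hUdef, ← hlam, ← hΛ]
  have hnn : ∀ z ∈ cube n, 0 ≤ (1 + ε) *
      ∑ j, w j * min (∑ i, (Uᵀ * B) j i ^ 2 * (1 - z i ^ 2)) (1 + 1 / ε) := fun z hz =>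
    mul_nonneg (by linarith) (Finset.sum_nonneg fun j _ => mul_nonneg (hw j)
      (le_min (Finset.sum_nonneg fun i _ => mul_nonneg (sq_nonneg _) (one_sub_sq_nonneg hz i))
        (by positivity)))
  have hnn' : ∀ z : Fin n → ℝ, 0 ≤ ∑ j, w j * (((Uᵀ * B) *ᵥ z) j + a j) ^ 2 := fun z =>
    Finset.sum_nonneg fun j _ => mul_nonneg (hw j) (sq_nonneg _)
  refine (ex_loop_walkStep_le (Ψ := potential ε (Uᵀ * B) w a) (sum_transpose_mul_sq_le hB hU') hε
    hw (fun z hz => add_nonneg (hnn' z) (hnn z hz)) (fun z hz => le_add_of_nonneg_right (hnn z hz))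
    (fun z y γp γm h => h.potential_le hε hw a) K _ (meanVec_mem_cube hp)).trans ?_
  apply ENNReal.ofReal_le_ofReal
  -- The walk starts at its mean, so initially the potential consists of the truncated term alone.
  have h0 : ∑ j, w j * (((Uᵀ * B) *ᵥ meanVec p) j + a j) ^ 2 = 0 :=
    Finset.sum_eq_zero fun j _ => by simp [hadef]
  rw [potential, h0, zero_add, MWU.eta]
  exact mul_le_mul_of_nonneg_left (sum_min_le_valueBound hε B p hU hw hw1) (by linarith)

end Oracle

end RandomWalk

/-! ### Laws on the vertices of the cube -/

section VertexLaws

open Matrix MeasureTheory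

/-- A law on the vertices of the cube whose mean is `2p - 1`. -/
structure VertexLaw {n : ℕ} (p : Fin n → ℝ) (D : PMF (Fin n → ℝ)) : Prop where
  vertex : ∀ z ∈ D.support, ∀ i, z i = 1 ∨ z i = -1
  mean : ∀ i, D.expect (fun z => ENNReal.ofReal (1 + z i)) = ENNReal.ofReal (2 * p i)

namespace VertexLaw

variable {m n : ℕ} {p : Fin n → ℝ} {D : PMF (Fin n → ℝ)}

theorem toMeasure_apply_eq_expect (D : PMF (Fin n → ℝ)) {s : Set (Fin n → ℝ)}
    (hs : MeasurableSet s) : D.toMeasure s = D.expect (s.indicator 1) := by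
  rw [D.toMeasure_apply hs, PMF.expect]
  refine tsum_congr fun z => ?_
  by_cases h : z ∈ s <;> simp [h]

theorem feasible (h : VertexLaw p D) (hp : ∀ i, 0 < p i ∧ p i < 1) : Feasible p D := by
  refine ⟨h.vertex, fun i => ?_⟩
  have hmeas : ∀ c : ℝ, MeasurableSet {z : Fin n → ℝ | z i = c} := fun c =>
    measurableSet_eq_fun (measurable_pi_apply i) measurable_const
  have h1 : D.toMeasure {z | z i = 1} = ENNReal.ofReal (p i) := by
    have e : 2 * D.toMeasure {z | z i = 1} = 2 * ENNReal.ofReal (p i) := by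
      rw [toMeasure_apply_eq_expect D (hmeas 1), ← PMF.expect_const_mul,
        ← ENNReal.ofReal_ofNat 2, ← ENNReal.ofReal_mul (by norm_num), ← h.mean i]
      refine PMF.expect_congr fun z hz => ?_
      rcases h.vertex z hz i with hi | hi
      · simp [Set.indicator, hi]; norm_num
      · simp [Set.indicator, hi]; norm_num
    exact (ENNReal.mul_right_inj (by norm_num) (by norm_num)).1 e
  refine ⟨h1, ?_⟩
  have h2 : D.toMeasure {z | z i = 1} + D.toMeasure {z | z i = -1} = 1 := by
    rw [toMeasure_apply_eq_expect D (hmeas 1), toMeasure_apply_eq_expect D (hmeas (-1)),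
      ← PMF.expect_add, ← D.expect_const 1]
    refine PMF.expect_congr fun z hz => ?_
    rcases h.vertex z hz i with hi | hi
    · simp [Set.indicator, hi]; norm_num
    · simp [Set.indicator, hi]; norm_num
  rw [h1] at h2
  rw [ENNReal.ofReal_sub _ (hp i).1.le, ENNReal.ofReal_one, ← h2,
    ENNReal.add_sub_cancel_left ENNReal.ofReal_ne_top]

theorem ae_vertex (h : VertexLaw p D) : ∀ᵐ z ∂D.toMeasure, ∀ i, z i = 1 ∨ z i = -1 := by
  have hmeas : MeasurableSet {z : Fin n → ℝ | ∀ i, z i = 1 ∨ z i = -1} := by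
    have : {z : Fin n → ℝ | ∀ i, z i = 1 ∨ z i = -1} = ⋂ i, ({z | z i = 1} ∪ {z | z i = -1}) := by
      ext; simp
    rw [this]
    exact MeasurableSet.iInter fun i =>
      (measurableSet_eq_fun (measurable_pi_apply i) measurable_const).union
        (measurableSet_eq_fun (measurable_pi_apply i) measurable_const)
  rw [ae_iff]
  change D.toMeasure {z : Fin n → ℝ | ∀ i, z i = 1 ∨ z i = -1}ᶜ = 0
  rw [PMF.toMeasure_apply_eq_zero_iff _ hmeas.compl, Set.disjoint_compl_right_iff_subset]
  exact fun z hz => h.vertex z hz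

theorem integrable (h : VertexLaw p D) {f : (Fin n → ℝ) → ℝ} (hf : Continuous f) :
    Integrable f D.toMeasure := by
  have hc : IsCompact (Set.pi Set.univ fun _ : Fin n => Set.Icc (-1 : ℝ) 1) :=
    isCompact_univ_pi fun _ => isCompact_Icc
  obtain ⟨C, hC⟩ := hc.exists_bound_of_continuousOn hf.continuousOn
  refine Integrable.of_bound hf.aestronglyMeasurable C ?_
  filter_upwards [h.ae_vertex] with z hz
  refine hC z fun i _ => ?_
  rcases hz i with hi | hi <;> rw [hi] <;> constructor <;> norm_num

/-- The bridge from extended nonnegative expectations to Bochner integrals; a continuous function is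
bounded on the vertices, which makes the expectation finite. -/
theorem expect_ofReal (h : VertexLaw p D) {f : (Fin n → ℝ) → ℝ} (hf : Continuous f)
    (h0 : ∀ z, 0 ≤ f z) :
    D.expect (fun z => ENNReal.ofReal (f z)) = ENNReal.ofReal (∫ z, f z ∂D.toMeasure) := by
  have hs := PMF.integral_eq_tsum D f (h.integrable hf)
  obtain ⟨C, hC⟩ : ∃ C, ∀ z ∈ D.support, f z ≤ C := by
    have hc : IsCompact (Set.pi Set.univ fun _ : Fin n => Set.Icc (-1 : ℝ) 1) :=
      isCompact_univ_pi fun _ => isCompact_Icc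
    obtain ⟨C, hC⟩ := hc.exists_bound_of_continuousOn hf.continuousOn
    refine ⟨C, fun z hz => (le_abs_self _).trans (hC z fun i _ => ?_)⟩
    rcases h.vertex z hz i with hi | hi <;> rw [hi] <;> constructor <;> norm_num
  have hfin : D.expect (fun z => ENNReal.ofReal (f z)) ≠ ⊤ := by
    refine ne_top_of_le_ne_top (b := ENNReal.ofReal C) ENNReal.ofReal_ne_top ?_
    rw [← D.expect_const (ENNReal.ofReal C)]
    exact PMF.expect_mono fun z hz => ENNReal.ofReal_le_ofReal (hC z hz)
  rw [hs, ← ENNReal.ofReal_toReal hfin, PMF.expect, ENNReal.tsum_toReal_eq]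
  · congr 1
    refine tsum_congr fun z => ?_
    rw [ENNReal.toReal_mul, ENNReal.toReal_ofReal (h0 z), smul_eq_mul]
  · exact fun z => ENNReal.mul_ne_top (D.apply_ne_top z) ENNReal.ofReal_ne_top

theorem integral_apply (h : VertexLaw p D) (hp : ∀ i, 0 < p i ∧ p i < 1) (i : Fin n) :
    ∫ z, z i ∂D.toMeasure = meanVec p i := by
  have h1 : D.expect (fun z => ENNReal.ofReal (|1 + z i|)) = ENNReal.ofReal (2 * p i) := by
    rw [← h.mean i]
    refine PMF.expect_congr fun z hz => ?_
    rw [abs_of_nonneg]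
    rcases h.vertex z hz i with hi | hi <;> rw [hi] <;> norm_num
  rw [h.expect_ofReal (by fun_prop) fun z => abs_nonneg _, ENNReal.ofReal_eq_ofReal_iff
    (integral_nonneg fun z => abs_nonneg _) (by linarith [(hp i).1])] at h1
  have h2 : ∫ z, |1 + z i| ∂D.toMeasure = ∫ z, (1 + z i) ∂D.toMeasure := by
    refine integral_congr_ae ?_
    filter_upwards [h.ae_vertex] with z hz
    rw [abs_of_nonneg]
    rcases hz i with hi | hi <;> rw [hi] <;> norm_num
  rw [h2, integral_add (integrable_const _) (h.integrable (continuous_apply i))] at h1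
  simp only [integral_const, probReal_univ, one_smul] at h1
  unfold meanVec
  linarith

theorem integral_mulVec (h : VertexLaw p D) (hp : ∀ i, 0 < p i ∧ p i < 1)
    (B : Matrix (Fin m) (Fin n) ℝ) (j : Fin m) :
    ∫ z, (B *ᵥ z) j ∂D.toMeasure = (B *ᵥ meanVec p) j := by
  simp only [mulVec, dotProduct]
  rw [integral_finsetSum _ fun i _ => (h.integrable (continuous_apply i)).const_mul _]
  refine Finset.sum_congr rfl fun i _ => ?_
  rw [integral_const_mul, h.integral_apply hp]

theorem covMat_apply (h : VertexLaw p D) (hp : ∀ i, 0 < p i ∧ p i < 1)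
    (B : Matrix (Fin m) (Fin n) ℝ) (j k : Fin m) :
    covMat B D j k =
      ∫ z, (B *ᵥ (z - meanVec p)) j * (B *ᵥ (z - meanVec p)) k ∂D.toMeasure := by
  rw [covMat, of_apply, ProbabilityTheory.covariance, h.integral_mulVec hp, h.integral_mulVec hp]
  simp only [mulVec_sub, Pi.sub_apply]

theorem continuous_mulVec_sub_apply (p : Fin n → ℝ) (B : Matrix (Fin m) (Fin n) ℝ) (j : Fin m) :
    Continuous fun z : Fin n → ℝ => (B *ᵥ (z - meanVec p)) j :=
  (continuous_apply j).comp (Continuous.matrix_mulVec continuous_const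
    (continuous_id.sub continuous_const))

theorem trace_covMat_mul (h : VertexLaw p D) (hp : ∀ i, 0 < p i ∧ p i < 1)
    (B : Matrix (Fin m) (Fin n) ℝ) {W : Matrix (Fin m) (Fin m) ℝ} (hW : W.IsHermitian) :
    (covMat B D * W).trace =
      ∫ z, (B *ᵥ (z - meanVec p)) ⬝ᵥ (W *ᵥ (B *ᵥ (z - meanVec p))) ∂D.toMeasure := by
  have hc := continuous_mulVec_sub_apply p B
  have e : ∀ z, (B *ᵥ (z - meanVec p)) ⬝ᵥ (W *ᵥ (B *ᵥ (z - meanVec p))) =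
      ∑ j, ∑ k, (B *ᵥ (z - meanVec p)) j * (B *ᵥ (z - meanVec p)) k * W j k := fun z => by
    rw [dotProduct]
    refine Finset.sum_congr rfl fun j _ => ?_
    rw [show (W *ᵥ (B *ᵥ (z - meanVec p))) j = ∑ k, W j k * (B *ᵥ (z - meanVec p)) k from rfl,
      Finset.mul_sum]
    exact Finset.sum_congr rfl fun k _ => by ring
  have hi : ∀ j k, Integrable
      (fun z => (B *ᵥ (z - meanVec p)) j * (B *ᵥ (z - meanVec p)) k * W j k) D.toMeasure :=
    fun j k => h.integrable (((hc j).mul (hc k)).mul continuous_const)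
  simp only [e]
  rw [integral_finsetSum _ fun j _ => integrable_finsetSum _ fun k _ => hi j k, trace]
  refine Finset.sum_congr rfl fun j _ => ?_
  rw [integral_finsetSum _ fun k _ => hi j k, diag_apply, mul_apply]
  refine Finset.sum_congr rfl fun k _ => ?_
  rw [integral_mul_const, h.covMat_apply hp, ← hW.apply j k, star_trivial]

theorem dotProduct_covMat (h : VertexLaw p D) (hp : ∀ i, 0 < p i ∧ p i < 1)
    (B : Matrix (Fin m) (Fin n) ℝ) (v : Fin m → ℝ) :
    v ⬝ᵥ (covMat B D *ᵥ v) = ∫ z, (v ⬝ᵥ (B *ᵥ (z - meanVec p))) ^ 2 ∂D.toMeasure := by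
  have hW : (vecMulVec v v).IsHermitian := by
    ext i j
    simp [vecMulVec_apply, mul_comm]
  have h1 := h.trace_covMat_mul hp B hW
  rw [mul_vecMulVec, trace_vecMulVec, dotProduct_comm] at h1
  rw [h1]
  congr 1
  funext z
  rw [vecMulVec_mulVec, dotProduct_smul, dotProduct_comm _ v, sq]
  rfl

theorem continuous_form (p : Fin n → ℝ) (B : Matrix (Fin m) (Fin n) ℝ) (v : Fin m → ℝ) :
    Continuous fun z : Fin n → ℝ => (v ⬝ᵥ (B *ᵥ (z - meanVec p))) ^ 2 :=
  (Continuous.dotProduct continuous_const (continuous_pi fun j =>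
    continuous_mulVec_sub_apply p B j)).pow 2

theorem expect_form (h : VertexLaw p D) (hp : ∀ i, 0 < p i ∧ p i < 1)
    (B : Matrix (Fin m) (Fin n) ℝ) (v : Fin m → ℝ) :
    D.expect (fun z => ENNReal.ofReal ((v ⬝ᵥ (B *ᵥ (z - meanVec p))) ^ 2)) =
      ENNReal.ofReal (v ⬝ᵥ (covMat B D *ᵥ v)) := by
  rw [h.dotProduct_covMat hp, h.expect_ofReal (continuous_form p B v) fun z => sq_nonneg _]

theorem posSemidef_covMat (h : VertexLaw p D) (hp : ∀ i, 0 < p i ∧ p i < 1)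
    (B : Matrix (Fin m) (Fin n) ℝ) : (covMat B D).PosSemidef := by
  refine posSemidef_of_dotProduct ?_ fun v => ?_
  · ext j k
    rw [conjTranspose_apply, star_trivial, h.covMat_apply hp, h.covMat_apply hp]
    simp only [mul_comm]
  · rw [h.dotProduct_covMat hp]
    exact integral_nonneg fun z => sq_nonneg _

theorem integral_sub_mean_sq (h : VertexLaw p D) (hp : ∀ i, 0 < p i ∧ p i < 1) (i : Fin n) :
    ∫ z, (z i - meanVec p i) ^ 2 ∂D.toMeasure = 4 * p i * (1 - p i) := by
  have h1 : ∫ z, (z i - meanVec p i) ^ 2 ∂D.toMeasure =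
      ∫ z, (1 + meanVec p i ^ 2 - 2 * meanVec p i * z i) ∂D.toMeasure := by
    refine integral_congr_ae ?_
    filter_upwards [h.ae_vertex] with z hz
    rcases hz i with hi | hi <;> rw [hi] <;> ring
  rw [h1, integral_sub (integrable_const _) ((h.integrable (continuous_apply i)).const_mul _),
    integral_const_mul, h.integral_apply hp]
  simp only [integral_const, probReal_univ, one_smul, meanVec]
  ring

end VertexLaw

/-! ### A priori bounds by the Bernoulli value. -/

section Bernoulli

variable {m n : ℕ}

theorem dotProduct_bernoulli (B : Matrix (Fin m) (Fin n) ℝ) (d : Fin n → ℝ) (v : Fin m → ℝ) :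
    v ⬝ᵥ ((B * diagonal d * Bᵀ) *ᵥ v) = ∑ i, d i * (Bᵀ *ᵥ v) i ^ 2 := by
  rw [← mulVec_mulVec, ← mulVec_mulVec, dotProduct_mulVec, ← mulVec_transpose, dotProduct]
  refine Finset.sum_congr rfl fun i _ => ?_
  rw [mulVec_diagonal]
  ring

theorem bernoulliValue_nonneg (B : Matrix (Fin m) (Fin n) ℝ) (p : Fin n → ℝ) :
    0 ≤ bernoulliValue B p := opNorm_nonneg _

theorem transpose_mulVec_sq_le_one {B : Matrix (Fin m) (Fin n) ℝ} (hB : ColumnsAtMostOne B)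
    {v : Fin m → ℝ} (hv : v ⬝ᵥ v = 1) (i : Fin n) : (Bᵀ *ᵥ v) i ^ 2 ≤ 1 := by
  have hcs := Finset.sum_mul_sq_le_sq_mul_sq Finset.univ (fun j => B j i) v
  have hb : ∑ j, B j i ^ 2 ≤ 1 := by
    have h2 : ‖WithLp.toLp 2 fun j => B j i‖ ^ 2 ≤ 1 := pow_le_one₀ (norm_nonneg _) (hB i)
    rw [norm_toLp_sq fun j => B j i, dotProduct] at h2
    simpa only [sq] using h2
  have hv' : ∑ j, v j ^ 2 = 1 := by
    rw [← hv, dotProduct]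
    exact Finset.sum_congr rfl fun j _ => sq _
  rw [hv', mul_one] at hcs
  exact hcs.trans hb

theorem bernoulliValue_le {B : Matrix (Fin m) (Fin n) ℝ} (hB : ColumnsAtMostOne B)
    {p : Fin n → ℝ} (hp : ∀ i, 0 < p i ∧ p i < 1) : bernoulliValue B p ≤ n := by
  have hd : ∀ i, 0 ≤ 4 * p i * (1 - p i) ∧ 4 * p i * (1 - p i) ≤ 1 := fun i =>
    ⟨mul_nonneg (by linarith [(hp i).1]) (by linarith [(hp i).2]),
      by nlinarith [sq_nonneg (2 * p i - 1)]⟩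
  have hpsd : (B * diagonal (fun i => 4 * p i * (1 - p i)) * Bᵀ).PosSemidef := by
    refine posSemidef_of_dotProduct ?_ fun v => ?_
    · rw [IsHermitian]
      simp [Matrix.mul_assoc]
    · rw [dotProduct_bernoulli]
      exact Finset.sum_nonneg fun i _ => mul_nonneg (hd i).1 (sq_nonneg _)
  refine hpsd.opNorm_le (Nat.cast_nonneg n) fun v hv => ?_
  rw [dotProduct_bernoulli]
  calc _ ≤ ∑ _i : Fin n, (1 : ℝ) := by
        refine Finset.sum_le_sum fun i _ => ?_
        have h1 := transpose_mulVec_sq_le_one hB hv i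
        calc _ ≤ 1 * (1 : ℝ) := mul_le_mul (hd i).2 h1 (sq_nonneg _) zero_le_one
          _ = 1 := one_mul 1
    _ = n := by simp

theorem eta_nonneg {ε : ℝ} (hε : 0 < ε) (B : Matrix (Fin m) (Fin n) ℝ) (p : Fin n → ℝ) :
    0 ≤ MWU.eta ε B p :=
  mul_nonneg (by linarith) (le_min (bernoulliValue_nonneg B p) (by positivity))

/-- If the minimum in η is the Bernoulli value this is clear; otherwise η > 1, and the Bernoulli
value is at most n. In particular η = 0 forces the Bernoulli value to vanish. -/
theorem bernoulliValue_le_mul_eta {B : Matrix (Fin m) (Fin n) ℝ} (hB : ColumnsAtMostOne B)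
    {p : Fin n → ℝ} (hp : ∀ i, 0 < p i ∧ p i < 1) {ε : ℝ} (hε : 0 < ε) :
    bernoulliValue B p ≤ n * MWU.eta ε B p := by
  have h0 := bernoulliValue_nonneg B p
  have hn := bernoulliValue_le hB hp
  have h2 : min (bernoulliValue B p) (1 + 1 / ε) ≤ MWU.eta ε B p := by
    have := le_min h0 (show 0 ≤ 1 + 1 / ε by positivity)
    unfold MWU.eta
    nlinarith
  rcases Nat.eq_zero_or_pos n with rfl | hpos
  · simpa using hn
  · have h1 : (1 : ℝ) ≤ n := by exact_mod_cast hpos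
    rcases le_total (bernoulliValue B p) (1 + 1 / ε) with h | h
    · rw [min_eq_left h] at h2
      nlinarith
    · rw [min_eq_right h] at h2
      have : 0 < 1 / ε := by positivity
      nlinarith

variable {p : Fin n → ℝ} {D : PMF (Fin n → ℝ)}

/-- Cauchy–Schwarz over the n coordinates replaces independence at the price of a factor n. The
bound yields a lower bound for the step sizes and settles the case η = 0. -/
theorem VertexLaw.dotProduct_covMat_le (h : VertexLaw p D) (hp : ∀ i, 0 < p i ∧ p i < 1)
    (B : Matrix (Fin m) (Fin n) ℝ) {v : Fin m → ℝ} (hv : v ⬝ᵥ v = 1) :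
    v ⬝ᵥ (covMat B D *ᵥ v) ≤ n * bernoulliValue B p := by
  have h1 := dotProduct_mulVec_le_opNorm (B * diagonal (fun i => 4 * p i * (1 - p i)) * Bᵀ) v
  rw [hv, mul_one, dotProduct_bernoulli] at h1
  have hc : ∀ i, Continuous fun z : Fin n → ℝ => (Bᵀ *ᵥ v) i ^ 2 * (z i - meanVec p i) ^ 2 :=
    fun i => by fun_prop
  rw [h.dotProduct_covMat hp]
  calc _ ≤ ∫ z, n * ∑ i, (Bᵀ *ᵥ v) i ^ 2 * (z i - meanVec p i) ^ 2 ∂D.toMeasure := by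
        refine integral_mono (h.integrable (continuous_form p B v))
          (h.integrable (continuous_const.mul (continuous_finsetSum _ fun i _ => hc i)))
          fun z => ?_
        rw [dotProduct_mulVec, ← mulVec_transpose, dotProduct]
        have := sq_sum_le_card_mul_sum_sq (s := Finset.univ)
          (f := fun i => (Bᵀ *ᵥ v) i * (z - meanVec p) i)
        simpa [mul_pow] using this
    _ = n * ∑ i, (Bᵀ *ᵥ v) i ^ 2 * (4 * p i * (1 - p i)) := by
        rw [integral_const_mul, integral_finsetSum _ fun i _ => h.integrable (hc i)]
        congr 1
        refine Finset.sum_congr rfl fun i _ => ?_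
        rw [integral_const_mul, h.integral_sub_mean_sq hp]
    _ ≤ n * bernoulliValue B p := by
        gcongr
        refine le_trans (le_of_eq ?_) h1
        exact Finset.sum_congr rfl fun i _ => by ring

theorem VertexLaw.opNorm_covMat_le (h : VertexLaw p D) (hp : ∀ i, 0 < p i ∧ p i < 1)
    (B : Matrix (Fin m) (Fin n) ℝ) : opNorm (covMat B D) ≤ n * bernoulliValue B p :=
  (h.posSemidef_covMat hp B).opNorm_le
    (mul_nonneg (Nat.cast_nonneg n) (bernoulliValue_nonneg B p))
    fun _ hv => h.dotProduct_covMat_le hp B hv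

end Bernoulli

/-! ### The law of the output of the oracle -/

namespace RandomWalk

variable {m n : ℕ} {B : Matrix (Fin m) (Fin n) ℝ} {p : Fin n → ℝ} {ε : ℝ}
  {W : Matrix (Fin m) (Fin m) ℝ} {K : ℕ}

/-- The law of the output of the oracle. -/
noncomputable def oracleLaw (K : ℕ) (ε : ℝ) (B : Matrix (Fin m) (Fin n) ℝ) (p : Fin n → ℝ)
    (W : Matrix (Fin m) (Fin m) ℝ) : PMF (Fin n → ℝ) :=
  (oracle K ε B p W).law.map fun r => r.getD 0

theorem vertexLaw_oracleLaw (hB : ColumnsAtMostOne B) (hp : ∀ i, 0 < p i ∧ p i < 1) (hε : 0 < ε)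
    (hW : W.PosSemidef) (hK : n < K) : VertexLaw p (oracleLaw K ε B p W) := by
  have h := halts_oracle hB hp hε hW hK
  exact ⟨fun z hz => h.of_mem_support_law 0 hz, fun i => by
    rw [oracleLaw, h.expect_law, ex_oracle_one_add hB hp hε hW hK]⟩

theorem trace_covMat_oracleLaw_mul_le (hB : ColumnsAtMostOne B) (hp : ∀ i, 0 < p i ∧ p i < 1)
    (hε : 0 < ε) (hW : W.PosSemidef) (hK : n < K) :
    (covMat B (oracleLaw K ε B p W) * W).trace ≤ MWU.eta ε B p * W.trace := by
  have h := vertexLaw_oracleLaw hB hp hε hW hK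
  have h1 := ex_oracle_form_le hB hp hε hW K
  rw [← (halts_oracle hB hp hε hW hK).expect_law 0] at h1
  change (oracleLaw K ε B p W).expect _ ≤ _ at h1
  have hcont : Continuous fun z : Fin n → ℝ =>
      (B *ᵥ (z - meanVec p)) ⬝ᵥ (W *ᵥ (B *ᵥ (z - meanVec p))) := by
    have : Continuous fun z : Fin n → ℝ => B *ᵥ (z - meanVec p) :=
      continuous_pi fun j => VertexLaw.continuous_mulVec_sub_apply p B j
    exact this.dotProduct (Continuous.matrix_mulVec continuous_const this)
  rw [h.expect_ofReal hcont fun z => hW.dotProduct_mulVec_nonneg' _,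
    ← h.trace_covMat_mul hp B hW.1] at h1
  refine (ENNReal.ofReal_le_ofReal_iff (mul_nonneg (eta_nonneg hε B p) ?_)).1 h1
  exact hW.trace_nonneg

end RandomWalk

end VertexLaws

/-! ### The main loop with the samples averaged out -/

namespace MWU

open Matrix

variable {m n : ℕ}

/-- The value at which the sum of the step sizes stops the main loop. -/
noncomputable def threshold (m : ℕ) (ε η : ℝ) : ℝ := 2 * Real.log m / (ε * η)

/-- The expected value of the output when the value of a sample drawn for the weights `W` is
replaced by its expectation `c W`; here `q` is the weighted sum of the values so far. -/
noncomputable def shadow (cov : Matrix (Fin m) (Fin m) ℝ → RComp (Matrix (Fin m) (Fin m) ℝ))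
    (c : Matrix (Fin m) (Fin m) ℝ → ℝ≥0∞) (η ε : ℝ) :
    ℕ → Matrix (Fin m) (Fin m) ℝ → Matrix (Fin m) (Fin m) ℝ → ℝ → ℝ≥0∞ → ℝ≥0∞
  | 0, _, _, _, _ => 0
  | K + 1, W, S, tot, q => (cov W).ex fun M =>
      if opNorm M = 0 then c W
      else if tot + ε / (6 * opNorm M) < threshold m ε η then
        shadow cov c η ε K (NormedSpace.exp (S + (ε / (6 * opNorm M)) • M))
          (S + (ε / (6 * opNorm M)) • M) (tot + ε / (6 * opNorm M))
          (q + ENNReal.ofReal (ε / (6 * opNorm M)) * c W)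
      else (q + ENNReal.ofReal (ε / (6 * opNorm M)) * c W) /
        ENNReal.ofReal (tot + ε / (6 * opNorm M))

/-- The accumulated value q influences no branch and enters the final value affinely, so averaging
over an independent draw may be moved inside q. -/
theorem ex_shadow {β : Type} {d : RComp β} {T : ℕ} {P : β → Prop} (hd : d.Halts T P)
    (cov : Matrix (Fin m) (Fin m) ℝ → RComp (Matrix (Fin m) (Fin m) ℝ))
    (c : Matrix (Fin m) (Fin m) ℝ → ℝ≥0∞) (η ε : ℝ) (g : β → ℝ≥0∞) (t : ℝ≥0∞) :
    ∀ (K : ℕ) (W S : Matrix (Fin m) (Fin m) ℝ) (tot : ℝ) (q : ℝ≥0∞),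
      (d.ex fun z => shadow cov c η ε K W S tot (q + t * g z)) =
        shadow cov c η ε K W S tot (q + t * d.ex g) := by
  intro K
  induction K with
  | zero => intro W S tot q; simpa [shadow] using hd.ex_const 0
  | succ K ih =>
    intro W S tot q
    simp only [shadow]
    rw [RComp.ex_comm]
    congr 1
    funext M
    split_ifs with h1 h2
    · exact hd.ex_const _
    · rw [add_right_comm, ← ih]
      congr 1
      funext z
      rw [add_right_comm]
    · have e : ∀ x, (q + t * x + ENNReal.ofReal (ε / (6 * opNorm M)) * c W) /
          ENNReal.ofReal (tot + ε / (6 * opNorm M)) =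
          (ENNReal.ofReal (tot + ε / (6 * opNorm M)))⁻¹ *
            ((q + ENNReal.ofReal (ε / (6 * opNorm M)) * c W) + t * x) := fun x => by
        rw [div_eq_mul_inv, mul_comm, add_right_comm]
      simp only [e, RComp.ex_const_mul, RComp.ex_add, hd.ex_const]

/-- The invariant of the main loop. -/
structure Invariant (P : (Fin n → ℝ) → Prop) (s : State m n) : Prop where
  hermitian : s.S.IsHermitian
  weight : s.W = NormedSpace.exp s.S
  items : ∀ x ∈ s.items, 0 < x.1 ∧ P x.2
  total : s.total = (s.items.map Prod.fst).sum

theorem Invariant.next {P : (Fin n → ℝ) → Prop} {s : State m n} (h : Invariant P s)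
    {M : Matrix (Fin m) (Fin m) ℝ} (hM : M.IsHermitian) {a : ℝ} (ha : 0 < a) {z : Fin n → ℝ}
    (hz : P z) :
    Invariant P ⟨NormedSpace.exp (s.S + a • M), s.S + a • M, s.total + a, s.items ++ [(a, z)]⟩ where
  hermitian := h.hermitian.add (by rw [IsHermitian, conjTranspose_smul, hM.eq, star_trivial])
  weight := rfl
  items := by
    intro x hx
    rcases List.mem_append.1 hx with hx | hx
    · exact h.items x hx
    · rw [List.mem_singleton.1 hx]
      exact ⟨ha, hz⟩
  total := by simp [h.total]

/-! ### The main loop: averaging, halting and the growth of the weights. -/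

section Pass

variable {O : Matrix (Fin m) (Fin m) ℝ → RComp (Fin n → ℝ)}
  {cov : Matrix (Fin m) (Fin m) ℝ → RComp (Matrix (Fin m) (Fin m) ℝ)} {η ε : ℝ}
  {P : (Fin n → ℝ) → Prop} {TO TC : ℕ} {amin : ℝ}

theorem step_pos (hε : 0 < ε) {M : Matrix (Fin m) (Fin m) ℝ} (h : opNorm M ≠ 0) :
    0 < ε / (6 * opNorm M) := by
  have : 0 < opNorm M := lt_of_le_of_ne (opNorm_nonneg M) (Ne.symm h)
  positivity

theorem ex_loop_pass (hε : 0 < ε)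
    (hO : ∀ S : Matrix (Fin m) (Fin m) ℝ, S.IsHermitian → (O (NormedSpace.exp S)).Halts TO P)
    (hcov : ∀ S : Matrix (Fin m) (Fin m) ℝ, S.IsHermitian →
      (cov (NormedSpace.exp S)).Halts TC fun M =>
        M.PosSemidef ∧ (opNorm M ≠ 0 → amin ≤ ε / (6 * opNorm M)))
    (g : (Fin n → ℝ) → ℝ≥0∞) :
    ∀ (K : ℕ) (s : State m n), Invariant P s →
      (RComp.loop (pass O cov η ε) K s).ex g =
        shadow cov (fun W => (O W).ex g) η ε K s.W s.S s.total
          (s.items.map fun x => ENNReal.ofReal x.1 * g x.2).sum := by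
  intro K
  induction K with
  | zero => intro s _; simp [RComp.loop, RComp.ex_cutOff, shadow]
  | succ K ih =>
    intro s hs
    have hO' : (O s.W).Halts TO P := by rw [hs.weight]; exact hO _ hs.hermitian
    have hcov' := hcov _ hs.hermitian
    rw [← hs.weight] at hcov'
    rw [RComp.ex_loop_succ, shadow]
    unfold pass
    rw [RComp.ex_bind]
    simp only [RComp.ex_bind (cov s.W)]
    -- Once M is fixed first, the branch taken no longer depends on z, and z can be averaged out.
    rw [RComp.ex_comm]
    refine hcov'.ex_congr fun M hM => ?_
    set q := (s.items.map fun x => ENNReal.ofReal x.1 * g x.2).sum with hq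
    set a := ε / (6 * opNorm M) with ha
    by_cases h1 : opNorm M = 0
    · simp only [RComp.ex_bind, RComp.ex_step, if_pos h1, Sum.elim_inr]
    · have hapos : 0 < a := step_pos hε h1
      have hsum : ∀ z, ((s.items ++ [(a, z)]).map fun x => ENNReal.ofReal x.1 * g x.2).sum =
          q + ENNReal.ofReal a * g z := fun z => by simp [hq]
      rw [if_neg h1]
      by_cases h2 : s.total + a < threshold m ε η
      · rw [if_pos h2, ← ex_shadow hO' cov _ η ε g]
        refine hO'.ex_congr fun z hz => ?_
        have h2' : s.total + a < 2 * Real.log m / (ε * η) := h2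
        have := ih _ (hs.next hM.1.1 hapos hz)
        simp only [hsum] at this
        rw [← this]
        simp only [RComp.ex_bind, RComp.ex_step, if_neg h1, ← ha, h2', decide_true, if_true,
          Sum.elim_inl]
        rfl
      · rw [if_neg h2]
        have h2' : ¬ s.total + a < 2 * Real.log m / (ε * η) := h2
        have : (O s.W).ex (fun z => (q + ENNReal.ofReal a * g z) / ENNReal.ofReal (s.total + a)) =
            (q + ENNReal.ofReal a * (O s.W).ex g) / ENNReal.ofReal (s.total + a) := by
          have e : ∀ z, (q + ENNReal.ofReal a * g z) / ENNReal.ofReal (s.total + a) =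
              (ENNReal.ofReal (s.total + a))⁻¹ * (q + ENNReal.ofReal a * g z) := fun z => by
            rw [div_eq_mul_inv, mul_comm]
          simp only [e, RComp.ex_const_mul, RComp.ex_add, hO'.ex_const]
          rw [div_eq_mul_inv, mul_comm]
        rw [← this]
        refine hO'.ex_congr fun z hz => ?_
        have hinv := hs.next hM.1.1 hapos hz
        have hsamp := RComp.ex_sample (s.items ++ [(a, z)]) (by simp)
          (fun x hx => (hinv.items x hx).1) g
        rw [hsum, ← hinv.total] at hsamp
        simp only [RComp.ex_bind, RComp.ex_step, if_neg h1, ← ha, h2', decide_false,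
          Bool.false_eq_true, if_false, Sum.elim_inr]
        exact hsamp

/-- The number of steps of a pass of the main loop that keeps at most `R` items. -/
def passCost (m n TO TC R : ℕ) : ℕ :=
  TO + (TC + ((m ^ 3 + 1) + (2 + (2 * m ^ 2 + (m ^ 3 + (1 + ((n + 1) + (4 + (R * (R + 4) + 1)))))))))

/-- The remaining passes r' are controlled by threshold ≤ total + (r'+1)·amin: a pass that continues
adds at least amin to the total. The bound on the length of the list limits the cost of the final
sampling. -/
theorem halts_loop_pass (hε : 0 < ε)
    (hO : ∀ S : Matrix (Fin m) (Fin m) ℝ, S.IsHermitian → (O (NormedSpace.exp S)).Halts TO P)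
    (hcov : ∀ S : Matrix (Fin m) (Fin m) ℝ, S.IsHermitian →
      (cov (NormedSpace.exp S)).Halts TC fun M =>
        M.PosSemidef ∧ (opNorm M ≠ 0 → amin ≤ ε / (6 * opNorm M)))
    {r K : ℕ} (hr : threshold m ε η ≤ (r + 1) * amin) (hK : r < K) :
    (RComp.loop (pass O cov η ε) K ⟨1, 0, 0, []⟩).Halts
      ((r + 1) * (passCost m n TO TC (r + 1) + 1)) P := by
  refine RComp.halts_loop (I := fun r' s => Invariant P s ∧
    threshold m ε η ≤ s.total + (r' + 1) * amin ∧ s.items.length + r' ≤ r) ?_ K r _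
    ⟨⟨isHermitian_zero, by simp, by simp, by simp⟩, by simpa using hr, by simp⟩ hK
  rintro r' s ⟨hs, hthr, hlen⟩
  have hO' : (O s.W).Halts TO P := by rw [hs.weight]; exact hO _ hs.hermitian
  have hcov' := hcov _ hs.hermitian
  rw [← hs.weight] at hcov'
  unfold pass passCost
  refine hO'.bind fun z hz => hcov'.bind fun M hM => ?_
  refine RComp.halts_step_bind ?_ le_rfl
  by_cases h1 : opNorm M = 0
  · rw [if_pos h1]
    exact RComp.halts_step_of_le (by omega) hz
  · rw [if_neg h1]
    set a := ε / (6 * opNorm M) with ha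
    have hapos : 0 < a := step_pos hε h1
    have hinv := hs.next hM.1.1 hapos hz
    refine RComp.halts_step_bind ?_ le_rfl
    refine RComp.halts_step_bind ?_ le_rfl
    refine RComp.halts_step_bind ?_ le_rfl
    refine RComp.halts_step_bind ?_ le_rfl
    refine RComp.halts_step_bind ?_ le_rfl
    refine RComp.halts_step_bind ?_ le_rfl
    by_cases h2 : s.total + a < threshold m ε η
    · have h2' : s.total + a < 2 * Real.log m / (ε * η) := h2
      simp only [h2', decide_true, if_true]
      refine RComp.halts_step_of_le (by omega) ?_
      have hle := hM.2 h1
      -- For r' = 0 this single step would already reach the threshold, so the loop would not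
      -- continue.
      have hr1 : 1 ≤ r' := by
        by_contra h
        have h0 : r' = 0 := by omega
        rw [h0] at hthr
        norm_num at hthr
        linarith
      have hcast : ((r' - 1 : ℕ) : ℝ) + 1 = r' := by
        rw [Nat.cast_sub hr1]; simp
      refine ⟨r' - 1, by omega, hinv, ?_, ?_⟩
      · rw [hcast]
        simp only
        linarith
      · simp only [List.length_append, List.length_singleton]
        omega
    · have h2' : ¬ s.total + a < 2 * Real.log m / (ε * η) := h2
      simp only [h2', decide_false, Bool.false_eq_true, if_false]
      refine ((RComp.halts_sample (s.items ++ [(a, z)]) (by simp) hinv.items).mono (T' :=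
        (r + 1) * ((r + 1) + 4)) ?_ fun _ h => h).bind fun z hz => RComp.halts_step _ _ hz
      have : (s.items ++ [(a, z)]).length ≤ r + 1 := by
        simp only [List.length_append, List.length_singleton]
        omega
      exact Nat.mul_le_mul this (by omega)

/-- A weighted mean of equal values is that value, along every run. It transfers the exact mean of
the oracle to the output. -/
theorem shadow_const (hε : 0 < ε)
    (hcov : ∀ S : Matrix (Fin m) (Fin m) ℝ, S.IsHermitian →
      (cov (NormedSpace.exp S)).Halts TC fun M =>
        M.PosSemidef ∧ (opNorm M ≠ 0 → amin ≤ ε / (6 * opNorm M)))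
    {c : Matrix (Fin m) (Fin m) ℝ → ℝ≥0∞} {κ : ℝ≥0∞}
    (hc : ∀ S : Matrix (Fin m) (Fin m) ℝ, S.IsHermitian → c (NormedSpace.exp S) = κ) :
    ∀ (K r : ℕ) (S : Matrix (Fin m) (Fin m) ℝ) (tot : ℝ), S.IsHermitian → 0 ≤ tot →
      threshold m ε η ≤ tot + (r + 1) * amin → r < K →
      shadow cov c η ε K (NormedSpace.exp S) S tot (ENNReal.ofReal tot * κ) = κ := by
  intro K
  induction K with
  | zero => intro r _ _ _ _ _ h; omega
  | succ K ih =>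
    intro r S tot hS htot hthr hr
    rw [shadow, hc S hS, ← (hcov S hS).ex_const κ]
    refine (hcov S hS).ex_congr fun M hM => ?_
    rw [(hcov S hS).ex_const κ]
    split_ifs with h1 h2
    · rfl
    · have hle := hM.2 h1
      have hapos := step_pos hε h1
      set a := ε / (6 * opNorm M) with ha
      have hr1 : 1 ≤ r := by
        by_contra h
        have h0 : r = 0 := by omega
        rw [h0] at hthr
        norm_num at hthr
        linarith
      have hcast : ((r - 1 : ℕ) : ℝ) + 1 = r := by
        rw [Nat.cast_sub hr1]; simp
      rw [← add_mul, ← ENNReal.ofReal_add htot hapos.le]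
      refine ih (r - 1) _ _ (hS.add (by rw [IsHermitian, conjTranspose_smul, hM.1.1.eq,
        star_trivial])) (by positivity) ?_ (by omega)
      rw [hcast]
      linarith
    · have hapos := step_pos hε h1
      rw [← add_mul, ← ENNReal.ofReal_add htot hapos.le, mul_comm, mul_div_assoc,
        ENNReal.div_self, mul_one]
      · simpa using add_pos_of_nonneg_of_pos htot hapos
      · exact ENNReal.ofReal_ne_top

theorem entrySum_sub_comm (X Y : Matrix (Fin m) (Fin m) ℝ) :
    entrySum (X - Y) = entrySum (Y - X) := by
  simp only [entrySum, Matrix.sub_apply, abs_sub_comm]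

/-- The growth of the trace of the weight matrix in one pass. -/
theorem trace_exp_add_smul_le {S M C : Matrix (Fin m) (Fin m) ℝ} (hS : S.IsHermitian)
    (hM : M.PosSemidef) (hε : 0 < ε) (hε1 : ε < 1) (h0 : opNorm M ≠ 0)
    (hC : (C * NormedSpace.exp S).trace ≤ η * (NormedSpace.exp S).trace) :
    (NormedSpace.exp (S + (ε / (6 * opNorm M)) • M)).trace ≤ (NormedSpace.exp S).trace *
      Real.exp ((1 + 2 / 5 * ε) * (ε / (6 * opNorm M) * (η + entrySum (M - C)))) := by
  have hapos := step_pos hε h0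
  have hnrm : 0 < opNorm M := lt_of_le_of_ne (opNorm_nonneg M) (Ne.symm h0)
  set a := ε / (6 * opNorm M) with ha
  set e := entrySum (M - C)
  have hW := hS.posSemidef_exp
  have hD : (a • M).PosSemidef := hM.smul hapos.le
  -- The step size is chosen to give the increment norm ε/6, so the update lemma applies with δ =
  -- ε/6.
  have han : a * opNorm M = ε / 6 := by rw [ha]; field_simp
  have h1 := trace_exp_add_le hS hD (δ := ε / 6) (by linarith) fun v hv => by
    rw [smul_mulVec, dotProduct_smul, smul_eq_mul, ← han]
    have := dotProduct_mulVec_le_opNorm M v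
    rw [hv, mul_one] at this
    exact mul_le_mul_of_nonneg_left this hapos.le
  have h2 : (M * NormedSpace.exp S).trace ≤ (η + e) * (NormedSpace.exp S).trace := by
    have := hW.trace_mul_le (Δ := M - C) (c := e) fun v hv => dotProduct_mulVec_le_entrySum _ hv
    rw [sub_mul, trace_sub] at this
    linarith
  have h3 := hW.trace_mul_nonneg hM
  -- The constant 2/5 is exact at ε = 1, where the ratio is 7/5.
  have h4 : (1 + ε / 6) / (1 - ε / 6) ≤ 1 + 2 / 5 * ε := by
    rw [div_le_iff₀ (by linarith)]
    nlinarith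
  rw [smul_mul, trace_smul, smul_eq_mul] at h1
  calc _ ≤ _ := h1
    _ ≤ (NormedSpace.exp S).trace + (1 + 2 / 5 * ε) *
        (a * ((η + e) * (NormedSpace.exp S).trace)) := by
      have h5 : 0 ≤ a * (M * NormedSpace.exp S).trace := mul_nonneg hapos.le h3
      have h6 := mul_le_mul_of_nonneg_left h2 hapos.le
      have h7 := mul_le_mul h4 h6 h5 (by linarith)
      linarith
    _ = (NormedSpace.exp S).trace * ((1 + 2 / 5 * ε) * (a * (η + e)) + 1) := by ring
    _ ≤ _ := mul_le_mul_of_nonneg_left (Real.add_one_le_exp _) hW.trace_nonneg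

/-- Taking logarithms, vᵀSv ≤ ln m + (1+2ε/5)(η tot + err), and the threshold gives ln m ≤ εη tot/2;
hence 2/5 + 1/2 = 9/10. The error occurs once in the trace and once in the form, with total factor
at most 3. -/
theorem form_div_le {S : Matrix (Fin m) (Fin m) ℝ} (hS : S.IsHermitian) {v : Fin m → ℝ}
    (hv : v ⬝ᵥ v = 1) (hε : 0 < ε) (hε1 : ε < 1) (hη : 0 < η) {tot err G : ℝ} (htot : 0 < tot)
    (herr : err ≤ tot * G) (hG : 0 ≤ G) (hthr : threshold m ε η ≤ tot)
    (htr : (NormedSpace.exp S).trace ≤ m * Real.exp ((1 + 2 / 5 * ε) * (η * tot + err))) :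
    (v ⬝ᵥ (S *ᵥ v) + err) / tot ≤ (1 + 9 / 10 * ε) * η + 3 * G := by
  have hm : (0 : ℝ) < m := by
    rcases Nat.eq_zero_or_pos m with rfl | h
    · simp [dotProduct] at hv
    · exact_mod_cast h
  have h1 := (exp_dotProduct_mulVec_le hS hv).trans htr
  rw [← Real.exp_log hm, ← Real.exp_add, Real.exp_le_exp] at h1
  have h2 : Real.log m ≤ ε * η * tot / 2 := by
    rw [threshold, div_le_iff₀ (by positivity)] at hthr
    linarith
  rw [div_le_iff₀ htot]
  have h3 : 0 ≤ tot * G := by positivity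
  have h4 : (2 + 2 / 5 * ε) * err ≤ (2 + 2 / 5 * ε) * (tot * G) :=
    mul_le_mul_of_nonneg_left herr (by linarith)
  have h5 : (2 + 2 / 5 * ε) * (tot * G) ≤ 3 * (tot * G) :=
    mul_le_mul_of_nonneg_right (by linarith) h3
  nlinarith

/-- If the expected error of the supplied matrices is at most `ξ` per pass, then the expected value
of the quadratic form exceeds `(1 + 9ε/10) η` by little. -/
theorem shadow_le (hε : 0 < ε) (hε1 : ε < 1) (hη : 0 < η)
    (hcov : ∀ S : Matrix (Fin m) (Fin m) ℝ, S.IsHermitian →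
      (cov (NormedSpace.exp S)).Halts TC fun M =>
        M.PosSemidef ∧ (opNorm M ≠ 0 → amin ≤ ε / (6 * opNorm M)))
    {C : Matrix (Fin m) (Fin m) ℝ → Matrix (Fin m) (Fin m) ℝ}
    (hCpos : ∀ S : Matrix (Fin m) (Fin m) ℝ, S.IsHermitian → (C (NormedSpace.exp S)).PosSemidef)
    (hC : ∀ S : Matrix (Fin m) (Fin m) ℝ, S.IsHermitian →
      (C (NormedSpace.exp S) * NormedSpace.exp S).trace ≤ η * (NormedSpace.exp S).trace)
    {ξ : ℝ} (hξ : 0 ≤ ξ)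
    (herror : ∀ S : Matrix (Fin m) (Fin m) ℝ, S.IsHermitian →
      (cov (NormedSpace.exp S)).ex (fun M => ENNReal.ofReal
        (entrySum (M - C (NormedSpace.exp S)))) ≤ ENNReal.ofReal ξ)
    {v : Fin m → ℝ} (hv : v ⬝ᵥ v = 1) :
    ∀ (K r : ℕ) (S : Matrix (Fin m) (Fin m) ℝ) (tot : ℝ) (q : ℝ≥0∞) (err G : ℝ),
      S.PosSemidef → 0 ≤ tot → threshold m ε η ≤ tot + (r + 1) * amin →
      0 ≤ err → 0 ≤ G → err ≤ tot * G →
      (NormedSpace.exp S).trace ≤ m * Real.exp ((1 + 2 / 5 * ε) * (η * tot + err)) →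
      q ≤ ENNReal.ofReal (v ⬝ᵥ (S *ᵥ v) + err) →
      shadow cov (fun W => ENNReal.ofReal (v ⬝ᵥ (C W *ᵥ v))) η ε K (NormedSpace.exp S) S tot q ≤
        ENNReal.ofReal ((1 + 9 / 10 * ε) * η + 3 * G + 3 * (r + 1) * ξ) := by
  intro K
  induction K with
  | zero => intros; simp [shadow]
  | succ K ih =>
    -- Here `err` is a step-weighted sum of the errors of the passes so far and `G` their plain sum.
    -- Since err ≤ tot·G, the division by the random total at the end leaves an error of order `G`,
    -- which can be averaged pass by pass.
    intro r S tot q err G hS htot hthr herr0 hG herr htr hq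
    have hbase : 0 ≤ (1 + 9 / 10 * ε) * η := by positivity
    have hCv := (hCpos S hS.1).dotProduct_mulVec_nonneg' v
    have hSv := hS.dotProduct_mulVec_nonneg' v
    rw [shadow]
    calc _ ≤ (cov (NormedSpace.exp S)).ex (fun M =>
          ENNReal.ofReal ((1 + 9 / 10 * ε) * η + 3 * G + 3 * r * ξ) +
            3 * ENNReal.ofReal (entrySum (M - C (NormedSpace.exp S)))) := by
          refine (hcov S hS.1).ex_mono fun M hM => ?_
          set e := entrySum (M - C (NormedSpace.exp S)) with he
          have he0 : 0 ≤ e := entrySum_nonneg _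
          have hCM : v ⬝ᵥ (C (NormedSpace.exp S) *ᵥ v) ≤ v ⬝ᵥ (M *ᵥ v) + e := by
            have := dotProduct_mulVec_le_entrySum (C (NormedSpace.exp S) - M) hv
            rw [entrySum_sub_comm, ← he, sub_mulVec, dotProduct_sub] at this
            linarith
          have hrξ : 0 ≤ 3 * (r : ℝ) * ξ := by positivity
          have hcomb : ENNReal.ofReal ((1 + 9 / 10 * ε) * η + 3 * G + 3 * r * ξ) +
              3 * ENNReal.ofReal e =
              ENNReal.ofReal ((1 + 9 / 10 * ε) * η + 3 * (G + e) + 3 * r * ξ) := by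
            rw [← ENNReal.ofReal_ofNat 3, ← ENNReal.ofReal_mul (by norm_num),
              ← ENNReal.ofReal_add (by positivity) (by positivity)]
            congr 1
            ring
          rw [hcomb]
          -- If the supplied matrix is zero, the true form of the returned sample is itself at most
          -- the error e.
          by_cases h1 : opNorm M = 0
          · rw [if_pos h1]
            apply ENNReal.ofReal_le_ofReal
            rw [opNorm_eq_zero.1 h1] at hCM
            simp only [zero_mulVec, dotProduct_zero, zero_add] at hCM
            linarith
          · rw [if_neg h1]
            have hapos := step_pos hε h1
            have hstep := trace_exp_add_smul_le hS.1 hM.1 hε hε1 h1 (hC S hS.1)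
            have hle := hM.2 h1
            rw [← he] at hstep
            set a := ε / (6 * opNorm M) with ha
            have hS' : (S + a • M).PosSemidef := hS.add (hM.1.smul hapos.le)
            have htr' : (NormedSpace.exp (S + a • M)).trace ≤
                m * Real.exp ((1 + 2 / 5 * ε) * (η * (tot + a) + (err + a * e))) := by
              refine hstep.trans ?_
              refine (mul_le_mul_of_nonneg_right htr (Real.exp_pos _).le).trans_eq ?_
              rw [mul_assoc, ← Real.exp_add]
              congr 2
              ring
            have hq' : q + ENNReal.ofReal a *
                ENNReal.ofReal (v ⬝ᵥ (C (NormedSpace.exp S) *ᵥ v)) ≤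
                ENNReal.ofReal (v ⬝ᵥ ((S + a • M) *ᵥ v) + (err + a * e)) := by
              rw [← ENNReal.ofReal_mul hapos.le]
              refine (add_le_add_left hq _).trans ?_
              rw [← ENNReal.ofReal_add (by positivity) (by positivity)]
              apply ENNReal.ofReal_le_ofReal
              rw [add_mulVec, dotProduct_add, smul_mulVec, dotProduct_smul, smul_eq_mul]
              nlinarith
            have herr' : err + a * e ≤ (tot + a) * (G + e) := by
              nlinarith [mul_nonneg htot he0, mul_nonneg hapos.le hG]
            split_ifs with h2
            · have hr1 : 1 ≤ r := by
                by_contra h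
                have h0 : r = 0 := by omega
                rw [h0] at hthr
                norm_num at hthr
                linarith
              have hcast : ((r - 1 : ℕ) : ℝ) + 1 = r := by
                rw [Nat.cast_sub hr1]; simp
              have := ih (r - 1) (S + a • M) (tot + a) _ (err + a * e) (G + e) hS'
                (by positivity) (by rw [hcast]; linarith) (by positivity) (by positivity)
                herr' htr' hq'
              rwa [hcast] at this
            · have htot' : 0 < tot + a := by positivity
              calc _ ≤ ENNReal.ofReal (v ⬝ᵥ ((S + a • M) *ᵥ v) + (err + a * e)) /
                    ENNReal.ofReal (tot + a) := ENNReal.div_le_div_right hq' _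
                _ = ENNReal.ofReal ((v ⬝ᵥ ((S + a • M) *ᵥ v) + (err + a * e)) / (tot + a)) :=
                    (ENNReal.ofReal_div_of_pos htot').symm
                _ ≤ _ := by
                    apply ENNReal.ofReal_le_ofReal
                    have := form_div_le hS'.1 hv hε hε1 hη htot' herr' (by positivity)
                      (not_lt.1 h2) htr'
                    linarith
      _ ≤ ENNReal.ofReal ((1 + 9 / 10 * ε) * η + 3 * G + 3 * r * ξ) + 3 * ENNReal.ofReal ξ := by
          rw [RComp.ex_add, (hcov S hS.1).ex_const, RComp.ex_const_mul]
          gcongr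
          exact herror S hS.1
      _ = _ := by
          rw [← ENNReal.ofReal_ofNat 3, ← ENNReal.ofReal_mul (by norm_num),
            ← ENNReal.ofReal_add (by positivity) (by positivity)]
          congr 1
          ring

end Pass

/-! ### The whole algorithm -/

section Run

open RandomWalk

variable {B : Matrix (Fin m) (Fin n) ℝ} {p : Fin n → ℝ} {ε : ℝ}
  {cov : Matrix (Fin m) (Fin m) ℝ → RComp (Matrix (Fin m) (Fin m) ℝ)} {TC : ℕ} {amin ξ : ℝ}

/-- The number of steps of the algorithm with at most `R` passes. -/
def runCost (m n TC R : ℕ) : ℕ :=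
  (4 * n + m * n + m * m * n + m ^ 3 + 4) +
    (m ^ 2 + R * (passCost m n (oracleCost m n) TC R + 1))

/-- Common to both versions: they differ only in the lower bound `amin` for the steps and the error
`ξ` per pass. The total error 3(r+1)ξ ≤ εη/10 raises (1+9ε/10)η to (1+ε)η. -/
theorem run_spec (hB : ColumnsAtMostOne B) (hp : ∀ i, 0 < p i ∧ p i < 1) (hε : 0 < ε) (hε1 : ε < 1)
    {r K : ℕ} (hnK : n < K) (hrK : r < K)
    (hcov : ∀ S : Matrix (Fin m) (Fin m) ℝ, S.IsHermitian →
      (cov (NormedSpace.exp S)).Halts TC fun M =>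
        M.PosSemidef ∧ (opNorm M ≠ 0 → amin ≤ ε / (6 * opNorm M)))
    (hr : threshold m ε (eta ε B p) ≤ (r + 1) * amin) (hξ : 0 ≤ ξ)
    (herror : 0 < eta ε B p → ∀ S : Matrix (Fin m) (Fin m) ℝ, S.IsHermitian →
      (cov (NormedSpace.exp S)).ex (fun M => ENNReal.ofReal
        (entrySum (M - covMat B (oracleLaw K ε B p (NormedSpace.exp S))))) ≤ ENNReal.ofReal ξ)
    (hrξ : 3 * (r + 1) * ξ ≤ ε * eta ε B p / 10) :
    (run K cov ε B p).Halts (runCost m n TC (r + 1)) (fun z => ∀ i, z i = 1 ∨ z i = -1) ∧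
      ReturnsGoodAssignment ε B p (run K cov ε B p) := by
  have hO : ∀ S : Matrix (Fin m) (Fin m) ℝ, S.IsHermitian →
      (oracle K ε B p (NormedSpace.exp S)).Halts (oracleCost m n)
        (fun z => ∀ i, z i = 1 ∨ z i = -1) := fun S hS =>
    halts_oracle hB hp hε hS.posSemidef_exp hnK
  have hlaw : ∀ S : Matrix (Fin m) (Fin m) ℝ, S.IsHermitian →
      VertexLaw p (oracleLaw K ε B p (NormedSpace.exp S)) := fun S hS =>
    vertexLaw_oracleLaw hB hp hε hS.posSemidef_exp hnK
  have hhalt : (run K cov ε B p).Halts (runCost m n TC (r + 1))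
      (fun z => ∀ i, z i = 1 ∨ z i = -1) := by
    unfold run runCost
    refine RComp.halts_step_bind ?_ le_rfl
    refine RComp.halts_step_bind ?_ le_rfl
    exact halts_loop_pass hε hO hcov hr hrK
  have hex : ∀ g, (run K cov ε B p).ex g =
      shadow cov (fun W => (oracle K ε B p W).ex g) (eta ε B p) ε K (NormedSpace.exp 0) 0 0 0 :=
    fun g => by
    unfold run
    simp only [RComp.ex_bind, RComp.ex_step]
    rw [ex_loop_pass hε hO hcov g K _ ⟨isHermitian_zero, by simp, by simp, by simp⟩]
    simp
  set D := (run K cov ε B p).law.map fun r => r.getD 0 with hD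
  have hvl : VertexLaw p D := by
    refine ⟨fun z hz => hhalt.of_mem_support_law 0 hz, fun i => ?_⟩
    rw [hD, hhalt.expect_law, hex]
    have := shadow_const (m := m) (η := eta ε B p) hε hcov
      (c := fun W => (oracle K ε B p W).ex fun z => ENNReal.ofReal (1 + z i))
      (κ := ENNReal.ofReal (2 * p i))
      (fun S hS => ex_oracle_one_add hB hp hε hS.posSemidef_exp hnK i) K r 0 0 isHermitian_zero
      le_rfl (by simpa using hr) hrK
    simpa using this
  refine ⟨hhalt, D, hhalt.law_eq 0, hvl.feasible hp, ?_⟩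
  have hη0 := eta_nonneg hε B p
  have htarget : (1 + ε) ^ 2 * min (bernoulliValue B p) (1 + 1 / ε) = (1 + ε) * eta ε B p := by
    unfold eta; ring
  rw [htarget]
  -- If η = 0 the Bernoulli value is zero, and then every law on the vertices with this mean has
  -- zero covariance.
  rcases hη0.eq_or_lt with hη | hη
  · have h1 := bernoulliValue_le_mul_eta hB hp hε
    rw [← hη, mul_zero] at h1
    have h2 := hvl.opNorm_covMat_le hp B
    rw [← hη, mul_zero]
    exact h2.trans (mul_nonpos_of_nonneg_of_nonpos (Nat.cast_nonneg n) h1)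
  · refine (hvl.posSemidef_covMat hp B).opNorm_le (by positivity) fun v hv => ?_
    have h1 := hvl.expect_form hp B v
    rw [hD, hhalt.expect_law, hex, ← hD] at h1
    have hc : ∀ S : Matrix (Fin m) (Fin m) ℝ, S.IsHermitian →
        (oracle K ε B p (NormedSpace.exp S)).ex
          (fun z => ENNReal.ofReal ((v ⬝ᵥ (B *ᵥ (z - meanVec p))) ^ 2)) =
        ENNReal.ofReal (v ⬝ᵥ (covMat B (oracleLaw K ε B p (NormedSpace.exp S)) *ᵥ v)) :=
      fun S hS => by
      rw [← (hlaw S hS).expect_form hp B v, oracleLaw, (hO S hS).expect_law]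
    have hcongr : ∀ (K' : ℕ) (S : Matrix (Fin m) (Fin m) ℝ) (tot : ℝ) (q : ℝ≥0∞),
        S.IsHermitian →
        shadow cov (fun W => (oracle K ε B p W).ex
          (fun z => ENNReal.ofReal ((v ⬝ᵥ (B *ᵥ (z - meanVec p))) ^ 2))) (eta ε B p) ε K'
          (NormedSpace.exp S) S tot q =
        shadow cov (fun W => ENNReal.ofReal (v ⬝ᵥ (covMat B (oracleLaw K ε B p W) *ᵥ v)))
          (eta ε B p) ε K' (NormedSpace.exp S) S tot q := by
      intro K'
      induction K' with
      | zero => intros; rfl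
      | succ K' ih =>
        intro S tot q hS
        simp only [shadow, hc S hS]
        refine (hcov S hS).ex_congr fun M hM => ?_
        split_ifs
        · rfl
        · exact ih _ _ _ (hS.add (by rw [IsHermitian, conjTranspose_smul, hM.1.1.eq, star_trivial]))
        · rfl
    rw [hcongr K 0 0 0 isHermitian_zero] at h1
    have h2 := shadow_le (η := eta ε B p) hε hε1 hη hcov
      (C := fun W => covMat B (oracleLaw K ε B p W))
      (fun S hS => (hlaw S hS).posSemidef_covMat hp B)
      (fun S hS => trace_covMat_oracleLaw_mul_le hB hp hε hS.posSemidef_exp hnK)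
      hξ (herror hη) hv K r 0 0 0 0 0 PosSemidef.zero le_rfl (by simpa using hr) le_rfl le_rfl
      (by simp) (by simp) (by simp)
    rw [h1] at h2
    have h3 := (ENNReal.ofReal_le_ofReal_iff (by positivity)).1 h2
    linarith

end Run

end MWU

namespace RComp

theorem ex_finsetSum {α ι : Type} (c : RComp α) (s : Finset ι) (f : ι → α → ℝ≥0∞) :
    (c.ex fun a => ∑ i ∈ s, f i a) = ∑ i ∈ s, c.ex (f i) := by
  classical
  induction s using Finset.induction_on with
  | empty => simpa using c.ex_const_mul 0 fun _ => 0
  | insert i s hi ih => simp only [Finset.sum_insert hi, ex_add, ih]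

end RComp

/-! ### Empirical covariance matrices -/

namespace MWU

open Matrix RandomWalk MeasureTheory

variable {m n : ℕ} {B : Matrix (Fin m) (Fin n) ℝ} {p : Fin n → ℝ} {ε : ℝ}

theorem abs_dotProduct_mulVec_sub_le (hB : ColumnsAtMostOne B) (hp : ∀ i, 0 < p i ∧ p i < 1)
    {v : Fin m → ℝ} (hv : v ⬝ᵥ v = 1) {z : Fin n → ℝ} (hz : ∀ i, z i = 1 ∨ z i = -1) :
    |v ⬝ᵥ (B *ᵥ (z - meanVec p))| ≤ 2 * n := by
  rw [dotProduct_mulVec, ← mulVec_transpose, dotProduct]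
  refine (Finset.abs_sum_le_sum_abs _ _).trans ?_
  calc _ ≤ ∑ _i : Fin n, (2 : ℝ) := by
        refine Finset.sum_le_sum fun i _ => ?_
        have h1 := (sq_le_one_iff_abs_le_one _).1 (transpose_mulVec_sq_le_one hB hv i)
        have h2 : |(z - meanVec p) i| ≤ 2 := by
          rw [abs_le, Pi.sub_apply, meanVec]
          rcases hz i with h | h <;> rw [h] <;> constructor <;> linarith [(hp i).1, (hp i).2]
        rw [abs_mul]
        calc _ ≤ 1 * (2 : ℝ) := mul_le_mul h1 h2 (abs_nonneg _) zero_le_one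
          _ = 2 := one_mul 2
    _ = 2 * n := by simp [mul_comm]

theorem abs_mulVec_sub_apply_le (hB : ColumnsAtMostOne B) (hp : ∀ i, 0 < p i ∧ p i < 1)
    {z : Fin n → ℝ} (hz : ∀ i, z i = 1 ∨ z i = -1) (j : Fin m) :
    |(B *ᵥ (z - meanVec p)) j| ≤ 2 * n := by
  classical
  have := abs_dotProduct_mulVec_sub_le hB hp (v := Pi.single j 1) (by simp) hz
  simpa using this

/-- The number of steps for the sum over `N` samples. -/
def sampleSumCost (m n N : ℕ) : ℕ :=
  N * (oracleCost m n + (2 * m * n + 3 * n) + 2 * m ^ 2) + m ^ 2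

section

variable {S : Matrix (Fin m) (Fin m) ℝ} {K : ℕ}

theorem halts_sampleSum (hB : ColumnsAtMostOne B) (hp : ∀ i, 0 < p i ∧ p i < 1) (hε : 0 < ε)
    (hS : S.IsHermitian) (hK : n < K) (N : ℕ) :
    (sampleSum K ε B p (NormedSpace.exp S) N).Halts (sampleSumCost m n N) fun M =>
      M.PosSemidef ∧ ∀ v : Fin m → ℝ, v ⬝ᵥ v = 1 → v ⬝ᵥ (M *ᵥ v) ≤ N * (2 * n) ^ 2 := by
  induction N with
  | zero =>
    rw [sampleSum]
    exact RComp.halts_step_of_le (by simp [sampleSumCost])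
      ⟨PosSemidef.zero, fun v _ => by simp⟩
  | succ N ih =>
    rw [sampleSum]
    refine ((halts_oracle hB hp hε hS.posSemidef_exp hK).bind (T' := (2 * m * n + 3 * n) +
      (sampleSumCost m n N + 2 * m ^ 2)) fun z hz => ?_).mono
        (by unfold sampleSumCost; ring_nf; omega) fun _ h => h
    refine RComp.halts_step_bind ?_ le_rfl
    refine ih.bind fun M hM => RComp.halts_step _ _ ⟨?_, fun v hv => ?_⟩
    · refine PosSemidef.add ?_ hM.1
      simpa using posSemidef_vecMulVec_self_star (B *ᵥ (z - meanVec p))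
    · rw [add_mulVec, dotProduct_add, vecMulVec_mulVec]
      have h1 : v ⬝ᵥ (MulOpposite.op ((B *ᵥ (z - meanVec p)) ⬝ᵥ v) • (B *ᵥ (z - meanVec p))) =
          |v ⬝ᵥ (B *ᵥ (z - meanVec p))| ^ 2 := by
        rw [dotProduct_smul, sq_abs, dotProduct_comm _ v, sq]
        rfl
      have h2 := abs_dotProduct_mulVec_sub_le hB hp hv hz
      have h3 := pow_le_pow_left₀ (abs_nonneg _) h2 2
      rw [h1]
      push_cast
      linarith [hM.2 v hv]

/-- The norm bound (2n)² holds for every outcome of the sampling, so the number of passes is bounded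
surely and not just with high probability. -/
theorem halts_empiricalCov (hB : ColumnsAtMostOne B) (hp : ∀ i, 0 < p i ∧ p i < 1) (hε : 0 < ε)
    (hS : S.IsHermitian) (hK : n < K) {N : ℕ} (hN : 0 < N) :
    (empiricalCov N K ε B p (NormedSpace.exp S)).Halts (sampleSumCost m n N + (m ^ 2 + 1)) fun M =>
      M.PosSemidef ∧ (opNorm M ≠ 0 → ε / (6 * (2 * n) ^ 2) ≤ ε / (6 * opNorm M)) := by
  unfold empiricalCov
  refine (halts_sampleSum hB hp hε hS hK N).bind fun M hM => RComp.halts_step _ _ ?_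
  have hN' : (0 : ℝ) < N := by exact_mod_cast hN
  have hpos : ((1 / (N : ℝ)) • M).PosSemidef := hM.1.smul (by positivity)
  refine ⟨hpos, fun h => ?_⟩
  have hle : opNorm ((1 / (N : ℝ)) • M) ≤ (2 * n) ^ 2 := by
    refine hpos.opNorm_le (by positivity) fun v hv => ?_
    rw [smul_mulVec, dotProduct_smul, smul_eq_mul, one_div, inv_mul_le_iff₀ hN']
    exact hM.2 v hv
  have h0 : 0 < opNorm ((1 / (N : ℝ)) • M) := lt_of_le_of_ne (opNorm_nonneg _) (Ne.symm h)
  gcongr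

/-- The second moments of an entry of the sum over `N` samples. -/
theorem ex_sampleSum_sq (hB : ColumnsAtMostOne B) (hp : ∀ i, 0 < p i ∧ p i < 1) (hε : 0 < ε)
    (hS : S.IsHermitian) (hK : n < K) (j k : Fin m) {μ σ : ℝ} (hσ : 0 ≤ σ)
    (hone : ∀ a : ℝ, (oracle K ε B p (NormedSpace.exp S)).ex (fun z => ENNReal.ofReal
      (((B *ᵥ (z - meanVec p)) j * (B *ᵥ (z - meanVec p)) k + a) ^ 2)) =
        ENNReal.ofReal ((μ + a) ^ 2 + σ)) (N : ℕ) :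
    ∀ a : ℝ, (sampleSum K ε B p (NormedSpace.exp S) N).ex
      (fun M => ENNReal.ofReal ((M j k + a) ^ 2)) = ENNReal.ofReal ((N * μ + a) ^ 2 + N * σ) := by
  induction N with
  | zero => intro a; simp [sampleSum, RComp.ex_step]
  | succ N ih =>
    intro a
    rw [sampleSum]
    simp only [RComp.ex_bind, RComp.ex_step, Matrix.add_apply, vecMulVec_apply]
    -- The quantifier over all shifts a lets the new sample be absorbed into the shift. Knowing
    -- E(X+a)² for all a encodes mean and variance without signed expectations, and the variances of
    -- independent samples add.
    have h1 : ∀ z : Fin n → ℝ, (sampleSum K ε B p (NormedSpace.exp S) N).ex (fun M =>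
        ENNReal.ofReal (((B *ᵥ (z - meanVec p)) j * (B *ᵥ (z - meanVec p)) k + M j k + a) ^ 2)) =
        ENNReal.ofReal (((B *ᵥ (z - meanVec p)) j * (B *ᵥ (z - meanVec p)) k +
          (N * μ + a)) ^ 2) + ENNReal.ofReal (N * σ) := fun z => by
      have := ih ((B *ᵥ (z - meanVec p)) j * (B *ᵥ (z - meanVec p)) k + a)
      rw [ENNReal.ofReal_add (sq_nonneg _) (by positivity)] at this
      convert this using 4
      · ring
      · ring
    simp only [h1]
    rw [RComp.ex_add, hone, (halts_oracle hB hp hε hS.posSemidef_exp hK).ex_const,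
      ← ENNReal.ofReal_add (by positivity) (by positivity)]
    congr 1
    push_cast
    ring

/-- Here σ is the variance of the product of two entries of B(z - z_0); each entry is at most 2n in
absolute value. -/
theorem exists_ex_oracle_sq (hB : ColumnsAtMostOne B) (hp : ∀ i, 0 < p i ∧ p i < 1) (hε : 0 < ε)
    (hS : S.IsHermitian) (hK : n < K) (j k : Fin m) :
    ∃ σ : ℝ, 0 ≤ σ ∧ σ ≤ (2 * n) ^ 4 ∧ ∀ a : ℝ,
      (oracle K ε B p (NormedSpace.exp S)).ex (fun z => ENNReal.ofReal
        (((B *ᵥ (z - meanVec p)) j * (B *ᵥ (z - meanVec p)) k + a) ^ 2)) =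
        ENNReal.ofReal ((covMat B (oracleLaw K ε B p (NormedSpace.exp S)) j k + a) ^ 2 + σ) := by
  have h := vertexLaw_oracleLaw hB hp hε hS.posSemidef_exp hK
  have hO := halts_oracle hB hp hε hS.posSemidef_exp hK
  set D := oracleLaw K ε B p (NormedSpace.exp S) with hD
  set X : (Fin n → ℝ) → ℝ := fun z => (B *ᵥ (z - meanVec p)) j * (B *ᵥ (z - meanVec p)) k with hX
  have hXc : Continuous X := (VertexLaw.continuous_mulVec_sub_apply p B j).mul
    (VertexLaw.continuous_mulVec_sub_apply p B k)
  have hμ : covMat B D j k = ∫ z, X z ∂D.toMeasure := h.covMat_apply hp B j k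
  set μ := covMat B D j k
  have hexp : ∀ a, ∫ z, (X z + a) ^ 2 ∂D.toMeasure =
      ∫ z, X z ^ 2 ∂D.toMeasure + (2 * a * μ + a ^ 2) := fun a => by
    have e : ∀ z, (X z + a) ^ 2 = X z ^ 2 + (2 * a * X z + a ^ 2) := fun z => by ring
    simp only [e]
    have i1 : Integrable (fun z => X z ^ 2) D.toMeasure := h.integrable (hXc.pow 2)
    have i2 : Integrable (fun z => 2 * a * X z) D.toMeasure := (h.integrable hXc).const_mul _
    have i3 : Integrable (fun z => 2 * a * X z + a ^ 2) D.toMeasure :=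
      i2.add (integrable_const _)
    rw [integral_add i1 i3, integral_add i2 (integrable_const _), integral_const_mul, ← hμ]
    simp
  have hvar : 0 ≤ ∫ z, X z ^ 2 ∂D.toMeasure - μ ^ 2 := by
    have h1 : 0 ≤ ∫ z, (X z + -μ) ^ 2 ∂D.toMeasure := integral_nonneg fun z => sq_nonneg _
    rw [hexp] at h1
    linarith
  refine ⟨∫ z, X z ^ 2 ∂D.toMeasure - μ ^ 2, hvar, ?_, fun a => ?_⟩
  · have hle : ∫ z, X z ^ 2 ∂D.toMeasure ≤ ∫ _z, ((2 * n) ^ 4 : ℝ) ∂D.toMeasure := by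
      refine integral_mono_ae (h.integrable (hXc.pow 2)) (integrable_const _) ?_
      filter_upwards [h.ae_vertex] with z hz
      have h1 := abs_mulVec_sub_apply_le hB hp hz j
      have h2 := abs_mulVec_sub_apply_le hB hp hz k
      have h3 : |X z| ≤ (2 * n) * (2 * n) := by
        rw [hX, abs_mul]
        exact mul_le_mul h1 h2 (abs_nonneg _) (by positivity)
      rw [← sq_abs]
      calc _ ≤ ((2 * n) * (2 * n) : ℝ) ^ 2 := pow_le_pow_left₀ (abs_nonneg _) h3 2
        _ = _ := by ring
    simp only [integral_const, probReal_univ, one_smul] at hle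
    linarith [sq_nonneg μ]
  · rw [← hO.expect_law 0]
    change D.expect (fun z => ENNReal.ofReal ((X z + a) ^ 2)) = _
    have hc : Continuous fun z => (X z + a) ^ 2 := (hXc.add continuous_const).pow 2
    rw [h.expect_ofReal hc fun z => sq_nonneg _, hexp]
    congr 1
    ring

/-- The expected error of the empirical covariance matrix. -/
theorem ex_entrySum_empiricalCov_le (hB : ColumnsAtMostOne B) (hp : ∀ i, 0 < p i ∧ p i < 1)
    (hε : 0 < ε) (hS : S.IsHermitian) (hK : n < K) {N : ℕ} (hN : 0 < N) {τ : ℝ} (hτ : 0 < τ) :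
    (empiricalCov N K ε B p (NormedSpace.exp S)).ex (fun M => ENNReal.ofReal
      (entrySum (M - covMat B (oracleLaw K ε B p (NormedSpace.exp S))))) ≤
      ENNReal.ofReal (m ^ 2 * ((2 * n) ^ 4 / (2 * τ * N) + τ / 2)) := by
  set C := covMat B (oracleLaw K ε B p (NormedSpace.exp S)) with hC
  have hN' : (0 : ℝ) < N := by exact_mod_cast hN
  have hsum := halts_sampleSum hB hp hε hS hK N
  have hentry : ∀ j k, (sampleSum K ε B p (NormedSpace.exp S) N).ex
      (fun M => ENNReal.ofReal |((1 / (N : ℝ)) • M - C) j k|) ≤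
      ENNReal.ofReal ((2 * n) ^ 4 / (2 * τ * N) + τ / 2) := fun j k => by
    obtain ⟨σ, hσ, hσ', hone⟩ := exists_ex_oracle_sq hB hp hε hS hK j k
    -- This shift cancels the mean of the sum, leaving only the variance Nσ.
    have hsq := ex_sampleSum_sq hB hp hε hS hK j k hσ hone N (-(N * C j k))
    rw [add_neg_cancel, zero_pow two_ne_zero, zero_add] at hsq
    calc _ ≤ (sampleSum K ε B p (NormedSpace.exp S) N).ex (fun M =>
          ENNReal.ofReal (1 / (2 * τ * N ^ 2)) * ENNReal.ofReal ((M j k + -(N * C j k)) ^ 2) +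
            ENNReal.ofReal (τ / 2)) := by
          refine hsum.ex_mono fun M _ => ?_
          rw [← ENNReal.ofReal_mul (by positivity),
            ← ENNReal.ofReal_add (by positivity) (by positivity)]
          apply ENNReal.ofReal_le_ofReal
          rw [Matrix.sub_apply, Matrix.smul_apply, smul_eq_mul]
          set x := 1 / (N : ℝ) * M j k - C j k with hx
          have e : 1 / (2 * τ * N ^ 2) * (M j k + -(N * C j k)) ^ 2 = x ^ 2 / (2 * τ) := by
            rw [hx]
            field_simp
            ring
          rw [e, div_add_div _ _ (by positivity) two_ne_zero, le_div_iff₀ (by positivity)]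
          -- The bound |x| ≤ x²/(2τ) + τ/2 passes from second to first moments without square roots;
          -- τ is chosen later.
          nlinarith [sq_nonneg (|x| - τ), sq_abs x]
      _ = ENNReal.ofReal (1 / (2 * τ * N ^ 2) * (N * σ) + τ / 2) := by
          rw [RComp.ex_add, RComp.ex_const_mul, hsq, hsum.ex_const,
            ENNReal.ofReal_add (by positivity) (by positivity),
            ENNReal.ofReal_mul (p := 1 / (2 * τ * N ^ 2)) (by positivity)]
      _ ≤ _ := by
          apply ENNReal.ofReal_le_ofReal
          have e : 1 / (2 * τ * N ^ 2) * (N * σ) = σ / (2 * τ * N) := by field_simp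
          rw [e]
          gcongr
  unfold empiricalCov
  simp only [RComp.ex_bind, RComp.ex_step]
  have e : ∀ M : Matrix (Fin m) (Fin m) ℝ, ENNReal.ofReal (entrySum M) =
      ∑ j, ∑ k, ENNReal.ofReal |M j k| := fun M => by
    unfold entrySum
    refine (ENNReal.ofReal_sum_of_nonneg fun j _ => Finset.sum_nonneg fun k _ =>
      abs_nonneg (M j k)).trans ?_
    exact Finset.sum_congr rfl fun j _ =>
      ENNReal.ofReal_sum_of_nonneg fun k _ => abs_nonneg (M j k)
  simp only [e, RComp.ex_finsetSum]
  calc _ ≤ ∑ _j : Fin m, ∑ _k : Fin m, ENNReal.ofReal ((2 * n) ^ 4 / (2 * τ * N) + τ / 2) :=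
        Finset.sum_le_sum fun j _ => Finset.sum_le_sum fun k _ => hentry j k
    _ = _ := by
        simp only [Finset.sum_const, Finset.card_univ, Fintype.card_fin, nsmul_eq_mul]
        rw [ENNReal.ofReal_mul (by positivity), ENNReal.ofReal_pow (by positivity),
          ENNReal.ofReal_natCast, sq, mul_assoc (m : ℝ≥0∞)]

end

/-! ### Polynomial bounds -/

section Bounds

theorem oracleCost_le {q : ℝ} (hq : 1 ≤ q) (hmn : (m : ℝ) + n ≤ q) :
    (oracleCost m n : ℝ) ≤ 33 * q ^ 4 := by
  have hm0 : (0 : ℝ) ≤ m := Nat.cast_nonneg m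
  have hn0 : (0 : ℝ) ≤ n := Nat.cast_nonneg n
  have hm : (m : ℝ) ≤ q := by linarith
  have hn : (n : ℝ) ≤ q := by linarith
  have hq0 : 0 ≤ q := by linarith
  have hpow : ∀ {a b : ℕ}, a ≤ b → q ^ a ≤ q ^ b := fun h => pow_le_pow_right₀ hq h
  have hq1 : ∀ b : ℕ, 1 ≤ q ^ b := fun b => one_le_pow₀ hq
  have hqb : ∀ b : ℕ, 1 ≤ b → q ≤ q ^ b := fun b hb => by simpa using hpow hb
  have m3 : (m : ℝ) ^ 3 ≤ q ^ 3 := by gcongr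
  have mn : (m : ℝ) * n ≤ q ^ 2 := by rw [sq]; gcongr
  have mnn : (m : ℝ) * n ^ 2 ≤ q ^ 3 := by rw [pow_succ' q 2]; gcongr
  have mmn : (m : ℝ) * m * n ≤ q ^ 3 := by
    calc (m : ℝ) * m * n ≤ q * q * q := by gcongr
      _ = q ^ 3 := by ring
  have mn3 : ((m : ℝ) + n) ^ 3 ≤ q ^ 3 := by gcongr
  have hwalk : (RandomWalk.passCost m n : ℝ) ≤ 13 * q ^ 3 := by
    unfold RandomWalk.passCost
    push_cast
    linarith [hpow (show 2 ≤ 3 by norm_num), hqb 3 (by norm_num), hq1 3]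
  unfold oracleCost
  push_cast
  have h1 : ((n : ℝ) + 1) * (RandomWalk.passCost m n + 1) ≤ (2 * q) * (14 * q ^ 3) := by
    gcongr
    · linarith
    · linarith [hq1 3]
  have h2 : (2 * q) * (14 * q ^ 3) = 28 * q ^ 4 := by ring
  linarith [hpow (show 3 ≤ 4 by norm_num), hqb 4 (by norm_num)]

/-- The exponent is 6 for the number of passes plus 12 for a pass, whose dominant term is the
sampling from up to `R` items at quadratic cost. -/
theorem runCost_le {q : ℝ} (hq : 1 ≤ q) (hmn : (m : ℝ) + n ≤ q) {N TC R : ℕ} (hN : 1 ≤ N)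
    (hTC : (TC : ℝ) ≤ N * (45 * q ^ 4)) (hR : (R : ℝ) ≤ 50 * q ^ 6) :
    (runCost m n TC R : ℝ) ≤ N * (150000 * q ^ 18) := by
  have hN' : (1 : ℝ) ≤ N := by exact_mod_cast hN
  have hm0 : (0 : ℝ) ≤ m := Nat.cast_nonneg m
  have hn0 : (0 : ℝ) ≤ n := Nat.cast_nonneg n
  have hm : (m : ℝ) ≤ q := by linarith
  have hn : (n : ℝ) ≤ q := by linarith
  have hq0 : 0 ≤ q := by linarith
  have hpow : ∀ {a b : ℕ}, a ≤ b → q ^ a ≤ q ^ b := fun h => pow_le_pow_right₀ hq h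
  have hq1 : ∀ b : ℕ, 1 ≤ q ^ b := fun b => one_le_pow₀ hq
  have hqb : ∀ b : ℕ, 1 ≤ b → q ≤ q ^ b := fun b hb => by simpa using hpow hb
  have m2 : (m : ℝ) ^ 2 ≤ q ^ 2 := by gcongr
  have m3 : (m : ℝ) ^ 3 ≤ q ^ 3 := by gcongr
  have mn : (m : ℝ) * n ≤ q ^ 2 := by rw [sq]; gcongr
  have mmn : (m : ℝ) * m * n ≤ q ^ 3 := by
    calc (m : ℝ) * m * n ≤ q * q * q := by gcongr
      _ = q ^ 3 := by ring
  have horacle := oracleCost_le hq hmn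
  have hRR : (R : ℝ) * (R + 4) ≤ 2700 * q ^ 12 := by
    calc (R : ℝ) * (R + 4) ≤ (50 * q ^ 6) * (54 * q ^ 6) := by
          gcongr
          linarith [hq1 6]
      _ = _ := by ring
  have hNpow : ∀ b : ℕ, q ^ b ≤ N * q ^ b := fun b =>
    le_mul_of_one_le_left (by positivity) hN'
  have hpass : (passCost m n (oracleCost m n) TC R : ℝ) ≤ N * (2800 * q ^ 12) := by
    unfold passCost
    push_cast
    have hN4 : (N : ℝ) * q ^ 4 ≤ N * q ^ 12 := by
      gcongr
      norm_num
    linarith [hpow (show 2 ≤ 12 by norm_num), hpow (show 3 ≤ 12 by norm_num),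
      hpow (show 4 ≤ 12 by norm_num), hqb 12 (by norm_num), hq1 12, hNpow 12]
  have hloop : (R : ℝ) * (passCost m n (oracleCost m n) TC R + 1) ≤ N * (140050 * q ^ 18) := by
    calc (R : ℝ) * (passCost m n (oracleCost m n) TC R + 1) ≤
          (50 * q ^ 6) * (N * (2801 * q ^ 12)) := by
          gcongr
          linarith [hq1 12, hNpow 12]
      _ = _ := by ring
  unfold runCost
  push_cast
  linarith [hpow (show 2 ≤ 18 by norm_num), hpow (show 3 ≤ 18 by norm_num),
    hqb 18 (by norm_num), hq1 18, hNpow 18]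

theorem sampleCost_le {q : ℝ} (hq : 1 ≤ q) (hmn : (m : ℝ) + n ≤ q) {N : ℕ} (hN : 1 ≤ N) :
    ((sampleSumCost m n N + (m ^ 2 + 1) : ℕ) : ℝ) ≤ N * (45 * q ^ 4) := by
  have hN' : (1 : ℝ) ≤ N := by exact_mod_cast hN
  have hm0 : (0 : ℝ) ≤ m := Nat.cast_nonneg m
  have hn0 : (0 : ℝ) ≤ n := Nat.cast_nonneg n
  have hm : (m : ℝ) ≤ q := by linarith
  have hn : (n : ℝ) ≤ q := by linarith
  have hq0 : 0 ≤ q := by linarith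
  have hpow : ∀ {a b : ℕ}, a ≤ b → q ^ a ≤ q ^ b := fun h => pow_le_pow_right₀ hq h
  have hq1 : ∀ b : ℕ, 1 ≤ q ^ b := fun b => one_le_pow₀ hq
  have hqb : ∀ b : ℕ, 1 ≤ b → q ≤ q ^ b := fun b hb => by simpa using hpow hb
  have m2 : (m : ℝ) ^ 2 ≤ q ^ 2 := by gcongr
  have mn : (m : ℝ) * n ≤ q ^ 2 := by rw [sq]; gcongr
  have horacle := oracleCost_le hq hmn
  unfold sampleSumCost
  push_cast
  have h1 : (oracleCost m n : ℝ) + (2 * m * n + 3 * n) + 2 * m ^ 2 ≤ 40 * q ^ 4 := by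
    linarith [hpow (show 2 ≤ 4 by norm_num), hqb 4 (by norm_num)]
  have h2 := mul_le_mul_of_nonneg_left h1 (show (0 : ℝ) ≤ N by linarith)
  have h3 : q ^ 4 ≤ N * q ^ 4 := le_mul_of_one_le_left (by positivity) hN'
  linarith [hpow (show 2 ≤ 4 by norm_num), hq1 4]

theorem log_natCast_le (m : ℕ) : Real.log m ≤ m :=
  Real.log_le_self (Nat.cast_nonneg m)

end Bounds

end MWU

/-! ### The two versions of the algorithm -/

namespace MWU

open Matrix RandomWalk

variable {m n : ℕ} {B : Matrix (Fin m) (Fin n) ℝ} {p : Fin n → ℝ} {ε : ℝ}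

theorem threshold_eq_zero_of_eta {η : ℝ} (h : η = 0) : threshold m ε η = 0 := by
  simp [threshold, h]

theorem natCast_pos_of_eta_pos (hB : ColumnsAtMostOne B) (hp : ∀ i, 0 < p i ∧ p i < 1)
    (hε : 0 < ε) (hη : 0 < eta ε B p) : (0 : ℝ) < n := by
  have h1 : 0 < min (bernoulliValue B p) (1 + 1 / ε) := by
    by_contra h
    exact absurd hη (not_lt.2 (mul_nonpos_of_nonneg_of_nonpos (by linarith) (not_lt.1 h)))
  exact (h1.trans_le (min_le_left _ _)).trans_le (bernoulliValue_le hB hp)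

theorem withExactCov_spec (hB : ColumnsAtMostOne B) (hp : ∀ i, 0 < p i ∧ p i < 1) (hε : 0 < ε)
    (hε1 : ε < 1) {K : ℕ} (hK : 100000000 * (m + n + 1 / ε) ^ 24 ≤ K) :
    (withExactCov K ε B p).StepsAtMost (100000000 * (m + n + 1 / ε) ^ 24) ∧
      ReturnsGoodAssignment ε B p (withExactCov K ε B p) := by
  obtain ⟨x, hx⟩ : ∃ x : ℝ, x = m + n + 1 / ε := ⟨_, rfl⟩
  rw [← hx] at hK ⊢
  have hm0 : (0 : ℝ) ≤ m := Nat.cast_nonneg m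
  have hn0 : (0 : ℝ) ≤ n := Nat.cast_nonneg n
  have hinv : 1 < 1 / ε := by rw [lt_div_iff₀ hε]; linarith
  have hx1 : 1 ≤ x := by linarith
  have hmx : (m : ℝ) ≤ x := by linarith
  have hnx : (n : ℝ) ≤ x := by linarith
  have hix : 1 / ε ≤ x := by linarith
  have hpow : ∀ {a b : ℕ}, a ≤ b → x ^ a ≤ x ^ b := fun h => pow_le_pow_right₀ hx1 h
  -- The threshold 2 ln m/(εη) divided by the least step ε/(6n²η), with ln m ≤ m; η cancels.
  set r : ℕ := ⌈12 * (n : ℝ) ^ 2 * m * (1 / ε) ^ 2⌉₊ with hr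
  have hrle : ((r + 1 : ℕ) : ℝ) ≤ 50 * x ^ 6 := by
    have h1 : (r : ℝ) < 12 * (n : ℝ) ^ 2 * m * (1 / ε) ^ 2 + 1 := Nat.ceil_lt_add_one (by positivity)
    have h2 : 12 * (n : ℝ) ^ 2 * m * (1 / ε) ^ 2 ≤ 12 * x ^ 2 * x * x ^ 2 := by gcongr
    have h3 : 12 * x ^ 2 * x * x ^ 2 = 12 * x ^ 5 := by ring
    push_cast
    linarith [hpow (show 5 ≤ 6 by norm_num), one_le_pow₀ (n := 6) hx1]
  have hnK : n < K := by
    have h1 : x ≤ x ^ 24 := by simpa using hpow (show 1 ≤ 24 by norm_num)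
    have : (n : ℝ) < K := by linarith
    exact_mod_cast this
  have hrK : r < K := by
    have : (r : ℝ) < K := by
      push_cast at hrle
      linarith [hpow (show 6 ≤ 24 by norm_num), one_le_pow₀ (n := 6) hx1]
    exact_mod_cast this
  have hη0 := eta_nonneg hε B p
  have hspec := run_spec (B := B) (p := p) (cov := exactCov K ε B p) (TC := m ^ 2)
    (amin := ε / (6 * (n * (n * eta ε B p)))) (ξ := 0) hB hp hε hε1 hnK hrK ?_ ?_ le_rfl ?_ ?_
  · refine ⟨hspec.1.stepsAtMost ?_, hspec.2⟩
    refine (runCost_le hx1 (by linarith) (N := 1) le_rfl ?_ hrle).trans ?_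
    · push_cast
      have : (m : ℝ) ^ 2 ≤ x ^ 2 := by gcongr
      linarith [hpow (show 2 ≤ 4 by norm_num), one_le_pow₀ (n := 4) hx1]
    · push_cast
      linarith [hpow (show 18 ≤ 24 by norm_num), one_le_pow₀ (n := 24) hx1]
  · intro S hS
    have hlaw := vertexLaw_oracleLaw hB hp hε hS.posSemidef_exp hnK
    refine RComp.halts_step _ _ ⟨hlaw.posSemidef_covMat hp B, fun h0 => ?_⟩
    have hle : opNorm (covMat B (oracleLaw K ε B p (NormedSpace.exp S))) ≤
        n * (n * eta ε B p) :=
      (hlaw.opNorm_covMat_le hp B).trans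
        (mul_le_mul_of_nonneg_left (bernoulliValue_le_mul_eta hB hp hε) hn0)
    have hpos : 0 < opNorm (covMat B (oracleLaw K ε B p (NormedSpace.exp S))) :=
      lt_of_le_of_ne (opNorm_nonneg _) (Ne.symm h0)
    change _ ≤ ε / (6 * opNorm (covMat B (oracleLaw K ε B p (NormedSpace.exp S))))
    gcongr
  -- For η = 0 the threshold is a division by zero, hence 0, and any number of passes will do.
  · rcases hη0.eq_or_lt with h | h
    · rw [threshold_eq_zero_of_eta h.symm]
      positivity
    · have hn := natCast_pos_of_eta_pos hB hp hε h
      have h1 : 12 * (n : ℝ) ^ 2 * m * (1 / ε) ^ 2 ≤ r + 1 := (Nat.le_ceil _).trans (by linarith)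
      have h2 : 12 * (n : ℝ) ^ 2 * m ≤ (r + 1) * ε ^ 2 := by
        have := mul_le_mul_of_nonneg_right h1 (sq_nonneg ε)
        calc _ = 12 * (n : ℝ) ^ 2 * m * (1 / ε) ^ 2 * ε ^ 2 := by field_simp
          _ ≤ _ := this
      have h3 := log_natCast_le m
      rw [threshold, div_le_iff₀ (by positivity)]
      have e : (r + 1 : ℝ) * (ε / (6 * (n * (n * eta ε B p)))) * (ε * eta ε B p) =
          (r + 1) * ε ^ 2 / (6 * n ^ 2) := by
        field_simp
      rw [e, le_div_iff₀ (by positivity)]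
      nlinarith [mul_le_mul_of_nonneg_left h3 (sq_nonneg (n : ℝ))]
  · intro _ S hS
    change (RComp.step (m ^ 2) (covMat B (oracleLaw K ε B p (NormedSpace.exp S)))).ex _ ≤ _
    rw [RComp.ex_step, sub_self]
    simp [entrySum]
  · simp only [mul_zero]
    positivity

theorem withSampledCov_spec (hB : ColumnsAtMostOne B) (hp : ∀ i, 0 < p i ∧ p i < 1) (hε : 0 < ε)
    (hε1 : ε < 1) {N K : ℕ}
    (hN : 100000000 * (m + n + 1 / ε + 1 / eta ε B p) ^ 24 ≤ N)
    (hK : 100000000 * (m + n + 1 / ε + 1 / eta ε B p) ^ 24 ≤ K) :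
    (withSampledCov N K ε B p).StepsAtMost
        (N * (100000000 * (m + n + 1 / ε + 1 / eta ε B p) ^ 24)) ∧
      ReturnsGoodAssignment ε B p (withSampledCov N K ε B p) := by
  have hη0 := eta_nonneg hε B p
  set η := eta ε B p with hη
  obtain ⟨x, hx⟩ : ∃ x : ℝ, x = m + n + 1 / ε + 1 / η := ⟨_, rfl⟩
  rw [← hx] at hN hK ⊢
  have hm0 : (0 : ℝ) ≤ m := Nat.cast_nonneg m
  have hn0 : (0 : ℝ) ≤ n := Nat.cast_nonneg n
  have hinv : 1 < 1 / ε := by rw [lt_div_iff₀ hε]; linarith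
  have hinvη : 0 ≤ 1 / η := by positivity
  have hx1 : 1 ≤ x := by linarith
  have hmx : (m : ℝ) ≤ x := by linarith
  have hnx : (n : ℝ) ≤ x := by linarith
  have hix : 1 / ε ≤ x := by linarith
  have hηx : 1 / η ≤ x := by linarith
  have hpow : ∀ {a b : ℕ}, a ≤ b → x ^ a ≤ x ^ b := fun h => pow_le_pow_right₀ hx1 h
  have hN1 : 1 ≤ N := by
    have : (1 : ℝ) ≤ N := by linarith [one_le_pow₀ (n := 24) hx1]
    exact_mod_cast this
  have hNpos : (0 : ℝ) < N := by exact_mod_cast hN1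
  -- The same quotient with the least step ε/(6(2n)²), which is not proportional to 1/η; so 1/η
  -- remains.
  set r : ℕ := ⌈48 * (n : ℝ) ^ 2 * m * (1 / ε) ^ 2 * (1 / η)⌉₊ with hr
  have hrle : ((r + 1 : ℕ) : ℝ) ≤ 50 * x ^ 6 := by
    have h1 : (r : ℝ) < 48 * (n : ℝ) ^ 2 * m * (1 / ε) ^ 2 * (1 / η) + 1 :=
      Nat.ceil_lt_add_one (by positivity)
    have h2 : 48 * (n : ℝ) ^ 2 * m * (1 / ε) ^ 2 * (1 / η) ≤ 48 * x ^ 2 * x * x ^ 2 * x := by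
      gcongr
    have h3 : 48 * x ^ 2 * x * x ^ 2 * x = 48 * x ^ 6 := by ring
    push_cast
    linarith [one_le_pow₀ (n := 6) hx1]
  have hnK : n < K := by
    have h1 : x ≤ x ^ 24 := by simpa using hpow (show 1 ≤ 24 by norm_num)
    have : (n : ℝ) < K := by linarith
    exact_mod_cast this
  have hrK : r < K := by
    have : (r : ℝ) < K := by
      push_cast at hrle
      linarith [hpow (show 6 ≤ 24 by norm_num), one_le_pow₀ (n := 6) hx1]
    exact_mod_cast this
  have hthr : threshold m ε η ≤ (r + 1) * (ε / (6 * (2 * n) ^ 2)) := by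
    rcases hη0.eq_or_lt with h | h
    · rw [threshold_eq_zero_of_eta h.symm]
      positivity
    · have hn := natCast_pos_of_eta_pos hB hp hε h
      have h1 : 48 * (n : ℝ) ^ 2 * m * (1 / ε) ^ 2 * (1 / η) ≤ r + 1 :=
        (Nat.le_ceil _).trans (by linarith)
      have h2 : 48 * (n : ℝ) ^ 2 * m ≤ (r + 1) * (ε ^ 2 * η) := by
        have := mul_le_mul_of_nonneg_right h1 (show 0 ≤ ε ^ 2 * η by positivity)
        calc _ = 48 * (n : ℝ) ^ 2 * m * (1 / ε) ^ 2 * (1 / η) * (ε ^ 2 * η) := by field_simp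
          _ ≤ _ := this
      have h3 := log_natCast_le m
      rw [threshold, div_le_iff₀ (by positivity)]
      have e : (r + 1 : ℝ) * (ε / (6 * (2 * n) ^ 2)) * (ε * η) =
          (r + 1) * (ε ^ 2 * η) / (24 * n ^ 2) := by
        field_simp
        ring
      rw [e, le_div_iff₀ (by positivity)]
      nlinarith [mul_le_mul_of_nonneg_left h3 (sq_nonneg (n : ℝ))]
  have hsteps : (runCost m n (sampleSumCost m n N + (m ^ 2 + 1)) (r + 1) : ℝ) ≤
      N * (100000000 * x ^ 24) := by
    have hmn : (m : ℝ) + n ≤ x := by linarith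
    refine (runCost_le hx1 hmn hN1 (sampleCost_le hx1 hmn hN1) hrle).trans ?_
    gcongr
    · norm_num
    · norm_num
  obtain ⟨ξ, hξ0, hξ, herror⟩ : ∃ ξ : ℝ, 0 ≤ ξ ∧ 3 * (r + 1) * ξ ≤ ε * η / 10 ∧
      (0 < η → ∀ S : Matrix (Fin m) (Fin m) ℝ, S.IsHermitian →
        (empiricalCov N K ε B p (NormedSpace.exp S)).ex (fun M => ENNReal.ofReal
          (entrySum (M - covMat B (oracleLaw K ε B p (NormedSpace.exp S))))) ≤
          ENNReal.ofReal ξ) := by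
    rcases hη0.eq_or_lt with h | h
    · refine ⟨0, le_rfl, by rw [← h]; simp, fun h' => absurd h h'.ne⟩
    · set R : ℝ := r + 1 with hR
      have hRpos : 0 < R := by positivity
      -- With this τ the term τ/2 uses at most half of the budget εη/10; m² + 1 in place of m²
      -- avoids a zero denominator.
      set τ : ℝ := ε * η / (30 * R * (m ^ 2 + 1)) with hτ
      have hτpos : 0 < τ := by positivity
      refine ⟨m ^ 2 * ((2 * n) ^ 4 / (2 * τ * N) + τ / 2), by positivity, ?_, fun _ S hS =>
        ex_entrySum_empiricalCov_le hB hp hε hS hnK hN1 hτpos⟩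
      have hτm : 3 * R * (m ^ 2 * (τ / 2)) ≤ ε * η / 20 := by
        have e : 3 * R * (m ^ 2 * (τ / 2)) = ε * η / 20 * (m ^ 2 / (m ^ 2 + 1)) := by
          rw [hτ]
          field_simp
          ring
        rw [e]
        refine mul_le_of_le_one_right (by positivity) ?_
        rw [div_le_one (by positivity)]
        linarith
      -- This makes the variance term fit into the other half of the budget. It is the source of the
      -- exponent 24 = 12 + 4 + 4 + 4, from R², the powers of m and of n, and (1/(εη))².
      have hNbig : 14400 * R ^ 2 * (m ^ 2 * (m ^ 2 + 1)) * n ^ 4 * ((1 / ε) * (1 / η)) ^ 2 ≤ N := by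
        have hRx : R ≤ 50 * x ^ 6 := by
          push_cast at hrle
          exact hrle
        have hm1 : (m : ℝ) ^ 2 + 1 ≤ 2 * x ^ 2 := by
          have : (m : ℝ) ^ 2 ≤ x ^ 2 := by gcongr
          linarith [one_le_pow₀ (n := 2) hx1]
        calc _ ≤ 14400 * (50 * x ^ 6) ^ 2 * (x ^ 2 * (2 * x ^ 2)) * x ^ 4 * (x * x) ^ 2 := by
              gcongr
          _ = 72000000 * x ^ 24 := by ring
          _ ≤ _ := by linarith [one_le_pow₀ (n := 24) hx1]
      have hfirst : 3 * R * (m ^ 2 * ((2 * n) ^ 4 / (2 * τ * N))) ≤ ε * η / 20 := by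
        have e : 3 * R * (m ^ 2 * ((2 * n) ^ 4 / (2 * τ * N))) =
            ε * η / 20 * (14400 * R ^ 2 * (m ^ 2 * (m ^ 2 + 1)) * n ^ 4 *
              ((1 / ε) * (1 / η)) ^ 2 / N) := by
          rw [hτ]
          field_simp
          ring
        rw [e]
        refine mul_le_of_le_one_right (by positivity) ?_
        rwa [div_le_one hNpos]
      calc _ = 3 * R * (m ^ 2 * ((2 * n) ^ 4 / (2 * τ * N))) + 3 * R * (m ^ 2 * (τ / 2)) := by ring
        _ ≤ _ := by linarith
  have hspec := run_spec (B := B) (p := p) (cov := empiricalCov N K ε B p) hB hp hε hε1 hnK hrK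
    (fun S hS => halts_empiricalCov hB hp hε hS hnK hN1) hthr hξ0 herror hξ
  exact ⟨hspec.1.stepsAtMost hsteps, hspec.2⟩

end MWU

theorem theorem2 :
    ∃ C k : ℕ, ∀ (m n : ℕ) (B : Matrix (Fin m) (Fin n) ℝ) (p : Fin n → ℝ) (ε : ℝ),
      ColumnsAtMostOne B → (∀ i, 0 < p i ∧ p i < 1) → 0 < ε → ε < 1 →
      -- explicit covariance matrices
      (∀ K : ℕ, C * (m + n + 1 / ε) ^ k ≤ (K : ℝ) →
        (MWU.withExactCov K ε B p).StepsAtMost (C * (m + n + 1 / ε) ^ k) ∧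
        ReturnsGoodAssignment ε B p (MWU.withExactCov K ε B p)) ∧
      -- empirical covariance matrices
      (∀ N K : ℕ, C * (m + n + 1 / ε + 1 / MWU.eta ε B p) ^ k ≤ (N : ℝ) →
        C * (m + n + 1 / ε + 1 / MWU.eta ε B p) ^ k ≤ (K : ℝ) →
        (MWU.withSampledCov N K ε B p).StepsAtMost
          (N * (C * (m + n + 1 / ε + 1 / MWU.eta ε B p) ^ k)) ∧
        ReturnsGoodAssignment ε B p (MWU.withSampledCov N K ε B p)) := by
  refine ⟨100000000, 24, fun m n B p ε hB hp hε hε1 => ⟨fun K hK => ?_, fun N K hN hK => ?_⟩⟩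
  · push_cast at hK ⊢
    exact MWU.withExactCov_spec hB hp hε hε1 hK
  · push_cast at hN hK ⊢
    exact MWU.withSampledCov_spec hB hp hε hε1 hN hK
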